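/- Let $(W,S)$ be a Coxeter system with length function $\ell$. Its roots are the half-spaces $w\alpha_s$ ($w\in W$, $s\in S$), where $\alpha_s=\{v\in W\mid \ell(sv)>\ell(v)\}$; let $\Phi$ be the set of roots, $-\alpha=W\setminus\alpha$, $\Phi_+=\{\alpha\in\Phi\mid 1\in\alpha\}$, $\Phi_-=\Phi\setminus\Phi_+$. A pair $\{\alpha,\beta\}$ is prenilpotent if $\alpha\cap\beta\neq\emptyset\neq(-\alpha)\cap(-\beta)$, and then $]\alpha,\beta[$ is the set of roots $\gamma\ne\alpha,\beta$ with $\alpha\cap\beta\subseteq\gamma$ and $(-\alpha)\cap(-\beta)\subseteq-\gamma$. Let $(G,\{U_\alpha\}_{\alpha\in\Phi},T)$ be an RGD system of type $(W,S)$: $G$ is a group with subgroups $U_\alpha$ and $T$ such that, with $U_\pm=\langle U_\alpha\mid\alpha\in\Phi_\pm\rangle$, (0) $U_\alpha\ne 1$ for all $\alpha\in\Phi$; (1) $[U_\alpha,U_\beta]\subseteq\langle U_\gamma\mid\gamma\in{]\alpha,\beta[}\rangle$ for every prenilpotent pair of distinct roots; (2) for every $s\in S$ and every $u\in U_{\alpha_s}\setminus\{1\}$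 there is an element $\mu(u)\in U_{-\alpha_s}uU_{-\alpha_s}$ with $\mu(u)U_\beta\mu(u)^{-1}=U_{s\beta}$ for all $\beta\in\Phi$, and these elements satisfy $\mu(u)^{-1}\mu(v)\in T$ for all $u,v\in U_{\alpha_s}\setminus\{1\}$; (3) $U_{-\alpha_s}\not\subseteq U_+$ for all $s\in S$; (4) $G=T\langle U_\alpha\mid\alpha\in\Phi\rangle$; (5) $T$ normalizes every $U_\alpha$. Put $B_\pm=TU_\pm$ and $N=T\langle\mu(u)\mid u\in U_{\alpha_s}\setminus\{1\},\,s\in S\rangle$, and identify $N/T$ with $W$ via $\mu(u)T\mapsto s$ for $u\in U_{\alpha_s}\setminus\{1\}$. The associated twin building $\mathcal C$ has chambers $\mathcal C_\pm=G/B_\pm$; the distances $\delta_\varepsilon$ and the codistance $\delta^*$ are given by $\delta_\varepsilon(gB_\varepsilon,hB_\varepsilon)=w\iff g^{-1}h\in B_\varepsilon wB_\varepsilon$ and $\delta^*(gB_\varepsilon,hB_{-\varepsilon})=w\iff g^{-1}h\in B_\varepsilon wB_{-\varepsilon}$. Chambers of different sign are opposite if their codistance is $1$. A twin apartment is a pair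 $\Sigma=(\Sigma_+,\Sigma_-)$ of apartments $\Sigma_\pm\subseteq\mathcal C_\pm$ (subsets isometric to $W$ with distance $(v,w)\mapsto v^{-1}w$) such that every chamber of $\Sigma_+\cup\Sigma_-$ is opposite to precisely one chamber of $\Sigma_+\cup\Sigma_-$. For a spherical residue $R\subseteq\mathcal C_\varepsilon$ and a chamber $d\in\mathcal C_{-\varepsilon}$, $\mathrm{proj}_R(d)$ is the chamber of $R$ whose codistance from $d$ has maximal length; spherical residues $R\subseteq\mathcal C_\varepsilon$ and $Q\subseteq\mathcal C_{-\varepsilon}$ are parallel if $\mathrm{proj}_R(Q)=R$ and $\mathrm{proj}_Q(R)=Q$. Let $\theta$ be a quasi-flip of $G$, i.e. an automorphism of $G$ with $\theta^2=\mathrm{id}$ such that $\theta(B_+)$ is a $G$-conjugate of $B_-$. It acts on the chambers of $\mathcal C$ by $gB_\varepsilon\mapsto\theta(g)x_\varepsilon B_{-\varepsilon}$, where $\theta(B_\varepsilon)=x_\varepsilon B_{-\varepsilon}x_\varepsilon^{-1}$, and this action induces an involution of $S$ (the types of adjacency). Suppose that $\theta$ locally fixes opposite chambers, i.e.: for every spherical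 residue $R$ of $\mathcal C$ that is parallel to $\theta(R)$ and whose type is a single $\theta$-orbit in $S$, every chamber $c\in R$ with $\mathrm{proj}_R(\theta(c))=c$ admits a chamber $d\in R$ with $\mathrm{proj}_R(\theta(d))=d$ that is opposite to $c$ in the spherical building $R$ (i.e. $\delta_\varepsilon(c,d)$ is the longest element of $W_J$, where $J$ is the type of $R$). Then every chamber $c$ of $\mathcal C$ is contained in a $\theta$-stable twin apartment of $\mathcal C$. -/

import Mathlib

open scoped Pointwise

universe u

/-! ### The root system of a Coxeter system, as the set of half-spaces of `W` -/

section Roots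

variable {B : Type*} {W : Type*} [Group W] {M : CoxeterMatrix B}

/-- The simple root `α_s = {w ∈ W | ℓ(s w) > ℓ(w)}`. -/
def simpleRootSet (cs : CoxeterSystem M W) (i : B) : Set W :=
  {w | cs.length w < cs.length (cs.simple i * w)}

/-- The roots: the translates `w α_s` of the simple roots, for `w ∈ W` and `s ∈ S`. -/
def CoxRoot (cs : CoxeterSystem M W) : Type _ :=
  {α : Set W // ∃ (w : W) (i : B), α = w • simpleRootSet cs i}

theorem simpleRootSet_compl (cs : CoxeterSystem M W) (i : B) :
    (simpleRootSet cs i)ᶜ = cs.simple i • simpleRootSet cs i := by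
  ext w
  rw [Set.mem_smul_set_iff_inv_smul_mem]
  simp only [simpleRootSet, Set.mem_compl_iff, Set.mem_ofPred_eq, smul_eq_mul,
    cs.inv_simple, cs.simple_mul_simple_cancel_left]
  have h := cs.length_simple_mul w i
  omega

namespace CoxRoot

variable {cs : CoxeterSystem M W}

/-- The simple root attached to `s`. -/
def simple (cs : CoxeterSystem M W) (i : B) : CoxRoot cs :=
  ⟨simpleRootSet cs i, 1, i, by simp⟩

/-- The action of `W` on the roots by left translation. -/
def act (w : W) (α : CoxRoot cs) : CoxRoot cs :=
  ⟨w • α.1, by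
    obtain ⟨v, i, h⟩ := α.2
    exact ⟨w * v, i, by rw [h, smul_smul]⟩⟩

/-- The opposite root `-α`, the complementary half-space. -/
def opp (α : CoxRoot cs) : CoxRoot cs :=
  ⟨α.1ᶜ, by
    obtain ⟨v, i, h⟩ := α.2
    exact ⟨v * cs.simple i, i, by
      rw [h, ← Set.smul_set_compl, simpleRootSet_compl, smul_smul]⟩⟩

/-- A root is positive if it contains the identity of `W`, and negative otherwise. -/
def IsPos (α : CoxRoot cs) : Prop := (1 : W) ∈ α.1

/-- The pair `{α, β}` is prenilpotent: `α ∩ β ≠ ∅` and `(-α) ∩ (-β) ≠ ∅`. -/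
def Prenilpotent (α β : CoxRoot cs) : Prop :=
  (α.1 ∩ β.1).Nonempty ∧ (α.opp.1 ∩ β.opp.1).Nonempty

/-- The open interval `]α, β[`: the roots `γ ∉ {α, β}` with `α ∩ β ⊆ γ` and
`(-α) ∩ (-β) ⊆ -γ`. -/
def openInterval (α β : CoxRoot cs) : Set (CoxRoot cs) :=
  {γ | γ ≠ α ∧ γ ≠ β ∧ α.1 ∩ β.1 ⊆ γ.1 ∧ α.opp.1 ∩ β.opp.1 ⊆ γ.opp.1}

end CoxRoot

end Roots

/-! ### RGD systems -/

/-- The conjugate `g H g⁻¹` of a subgroup. -/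
def conjSubgroup {G : Type*} [Group G] (g : G) (H : Subgroup G) : Subgroup G :=
  H.map (MulAut.conj g).toMonoidHom

/-- RGD systems `(G, (U_α)_{α ∈ Φ}, T)` of type `(W, S)`. -/
structure RGDSystem {B : Type*} {W : Type*} [Group W] {M : CoxeterMatrix B}
    (cs : CoxeterSystem M W) (G : Type*) [Group G] where
  /-- The root groups. -/
  U : CoxRoot cs → Subgroup G
  /-- The torus. -/
  T : Subgroup G
  root_ne_bot : ∀ α, U α ≠ ⊥
  commutator_le : ∀ α β : CoxRoot cs, α ≠ β → α.Prenilpotent β →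
    ⁅U α, U β⁆ ≤ ⨆ γ ∈ α.openInterval β, U γ
  exists_mu : ∀ i : B, ∃ m : G → G,
    (∀ u ∈ U (CoxRoot.simple cs i), u ≠ 1 →
      (∃ u' ∈ U (CoxRoot.simple cs i).opp, ∃ u'' ∈ U (CoxRoot.simple cs i).opp,
        m u = u' * u * u'') ∧
      ∀ β, conjSubgroup (m u) (U β) = U (β.act (cs.simple i))) ∧
    (∀ u ∈ U (CoxRoot.simple cs i), u ≠ 1 → ∀ v ∈ U (CoxRoot.simple cs i), v ≠ 1 →
      (m u)⁻¹ * m v ∈ T)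
  not_neg_le_pos : ∀ i : B,
    ¬ U (CoxRoot.simple cs i).opp ≤ ⨆ (α : CoxRoot cs) (_ : α.IsPos), U α
  torus_mul_roots : ∀ g : G, ∃ t ∈ T, ∃ x ∈ (⨆ α, U α : Subgroup G), g = t * x
  torus_normalizes : ∀ α, ∀ t ∈ T, conjSubgroup t (U α) = U α

/-! ### Twin chamber systems with their `W`-valued (co)distances -/

/-- The data underlying a twin building `((C₊, δ₊), (C₋, δ₋), δ*)` of type `(W, S)`: the set
`C₊ ∪ C₋` of chambers, the sign of a chamber (`true` for `C₊`, `false` for `C₋`) and the function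
`δ` which is `δ_ε` on pairs of chambers of the same sign `ε` and `δ*` on pairs of chambers
of different signs. -/
structure TwinChamberData (W : Type*) where
  Chamber : Type u
  sign : Chamber → Bool
  δ : Chamber → Chamber → W

namespace TwinChamberData

variable {B : Type*} {W : Type*} [Group W] {M : CoxeterMatrix B}
variable (cs : CoxeterSystem M W) (C : TwinChamberData.{u} W)

/-- `s`-adjacency (including equality) of chambers of the same sign. -/
def Adj (i : B) (c d : C.Chamber) : Prop :=
  C.sign c = C.sign d ∧ (C.δ c d = 1 ∨ C.δ c d = cs.simple i)

/-- Two chambers of different signs are opposite if their codistance is `1`. -/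
def Opp (c d : C.Chamber) : Prop := C.sign c ≠ C.sign d ∧ C.δ c d = 1

/-- The `J`-residue of `c`: all chambers joined to `c` by a `J`-gallery. -/
def residue (J : Set B) (c : C.Chamber) : Set C.Chamber :=
  {d | Relation.ReflTransGen (fun x y => ∃ i ∈ J, C.Adj cs i x y) c d}

/-- `c` is the projection `proj_R d` of `d` onto `R`, where `R` is a residue of spherical type in
one half and `d` is a chamber of the other half: the chamber of `R` at
codistance of maximal length from `d`. -/
def IsProj (R : Set C.Chamber) (d c : C.Chamber) : Prop :=
  c ∈ R ∧ ∀ x ∈ R, cs.length (C.δ x d) ≤ cs.length (C.δ c d)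

/-- The set `proj_R Q` for residues `R`, `Q` of spherical type in different halves. -/
def projSet (R Q : Set C.Chamber) : Set C.Chamber := {c | ∃ d ∈ Q, C.IsProj cs R d c}

/-- Parallel residues (of spherical types, in different halves). -/
def Parallel (R Q : Set C.Chamber) : Prop := C.projSet cs R Q = R ∧ C.projSet cs Q R = Q

/-- An apartment of the half of sign `ε`: a set of chambers isometric to `W` with the distance
`(v, w) ↦ v⁻¹ w`. -/
def IsApartment (ε : Bool) (A : Set C.Chamber) : Prop :=
  (∀ c ∈ A, C.sign c = ε) ∧
    ∃ f : W → C.Chamber, Set.BijOn f Set.univ A ∧ ∀ v w, C.δ (f v) (f w) = v⁻¹ * w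

/-- A twin apartment `(A₊, A₋)`, written as the set `A = A₊ ∪ A₋`: both halves are apartments and
each chamber of `A` is opposite to precisely one chamber of `A`. -/
def IsTwinApartment (A : Set C.Chamber) : Prop :=
  (∀ ε, C.IsApartment ε {c ∈ A | C.sign c = ε}) ∧ ∀ c ∈ A, ∃! d, d ∈ A ∧ C.Opp c d

end TwinChamberData

section Types

variable {B : Type*} {W : Type*} [Group W] {M : CoxeterMatrix B} (cs : CoxeterSystem M W)

/-- The standard parabolic subgroup `W_J`. -/
def parabolic (J : Set B) : Subgroup W := Subgroup.closure (cs.simple '' J)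

/-- `J` is spherical: `W_J` is finite. -/
def IsSphericalType (J : Set B) : Prop := (parabolic cs J : Set W).Finite

/-- `w` is the longest element of `W_J`. -/
def IsLongestElement (J : Set B) (w : W) : Prop :=
  w ∈ parabolic cs J ∧ ∀ v ∈ parabolic cs J, cs.length v ≤ cs.length w

end Types

namespace TwinChamberData

variable {B : Type*} {W : Type*} [Group W] {M : CoxeterMatrix B}
variable (cs : CoxeterSystem M W) (C : TwinChamberData.{u} W)

/-- The involutive map `θ` on chambers sends the type `s` to the type `t`: it maps `s`-adjacency to
`t`-adjacency. -/
def MapsType (θ : C.Chamber → C.Chamber) (s t : B) : Prop :=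
  ∀ c d, C.Adj cs s c d ↔ C.Adj cs t (θ c) (θ d)

/-- `J` is a single orbit `{s, θ(s)}` of the involution induced by `θ` on the types. -/
def IsTypeOrbit (θ : C.Chamber → C.Chamber) (J : Set B) : Prop :=
  ∃ s t, C.MapsType cs θ s t ∧ J = {s, t}

/-- The quasi-flip `θ` of chambers locally fixes opposite chambers: for every spherical residue `R`
whose type is a single `θ`-orbit and which is parallel to `θ(R)`, each chamber of `R` fixed by
`proj_R ∘ θ` has an opposite chamber in the spherical building `R` that is also fixed by
`proj_R ∘ θ`. -/
def LocallyFixesOpposite (θ : C.Chamber → C.Chamber) : Prop :=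
  ∀ (J : Set B) (e : C.Chamber), IsSphericalType cs J → C.IsTypeOrbit cs θ J →
    C.Parallel cs (C.residue cs J e) (θ '' C.residue cs J e) →
    ∀ c ∈ C.residue cs J e, C.IsProj cs (C.residue cs J e) (θ c) c →
      ∃ d ∈ C.residue cs J e, C.IsProj cs (C.residue cs J e) (θ d) d ∧
        IsLongestElement cs J (C.δ c d)

end TwinChamberData

/-! ### The twin `BN`-pair and the twin building of an RGD system; quasi-flips -/

namespace RGDSystem

variable {B : Type*} {W : Type*} [Group W] {M : CoxeterMatrix B} {cs : CoxeterSystem M W}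
variable {G : Type u} [Group G] (R : RGDSystem cs G)

/-- `U_+` for `ε = true`, and `U_-` for `ε = false`. -/
def unip (ε : Bool) : Subgroup G := ⨆ (α : CoxRoot cs) (_ : α.IsPos ↔ ε = true), R.U α

/-- The Borel subgroups `B_ε = T U_ε` (the product is a subgroup since `T` normalizes `U_ε`). -/
def borel (ε : Bool) : Subgroup G := R.T ⊔ R.unip ε

/-- `n = μ(u)` for the element `u ≠ 1` of the simple root group of `s`. -/
def IsMu (i : B) (u n : G) : Prop :=
  (∃ u' ∈ R.U (CoxRoot.simple cs i).opp, ∃ u'' ∈ R.U (CoxRoot.simple cs i).opp,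
    n = u' * u * u'') ∧
  ∀ β, conjSubgroup n (R.U β) = R.U (β.act (cs.simple i))

/-- `N = T ⟨μ(u) | u ∈ U_α ∖ {1}, α simple⟩`. -/
def N : Subgroup G :=
  R.T ⊔ Subgroup.closure
    {n | ∃ i, ∃ u ∈ R.U (CoxRoot.simple cs i), u ≠ 1 ∧ R.IsMu i u n}

/-- `n ∈ N` represents `w ∈ W` under the isomorphism `N / T ≅ W` (which sends `μ(u) T` to `s` for
`u` in the root group of `α_s`): `n` permutes the root groups as `w` permutes the roots. -/
def Represents (n : G) (w : W) : Prop :=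
  n ∈ R.N ∧ ∀ β, conjSubgroup n (R.U β) = R.U (β.act w)

/-- The double coset `B_ε w B_ε'`. -/
def bruhatCell (ε ε' : Bool) (w : W) : Set G :=
  {x | ∃ b ∈ R.borel ε, ∃ n, R.Represents n w ∧ ∃ b' ∈ R.borel ε', x = b * n * b'}

/-- The twin building associated with the RGD system. The chambers of sign `ε` are the cosets
`g B_ε`, and `δ (g B_ε) (h B_ε')` is the unique `w ∈ W` with `B_ε g⁻¹ h B_ε' = B_ε w B_ε'`,
by the Bruhat decomposition for `ε = ε'` and the Birkhoff decomposition for `ε ≠ ε'`. -/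
noncomputable def twinBuilding : TwinChamberData.{u} W where
  Chamber := Σ ε : Bool, G ⧸ R.borel ε
  sign c := c.1
  δ c d := Classical.epsilon fun w =>
    ∃ g h : G, (g : G ⧸ R.borel c.1) = c.2 ∧ (h : G ⧸ R.borel d.1) = d.2 ∧
      g⁻¹ * h ∈ R.bruhatCell c.1 d.1 w

/-- A quasi-flip of `G`: an automorphism `θ` with `θ² = id` such that `θ(B_+)` is conjugate to
`B_-`. -/
def IsQuasiFlip (θ : G ≃* G) : Prop :=
  (∀ g, θ (θ g) = g) ∧
    ∃ x : G, (R.borel true).map θ.toMonoidHom = conjSubgroup x (R.borel false)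

variable {R}

theorem IsQuasiFlip.exists_conj {θ : G ≃* G} (h : R.IsQuasiFlip θ) (ε : Bool) :
    ∃ x : G, (R.borel ε).map θ.toMonoidHom = conjSubgroup x (R.borel !ε) := by
  obtain ⟨h2, x, hx⟩ := h
  cases ε with
  | true => exact ⟨x, hx⟩
  | false =>
    refine ⟨(θ x)⁻¹, ?_⟩
    have key : ∀ y : G, y ∈ R.borel false ↔ θ (x * y * x⁻¹) ∈ R.borel true := by
      intro y
      have e1 : y ∈ R.borel false ↔ x * y * x⁻¹ ∈ conjSubgroup x (R.borel false) := by
        simp only [conjSubgroup, Subgroup.mem_map]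
        constructor
        · intro hy
          exact ⟨y, hy, by simp⟩
        · rintro ⟨z, hz, hzy⟩
          simp only [MulEquiv.toMonoidHom_eq_coe, MonoidHom.coe_coe, MulAut.conj_apply,
            mul_left_inj, mul_right_inj] at hzy
          exact hzy ▸ hz
      rw [e1, ← hx, Subgroup.mem_map]
      constructor
      · rintro ⟨z, hz, hzy⟩
        rw [← hzy]
        simpa [h2] using hz
      · intro hy
        exact ⟨_, hy, by simp [h2]⟩
    ext y
    simp only [conjSubgroup, Subgroup.mem_map, Bool.not_false]
    constructor
    · rintro ⟨z, hz, rfl⟩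
      refine ⟨_, (key z).1 hz, ?_⟩
      simp [mul_assoc]
    · rintro ⟨z, hz, rfl⟩
      refine ⟨x⁻¹ * θ z * x, (key _).2 ?_, ?_⟩
      · simpa [mul_assoc, h2] using hz
      · simp [h2]

/-- Some `x_ε` with `θ(B_ε) = x_ε B_{-ε} x_ε⁻¹`; the coset `x_ε B_{-ε}` does not depend on the
choice, since `B_{-ε}` is its own normalizer. -/
noncomputable def IsQuasiFlip.conjElt {θ : G ≃* G} (h : R.IsQuasiFlip θ) (ε : Bool) : G :=
  (h.exists_conj ε).choose

/-- The map `g B_ε ↦ θ(g) x_ε B_{-ε}` from `G / B_ε` to `G / B_{-ε}`. -/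
noncomputable def IsQuasiFlip.cosetMap {θ : G ≃* G} (h : R.IsQuasiFlip θ) (ε : Bool) :
    G ⧸ R.borel ε → G ⧸ R.borel !ε := fun q =>
  Quotient.liftOn' q
    (fun g => ((θ g * h.conjElt ε : G) : G ⧸ R.borel !ε)) (by
      intro a b hab
      rw [QuotientGroup.leftRel_apply] at hab
      rw [QuotientGroup.eq]
      have hm : (R.borel ε).map θ.toMonoidHom = conjSubgroup (h.conjElt ε) (R.borel !ε) :=
        (h.exists_conj ε).choose_spec
      have h1 : θ (a⁻¹ * b) ∈ conjSubgroup (h.conjElt ε) (R.borel !ε) := by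
        rw [← hm]
        exact Subgroup.mem_map_of_mem θ.toMonoidHom hab
      obtain ⟨z, hz, hzy⟩ := h1
      have h2 : z = (θ a * h.conjElt ε)⁻¹ * (θ b * h.conjElt ε) := by
        have h3 : h.conjElt ε * z * (h.conjElt ε)⁻¹ = θ (a⁻¹ * b) := hzy
        rw [map_mul, map_inv] at h3
        calc z = (h.conjElt ε)⁻¹ * (h.conjElt ε * z * (h.conjElt ε)⁻¹) *
              h.conjElt ε := by group
          _ = _ := by rw [h3]; group
      exact h2 ▸ hz)

/-- The map on chambers induced by a quasi-flip `θ` of `G`: `g B_ε ↦ θ(g) x_ε B_{-ε}`, where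
`θ(B_ε) = x_ε B_{-ε} x_ε⁻¹`. In terms of stabilizers, it maps the chamber with
stabilizer `P` to the chamber of the opposite sign with stabilizer `θ(P)`. -/
noncomputable def IsQuasiFlip.chamberMap {θ : G ≃* G} (h : R.IsQuasiFlip θ) :
    R.twinBuilding.Chamber → R.twinBuilding.Chamber :=
  fun (c : Σ ε : Bool, G ⧸ R.borel ε) => ⟨!c.1, h.cosetMap c.1 c.2⟩

end RGDSystem

/-! The proof has a geometric half, which uses only the properties of a thick twin building
collected in `IsThickTwinBuilding`, and a group-theoretic half, which derives these properties from
the RGD system.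

Geometry. The quasi-flip acts on distances and codistances through one involutive automorphism σ of
(W, S) (`exists_typeMap`). For a chamber c let w be the codistance from c to θ(c); then σ(w) = w⁻¹.
`exists_stable_frame` is an induction on the length of w. If some left descent s of w satisfies s w
σ(s) ≠ w, then every chamber d ≠ c of the s-panel of c has codistance s w σ(s) to θ(d), which is
shorter, and a θ-stable twin apartment through d is forced to contain c. Otherwise w is the longest
element of W_I, where I is the set of left descents of w (`mem_parabolic_of_stable`), and
conjugation by w induces σ on W_I. Starting at c, one passes repeatedly to opposite chambers in
residues of type {s, σ(s)}, which the local hypothesis supplies; this keeps the codistance from x to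
θ(x) equal to w and lengthens the distance from c to x (`exists_longer`). The process ends at some d
with δ(c, d) = w. Then c is opposite to θ(d), and d to θ(c); both pairs span the same twin
apartment, and θ interchanges the pairs (`exists_frame_of_eq`).

Algebra. Chambers are cosets of the Borel groups, so the building properties amount to a product
rule for double cosets (`cell_mul_simple`), the decompositions of G (`exists_mem_cell`) and their
disjointness (`cell_unique`). Bruhat disjointness for the sign ε is the usual length induction; it
needs that no simple root group of sign -ε lies in U_ε, which is assumed only for positive ε.
Birkhoff disjointness follows from Bruhat disjointness in one half by a covering argument: pairs (g,
w), compared by means of the group generated by T and the root groups of the inversions of w, lie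
over the chambers of that half. Galleries lift, rank two residues lift faithfully, and since reduced
words for one element are related by braid moves, two joined points over the same chamber are
equivalent. Birkhoff disjointness in turn yields the missing non-inclusion for the other sign
(`notOppLe_of_not`).

The Coxeter-theoretic input is the exchange condition, proved by a parity count of reflections, and
its consequences for parabolic subgroups and reduced words. -/

namespace CoxeterSystem

variable {B W : Type*} [Group W] {M : CoxeterMatrix B} (cs : CoxeterSystem M W)

/-! ### The exchange condition -/

open Classical in
/-- The action of a simple reflection on pairs of an element of `W` and a parity. -/
noncomputable def parityStep (i : B) : Function.End (W × ZMod 2) := fun p =>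
  (cs.simple i * p.1 * cs.simple i, p.2 + if p.1 = cs.simple i then 1 else 0)

open Classical in
theorem parityStep_apply (i : B) (t : W) (z : ZMod 2) : cs.parityStep i (t, z) =
    (cs.simple i * t * cs.simple i, z + if t = cs.simple i then 1 else 0) := rfl

theorem simple_mul_pow_mul (i j : B) (k : ℕ) :
    cs.simple j * (cs.simple i * cs.simple j) ^ k =
      ((cs.simple i * cs.simple j)⁻¹) ^ k * cs.simple j := by
  have h : (cs.simple i * cs.simple j)⁻¹ =
      cs.simple j * (cs.simple i * cs.simple j) * (cs.simple j)⁻¹ := by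
    simp [mul_assoc]
  rw [h, conj_pow]
  simp [mul_assoc]

open Classical in
theorem parityStep_mul_pow (i j : B) (k : ℕ) (t : W) (z : ZMod 2) :
    ((cs.parityStep i * cs.parityStep j) ^ k) (t, z) =
      ((cs.simple i * cs.simple j) ^ k * t * ((cs.simple i * cs.simple j)⁻¹) ^ k,
        z + ∑ q ∈ Finset.range (2 * k),
          if t = ((cs.simple i * cs.simple j)⁻¹) ^ q * cs.simple j then 1 else 0) := by
  set r := cs.simple i * cs.simple j with hr
  induction k with
  | zero => simp; rfl
  | succ k ih =>
    have hcomm : cs.simple j * r ^ k = (r⁻¹) ^ k * cs.simple j := cs.simple_mul_pow_mul i j k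
    rw [pow_succ']
    change cs.parityStep i (cs.parityStep j (((cs.parityStep i * cs.parityStep j) ^ k) (t, z))) = _
    rw [ih, show 2 * (k + 1) = 2 * k + 1 + 1 by ring, Finset.sum_range_succ,
      Finset.sum_range_succ]
    rw [parityStep_apply, parityStep_apply]
    have e1 : (r ^ k * t * (r⁻¹) ^ k = cs.simple j) ↔ t = (r⁻¹) ^ (2 * k) * cs.simple j := by
      have : (r⁻¹) ^ (2 * k) * cs.simple j = (r⁻¹) ^ k * cs.simple j * r ^ k := by
        rw [two_mul, pow_add, mul_assoc, mul_assoc, hcomm]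
      rw [this]
      constructor
      · intro h; rw [← h]; simp [mul_assoc]
      · intro h; rw [h]; simp [mul_assoc]
    have e2 : (cs.simple j * (r ^ k * t * (r⁻¹) ^ k) * cs.simple j = cs.simple i) ↔
        t = (r⁻¹) ^ (2 * k + 1) * cs.simple j := by
      have : (r⁻¹) ^ (2 * k + 1) * cs.simple j =
          (r⁻¹) ^ k * (cs.simple j * cs.simple i * cs.simple j) * r ^ k := by
        have h' : r⁻¹ = cs.simple j * cs.simple i := by simp [hr]
        have : (r⁻¹) ^ (2 * k + 1) = (r⁻¹) ^ k * r⁻¹ * (r⁻¹) ^ k := by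
          rw [← pow_succ, ← pow_add]; congr 1; ring
        rw [this, mul_assoc _ _ (cs.simple j), ← hcomm, h']
        simp only [mul_assoc]
      rw [this]
      constructor
      · intro h; rw [← h]; simp [mul_assoc]
      · intro h; rw [h]; simp [mul_assoc]
    rw [if_congr e1 rfl rfl, if_congr e2 rfl rfl]
    refine Prod.ext ?_ (by simp only [add_assoc])
    simp only [pow_succ', pow_succ (r⁻¹)]
    simp [hr, mul_assoc]

theorem isLiftable_parityStep : M.IsLiftable cs.parityStep := by
  classical
  intro i j
  funext ⟨t, z⟩
  rw [parityStep_mul_pow]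
  have h : (cs.simple i * cs.simple j) ^ M.M i j = 1 := cs.simple_mul_simple_pow i j
  have h' : ((cs.simple i * cs.simple j)⁻¹) ^ M.M i j = 1 := by rw [inv_pow, h, inv_one]
  -- The summand has period m_ij in q, and the sum runs over two periods, so it vanishes modulo two.
  rw [h, h', two_mul, Finset.sum_range_add]
  simp only [pow_add, h', one_mul, mul_one]
  have h2 : ∀ a : ZMod 2, a + a = 0 := by decide
  rw [h2]
  simp
  rfl

/-- The homomorphism counting, modulo two, how often a wall is crossed. -/
noncomputable def parityHom : W →* Function.End (W × ZMod 2) :=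
  cs.lift ⟨cs.parityStep, cs.isLiftable_parityStep⟩

open Classical in
theorem parityHom_simple_mul (i : B) (w : W) (p : W × ZMod 2) :
    cs.parityHom (cs.simple i * w) p = cs.parityStep i (cs.parityHom w p) := by
  rw [map_mul]
  have : cs.parityHom (cs.simple i) = cs.parityStep i := by
    simp [parityHom, cs.lift_apply_simple]
  rw [this]; rfl

theorem parityHom_mul (v w : W) (p : W × ZMod 2) :
    cs.parityHom (v * w) p = cs.parityHom v (cs.parityHom w p) := by
  rw [map_mul]; rfl

theorem parityHom_apply (w t : W) (z : ZMod 2) :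
    cs.parityHom w (t, z) = (w * t * w⁻¹, z + (cs.parityHom w (t, 0)).2) := by
  induction w using cs.simple_induction_left generalizing z with
  | one => simp only [map_one]; simp [Function.End.one_def]
  | mul_simple_left w i ih =>
    rw [cs.parityHom_simple_mul, cs.parityHom_simple_mul, ih, ih 0]
    simp [parityStep, mul_assoc, add_assoc]

/-- An odd count means that some suffix of the word conjugates t into the letter standing in front
of it; multiplying by t on the right then cancels that letter. -/
theorem exists_eraseIdx_of_parity (t : W) (ω : List B)
    (h : (cs.parityHom (cs.wordProd ω) (t, 0)).2 ≠ 0) :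
    ∃ j < ω.length, cs.wordProd ω * t = cs.wordProd (ω.eraseIdx j) := by
  induction ω with
  | nil => simp [Function.End.one_def] at h
  | cons i ω ih =>
    by_cases h0 : (cs.parityHom (cs.wordProd ω) (t, 0)).2 = 0
    · rw [cs.wordProd_cons, cs.parityHom_simple_mul, cs.parityHom_apply] at h
      simp only [parityStep, h0, zero_add] at h
      have h1 : cs.wordProd ω * t * (cs.wordProd ω)⁻¹ = cs.simple i := by
        by_contra h2; simp [h2] at h
      refine ⟨0, by simp, ?_⟩
      rw [mul_inv_eq_iff_eq_mul] at h1
      rw [cs.wordProd_cons, mul_assoc, h1]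
      simp
    · obtain ⟨j, hj, hj'⟩ := ih h0
      refine ⟨j + 1, by simpa using hj, ?_⟩
      rw [List.eraseIdx_cons_succ, cs.wordProd_cons, cs.wordProd_cons, mul_assoc, hj']

/-- If the count of s_i along w were even, it would be odd along w s_i; deleting a letter from a
reduced word of w s_i would then produce w, making w the shorter of the two. -/
theorem exchange_right {ω : List B} {i : B}
    (h : cs.length (cs.wordProd ω * cs.simple i) < cs.length (cs.wordProd ω)) :
    ∃ j < ω.length, cs.wordProd ω * cs.simple i = cs.wordProd (ω.eraseIdx j) := by
  apply cs.exists_eraseIdx_of_parity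
  intro h0
  obtain ⟨ω', hω', he⟩ := cs.exists_isReduced (cs.wordProd ω * cs.simple i)
  have h1 : (cs.parityHom (cs.wordProd ω') (cs.simple i, 0)).2 ≠ 0 := by
    rw [← he, cs.parityHom_mul]
    have : cs.parityHom (cs.simple i) (cs.simple i, 0) = (cs.simple i, 1) := by
      have := cs.parityHom_simple_mul i 1 (cs.simple i, 0)
      rw [mul_one] at this
      rw [this]
      simp [parityStep, Function.End.one_def]
    rw [this, cs.parityHom_apply, h0]
    simp
  obtain ⟨j, hj, hj'⟩ := cs.exists_eraseIdx_of_parity _ _ h1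
  rw [← he, cs.simple_mul_simple_cancel_right] at hj'
  have h3 : cs.length (cs.wordProd ω) < ω'.length := by
    rw [hj']
    refine (cs.length_wordProd_le _).trans_lt ?_
    rw [List.length_eraseIdx_of_lt hj]; omega
  have h4 : cs.length (cs.wordProd ω * cs.simple i) = ω'.length := by rw [he]; exact hω'
  omega

theorem eraseIdx_append_cases (ω₁ ω₂ : List B) {j : ℕ} (hj : j < (ω₁ ++ ω₂).length) :
    (∃ k < ω₁.length, (ω₁ ++ ω₂).eraseIdx j = ω₁.eraseIdx k ++ ω₂) ∨
      ∃ k < ω₂.length, (ω₁ ++ ω₂).eraseIdx j = ω₁ ++ ω₂.eraseIdx k := by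
  by_cases h : j < ω₁.length
  · exact Or.inl ⟨j, h, List.eraseIdx_append_of_lt_length h _⟩
  · push Not at h
    rw [List.length_append] at hj
    exact Or.inr ⟨j - ω₁.length, by omega, List.eraseIdx_append_of_length_le h _⟩

/-- Exchange for a product `v w` with a right descent. -/
theorem exchange_mul {v w : W} {i : B}
    (h : cs.length (v * w * cs.simple i) < cs.length (v * w)) :
    (∃ v', cs.length v' < cs.length v ∧ v * w * cs.simple i = v' * w) ∨
      ∃ w', cs.length w' < cs.length w ∧ w * cs.simple i = w' := by
  obtain ⟨ω₁, h1, rfl⟩ := cs.exists_isReduced v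
  obtain ⟨ω₂, h2, rfl⟩ := cs.exists_isReduced w
  rw [← cs.wordProd_append] at h
  obtain ⟨j, hj, he⟩ := cs.exchange_right h
  have hlt : ∀ (ω : List B) k, k < ω.length → cs.length (cs.wordProd (ω.eraseIdx k)) < ω.length := by
    intro ω k hk
    refine (cs.length_wordProd_le _).trans_lt ?_
    rw [List.length_eraseIdx_of_lt hk]; omega
  rcases eraseIdx_append_cases ω₁ ω₂ hj with ⟨k, hk, hk'⟩ | ⟨k, hk, hk'⟩
  · left
    refine ⟨_, (hlt _ _ hk).trans_eq h1.symm, ?_⟩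
    rw [← cs.wordProd_append, he, hk', cs.wordProd_append]
  · right
    refine ⟨_, (hlt _ _ hk).trans_eq h2.symm, ?_⟩
    rw [hk', cs.wordProd_append, cs.wordProd_append, mul_assoc, mul_right_inj] at he
    exact he

/-- The folding condition. -/
theorem simple_mul_eq_mul_simple {x : W} {i j : B}
    (h1 : cs.length x < cs.length (cs.simple i * x))
    (h2 : cs.length (cs.simple i * (x * cs.simple j)) < cs.length (x * cs.simple j)) :
    cs.simple i * x = x * cs.simple j := by
  have h3 : cs.length (cs.simple i * x * cs.simple j) < cs.length (cs.simple i * x) := by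
    rw [mul_assoc]
    rcases cs.length_mul_simple x j with h | h <;>
    rcases cs.length_simple_mul x i with h' | h' <;> omega
  -- Either the initial s_i is the deleted letter, which is the claim, or x s_j is shorter than x,
  -- and then the lengths of s_i x and s_i x s_j differ by too much.
  rcases cs.exchange_mul h3 with ⟨v', hv, he⟩ | ⟨w', hw, he⟩
  · rw [cs.length_simple, Nat.lt_one_iff, cs.length_eq_zero_iff] at hv
    rw [hv, one_mul] at he
    calc cs.simple i * x = cs.simple i * x * cs.simple j * cs.simple j := by simp
      _ = x * cs.simple j := by rw [he]
  · exfalso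
    rw [← he] at hw
    have h4 : cs.length (x * cs.simple j) + 1 = cs.length x := by
      rcases cs.length_mul_simple x j with h | h <;> omega
    have h5 := cs.length_mul_simple (cs.simple i * x) j
    rw [mul_assoc] at h5
    rcases cs.length_simple_mul x i with h' | h' <;> omega

end CoxeterSystem

namespace CoxeterSystem

variable {B W : Type*} [Group W] {M : CoxeterMatrix B} (cs : CoxeterSystem M W)

/-! ### Parabolic subgroups -/

theorem simple_mem_parabolic {J : Set B} {i : B} (hi : i ∈ J) : cs.simple i ∈ parabolic cs J :=
  Subgroup.subset_closure ⟨i, hi, rfl⟩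

theorem wordProd_mem_parabolic {J : Set B} {ω : List B} (h : ∀ i ∈ ω, i ∈ J) :
    cs.wordProd ω ∈ parabolic cs J := by
  induction ω with
  | nil => simp
  | cons i ω ih =>
    rw [cs.wordProd_cons]
    exact Subgroup.mul_mem _ (cs.simple_mem_parabolic (h i (by simp)))
      (ih fun j hj => h j (by simp [hj]))

theorem parabolic_mono {J K : Set B} (h : J ⊆ K) : parabolic cs J ≤ parabolic cs K :=
  Subgroup.closure_mono (Set.image_mono h)

theorem length_mul_simple_of_lt {w : W} {i : B}
    (h : cs.length w < cs.length (w * cs.simple i)) :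
    cs.length (w * cs.simple i) = cs.length w + 1 := by
  rcases cs.length_mul_simple w i with h' | h' <;> omega

theorem length_mul_simple_of_gt {w : W} {i : B}
    (h : cs.length (w * cs.simple i) < cs.length w) :
    cs.length (w * cs.simple i) + 1 = cs.length w := by
  rcases cs.length_mul_simple w i with h' | h' <;> omega

theorem length_simple_mul_of_gt {w : W} {i : B}
    (h : cs.length (cs.simple i * w) < cs.length w) :
    cs.length (cs.simple i * w) + 1 = cs.length w := by
  rcases cs.length_simple_mul w i with h' | h' <;> omega

theorem isReduced_concat {ω : List B} {i : B} (h : cs.IsReduced ω)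
    (h' : cs.length (cs.wordProd ω) < cs.length (cs.wordProd ω * cs.simple i)) :
    cs.IsReduced (ω.concat i) := by
  rw [IsReduced, cs.wordProd_concat, cs.length_mul_simple_of_lt h', h.eq, List.length_concat]

theorem isReduced_of_concat {ω : List B} {i : B} (h : cs.IsReduced (ω.concat i)) :
    cs.IsReduced ω ∧ cs.length (cs.wordProd ω) < cs.length (cs.wordProd ω * cs.simple i) := by
  have h1 := h.eq
  rw [cs.wordProd_concat, List.length_concat] at h1
  have h2 := cs.length_wordProd_le ω
  have h3 := cs.length_mul_simple (cs.wordProd ω) i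
  refine ⟨?_, by omega⟩
  rw [IsReduced]; omega

theorem exists_isReduced_of_mem_parabolic {J : Set B} {v : W} (hv : v ∈ parabolic cs J) :
    ∃ ω : List B, cs.IsReduced ω ∧ (∀ i ∈ ω, i ∈ J) ∧ v = cs.wordProd ω := by
  have step : ∀ x y, y ∈ cs.simple '' J →
      (∃ ω : List B, cs.IsReduced ω ∧ (∀ i ∈ ω, i ∈ J) ∧ x = cs.wordProd ω) →
      (∃ ω : List B, cs.IsReduced ω ∧ (∀ i ∈ ω, i ∈ J) ∧ x * y = cs.wordProd ω) := by
    rintro x _ ⟨i, hi, rfl⟩ ⟨ω, h1, h2, rfl⟩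
    rcases cs.length_mul_simple (cs.wordProd ω) i with h | h
    · refine ⟨ω.concat i, cs.isReduced_concat h1 (by omega), ?_, (cs.wordProd_concat i ω).symm⟩
      intro j hj
      rw [List.concat_eq_append, List.mem_append, List.mem_singleton] at hj
      rcases hj with hj | rfl
      · exact h2 j hj
      · exact hi
    · obtain ⟨j, hj, he⟩ := cs.exchange_right (ω := ω) (i := i) (by omega)
      refine ⟨ω.eraseIdx j, ?_, fun k hk => h2 k (List.mem_of_mem_eraseIdx hk), he⟩
      rw [IsReduced, ← he, List.length_eraseIdx_of_lt hj]
      have := h1.eq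
      omega
  refine Subgroup.closure_induction_right (p := fun v _ => ∃ ω : List B, cs.IsReduced ω ∧
    (∀ i ∈ ω, i ∈ J) ∧ v = cs.wordProd ω) ?_ ?_ ?_ hv
  · exact ⟨[], by simp [IsReduced], by simp, by simp⟩
  · intro x _ y hy h; exact step x y hy h
  · rintro x _ y hy h
    obtain ⟨i, hi, rfl⟩ := hy
    rw [cs.inv_simple]
    exact step x _ ⟨i, hi, rfl⟩ h

theorem parabolic_induction {J : Set B} {p : W → Prop} (one : p 1)
    (mul : ∀ v ∈ parabolic cs J, ∀ i ∈ J, cs.length v < cs.length (v * cs.simple i) → p v →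
      p (v * cs.simple i)) {v : W} (hv : v ∈ parabolic cs J) : p v := by
  obtain ⟨ω, h1, h2, rfl⟩ := cs.exists_isReduced_of_mem_parabolic hv
  clear hv
  induction ω using List.reverseRecOn with
  | nil => simpa using one
  | append_singleton ω i ih =>
    rw [← List.concat_eq_append] at h1 ⊢
    have h3 := cs.isReduced_of_concat h1
    have h4 : ∀ j ∈ ω, j ∈ J := fun j hj => h2 j (by simp [hj])
    rw [cs.wordProd_concat]
    exact mul _ (cs.wordProd_mem_parabolic h4) i (h2 i (by simp)) h3.2 (ih h3.1 h4)

theorem exists_eq_mul_simple_of_mem_parabolic {J : Set B} {v : W} (hv : v ∈ parabolic cs J)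
    (h : v ≠ 1) : ∃ u ∈ parabolic cs J, ∃ i ∈ J, v = u * cs.simple i ∧
      cs.length u < cs.length v := by
  revert h
  refine cs.parabolic_induction (p := fun v => v ≠ 1 → ∃ u ∈ parabolic cs J, ∃ i ∈ J,
    v = u * cs.simple i ∧ cs.length u < cs.length v) (fun h => (h rfl).elim) ?_ hv
  intro u hu i hi hl _ _
  exact ⟨u, hu, i, hi, rfl, hl⟩

/-- If a letter s shortened w u, exchange would delete a letter from w or from u. The first makes w
(u s u⁻¹) shorter than w, against minimality; the second makes u s shorter than u. -/
theorem length_mul_of_minimal {J : Set B} {w v : W}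
    (h : ∀ u ∈ parabolic cs J, cs.length w ≤ cs.length (w * u)) (hv : v ∈ parabolic cs J) :
    cs.length (w * v) = cs.length w + cs.length v := by
  refine cs.parabolic_induction (p := fun v => cs.length (w * v) = cs.length w + cs.length v)
    (by simp) ?_ hv
  intro u hu i hi hl ih
  rw [← mul_assoc, cs.length_mul_simple_of_lt hl, ← add_assoc, ← ih]
  refine cs.length_mul_simple_of_lt ?_
  by_contra hc
  have hc' : cs.length (w * u * cs.simple i) < cs.length (w * u) := by
    have := cs.length_mul_simple_ne (w * u) i
    omega
  rcases cs.exchange_mul hc' with ⟨w', hw, he⟩ | ⟨u', hw, he⟩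
  · have := h (u * cs.simple i * u⁻¹) (Subgroup.mul_mem _ (Subgroup.mul_mem _ hu
      (cs.simple_mem_parabolic hi)) (Subgroup.inv_mem _ hu))
    rw [← mul_assoc, ← mul_assoc, he] at this
    simp at this
    omega
  · rw [← he] at hw; omega

theorem exists_min_coset (J : Set B) (w : W) : ∃ w₁, ∃ v ∈ parabolic cs J, w = w₁ * v ∧
    ∀ u ∈ parabolic cs J, cs.length (w₁ * u) = cs.length w₁ + cs.length u := by
  classical
  have hne : ∃ n, ∃ u ∈ parabolic cs J, cs.length (w * u) = n :=
    ⟨_, 1, Subgroup.one_mem _, rfl⟩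
  obtain ⟨u, hu, hn⟩ := Nat.find_spec hne
  refine ⟨w * u, u⁻¹, Subgroup.inv_mem _ hu, by simp, fun v hv => ?_⟩
  refine cs.length_mul_of_minimal ?_ hv
  intro x hx
  rw [hn]
  exact Nat.find_min' hne ⟨u * x, Subgroup.mul_mem _ hu hx, by rw [mul_assoc]⟩

theorem length_mul_of_ascents {J : Set B} {w v : W}
    (h : ∀ i ∈ J, cs.length w < cs.length (w * cs.simple i)) (hv : v ∈ parabolic cs J) :
    cs.length (w * v) = cs.length w + cs.length v := by
  obtain ⟨w₁, u, hu, rfl, hadd⟩ := cs.exists_min_coset J w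
  by_cases hu1 : u = 1
  · subst hu1; simpa using hadd v hv
  · exfalso
    obtain ⟨u', hu', i, hi, rfl, hl⟩ := cs.exists_eq_mul_simple_of_mem_parabolic hu hu1
    have h1 := h i hi
    rw [← mul_assoc, cs.simple_mul_simple_cancel_right, mul_assoc, hadd _ hu, hadd _ hu'] at h1
    omega

theorem exists_left_min_coset (J : Set B) (w : W) : ∃ w₁, ∃ v ∈ parabolic cs J, w = v * w₁ ∧
    ∀ u ∈ parabolic cs J, cs.length (u * w₁) = cs.length u + cs.length w₁ := by
  obtain ⟨w₁, v, hv, he, h⟩ := cs.exists_min_coset J w⁻¹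
  refine ⟨w₁⁻¹, v⁻¹, Subgroup.inv_mem _ hv, by rw [← mul_inv_rev, ← he, inv_inv], ?_⟩
  intro u hu
  have := h u⁻¹ (Subgroup.inv_mem _ hu)
  rw [← cs.length_inv, mul_inv_rev, inv_inv, cs.length_inv u] at this
  rw [this, cs.length_inv]; omega

/-! ### Dihedral parabolic subgroups -/

theorem eq_alternatingWord_of_isReduced {i j : B} {ω : List B}
    (hω : ∀ k ∈ ω, k = i ∨ k = j) (h : cs.IsReduced (ω.concat j)) :
    ω.concat j = alternatingWord i j (ω.length + 1) := by
  induction ω using List.reverseRecOn generalizing i j with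
  | nil => simp [alternatingWord]
  | append_singleton ω k ih =>
    rw [← List.concat_eq_append] at h ⊢
    have h1 := cs.isReduced_of_concat h
    rcases hω k (by simp) with rfl | rfl
    · rw [ih (i := j) (j := k) (fun l hl => (hω l (by simp [hl])).symm) h1.1]
      rw [alternatingWord_succ k j]
      simp
    · have h2 := (cs.isReduced_of_concat h1.1).2
      have h3 := h1.2
      rw [cs.wordProd_concat, cs.simple_mul_simple_cancel_right] at h3
      omega

theorem eq_wordProd_alternatingWord {i j : B} {d : W} (hd : d ∈ parabolic cs {i, j})
    (h : cs.length (d * cs.simple j) < cs.length d) :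
    d = cs.wordProd (alternatingWord i j (cs.length d)) := by
  have hdj : d * cs.simple j ∈ parabolic cs {i, j} :=
    Subgroup.mul_mem _ hd (cs.simple_mem_parabolic (by simp))
  obtain ⟨ω, h1, h2, h3⟩ := cs.exists_isReduced_of_mem_parabolic hdj
  have h4 : d = cs.wordProd (ω.concat j) := by
    rw [cs.wordProd_concat, ← h3, cs.simple_mul_simple_cancel_right]
  have h5 : cs.IsReduced (ω.concat j) := by
    refine cs.isReduced_concat h1 ?_
    rw [← h3, cs.simple_mul_simple_cancel_right]; exact h
  have h6 := cs.eq_alternatingWord_of_isReduced (i := i) (fun k hk => by simpa using h2 k hk) h5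
  have h7 : cs.length d = ω.length + 1 := by rw [h4, h5.eq]; simp
  rw [h7, ← h6, h4]

theorem exists_append_alternatingWord (i j : B) (m n : ℕ) :
    ∃ ω : List B, ω.length = n ∧ alternatingWord i j (n + m) = ω ++ alternatingWord i j m := by
  induction n with
  | zero => exact ⟨[], by simp⟩
  | succ n ih =>
    obtain ⟨ω, h1, h2⟩ := ih
    rw [show n + 1 + m = n + m + 1 by ring, alternatingWord_succ', h2]
    exact ⟨_ :: ω, by simp [h1], rfl⟩

theorem isReduced_of_append {ω ω' : List B} (h : cs.IsReduced (ω ++ ω')) :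
    cs.IsReduced ω ∧ cs.IsReduced ω' := by
  have h1 := h.eq
  rw [cs.wordProd_append, List.length_append] at h1
  have h2 := cs.length_wordProd_le ω
  have h3 := cs.length_wordProd_le ω'
  have h4 := cs.length_mul_le (cs.wordProd ω) (cs.wordProd ω')
  constructor <;> rw [IsReduced] <;> omega

/-- A short x is a suffix of the alternating word of d that ends in the same letter. A longer x
would contain, as a suffix of a reduced word, the word of d ending in j followed by i, although i is
a descent of d. -/
theorem length_mul_inv_of_alternatingWord {i j : B} {d x : W}
    (h1 : cs.length (d * cs.simple i) < cs.length d)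
    (e1 : d = cs.wordProd (alternatingWord j i (cs.length d)))
    (e2 : d = cs.wordProd (alternatingWord i j (cs.length d)))
    (hx : x = cs.wordProd (alternatingWord j i (cs.length x))) :
    cs.length (d * x⁻¹) + cs.length x = cs.length d := by
  by_cases hk : cs.length x ≤ cs.length d
  · obtain ⟨ω, h2, h3⟩ := exists_append_alternatingWord j i (cs.length x)
      (cs.length d - cs.length x)
    rw [Nat.sub_add_cancel hk] at h3
    have h4 : d * x⁻¹ = cs.wordProd ω := by
      rw [mul_inv_eq_iff_eq_mul, e1, h3, cs.wordProd_append, ← hx]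
    have h5 := cs.length_wordProd_le ω
    have h6 := cs.length_mul_le (d * x⁻¹) x
    rw [inv_mul_cancel_right, h4] at h6
    rw [h4]
    omega
  · exfalso
    obtain ⟨ω, h2, h3⟩ := exists_append_alternatingWord j i (cs.length d + 1)
      (cs.length x - (cs.length d + 1))
    rw [Nat.sub_add_cancel (by omega)] at h3
    have h4 : cs.IsReduced (alternatingWord j i (cs.length x)) := by
      rw [IsReduced, ← hx, length_alternatingWord]
    rw [h3] at h4
    have h5 := (cs.isReduced_of_append h4).2.eq
    rw [alternatingWord_succ, cs.wordProd_concat, ← e2] at h5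
    simp at h5
    omega

theorem length_mul_inv_of_dihedral_descents {i j : B} {d x : W} (hd : d ∈ parabolic cs {i, j})
    (hi : cs.length (d * cs.simple i) < cs.length d)
    (hj : cs.length (d * cs.simple j) < cs.length d) (hx : x ∈ parabolic cs {i, j}) :
    cs.length (d * x⁻¹) + cs.length x = cs.length d := by
  have hd' : d ∈ parabolic cs {j, i} := by rwa [Set.pair_comm]
  have e2 := cs.eq_wordProd_alternatingWord hd hj
  have e1 := cs.eq_wordProd_alternatingWord hd' hi
  by_cases hx1 : x = 1
  · simp [hx1]
  · obtain ⟨u, hu, k, hk, he, hl⟩ := cs.exists_eq_mul_simple_of_mem_parabolic hx hx1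
    have hxk : cs.length (x * cs.simple k) < cs.length x := by
      rw [he, cs.simple_mul_simple_cancel_right, ← he]; exact hl
    rcases hk with rfl | hk
    · exact cs.length_mul_inv_of_alternatingWord hi e1 e2
        (cs.eq_wordProd_alternatingWord (by rwa [Set.pair_comm]) hxk)
    · rw [Set.mem_singleton_iff] at hk
      subst hk
      exact cs.length_mul_inv_of_alternatingWord hj e2 e1
        (cs.eq_wordProd_alternatingWord hx hxk)

/-- If every `j ∈ J` is a right descent of `w`, then every element of `W_J` is a suffix of `w`. -/
theorem length_mul_inv_of_descents {J : Set B} {w u : W}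
    (h : ∀ i ∈ J, cs.length (w * cs.simple i) < cs.length w) (hu : u ∈ parabolic cs J) :
    cs.length (w * u⁻¹) + cs.length u = cs.length w := by
  induction hn : cs.length u using Nat.strong_induction_on generalizing u with
  | _ n ih =>
  have hsplit : ∀ x ∈ parabolic cs J, x ≠ 1 → ∃ i ∈ J, ∃ y ∈ parabolic cs J,
      x = cs.simple i * y ∧ cs.length y < cs.length x := by
    intro x hx hx1
    obtain ⟨y, hy, i, hi, he, hl⟩ := cs.exists_eq_mul_simple_of_mem_parabolic
      (Subgroup.inv_mem _ hx) (inv_ne_one.2 hx1)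
    refine ⟨i, hi, y⁻¹, Subgroup.inv_mem _ hy, ?_, ?_⟩
    · rw [← inv_inv x, he]; simp
    · rwa [cs.length_inv] at hl ⊢
  subst hn
  by_cases hu1 : u = 1
  · simp [hu1]
  obtain ⟨i, hi, u', hu', rfl, hl⟩ := hsplit u hu hu1
  by_cases hu1' : u' = 1
  · subst hu1'
    have := cs.length_mul_simple_of_gt (h i hi)
    simpa using this
  obtain ⟨j, hj, u'', hu'', he, hl'⟩ := hsplit u' hu' hu1'
  have hK : parabolic cs {i, j} ≤ parabolic cs J := cs.parabolic_mono (by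
    rintro k (rfl | rfl) <;> assumption)
  -- Splitting off the dihedral part d of u' reduces the claim to rank two: by induction i and j are
  -- both descents of w z⁻¹, so its dihedral part is longest and has the element s_i d as a suffix.
  obtain ⟨z, d, hd, hdz, hz⟩ := cs.exists_left_min_coset {i, j} u'
  have hzJ : z ∈ parabolic cs J := by
    have : z = d⁻¹ * u' := by rw [hdz]; simp
    rw [this]
    exact Subgroup.mul_mem _ (Subgroup.inv_mem _ (hK hd)) hu'
  have hd1 : d ≠ 1 := by
    rintro rfl
    rw [one_mul] at hdz
    have := hz (cs.simple j) (cs.simple_mem_parabolic (by simp))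
    rw [← hdz, he, cs.simple_mul_simple_cancel_left, ← he] at this
    omega
  have hdpos : 0 < cs.length d := Nat.pos_of_ne_zero fun h0 => hd1 (cs.length_eq_zero_iff.1 h0)
  have hlu' : cs.length u' = cs.length d + cs.length z := by rw [hdz, hz d hd]
  have hz0 := ih (cs.length z) (by omega) hzJ rfl
  have hdesc : ∀ k ∈ ({i, j} : Set B),
      cs.length (w * z⁻¹ * cs.simple k) < cs.length (w * z⁻¹) := by
    intro k hk
    have h1 := hz (cs.simple k) (cs.simple_mem_parabolic hk)
    rw [cs.length_simple] at h1
    have h2 := ih (cs.length (cs.simple k * z)) (by omega)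
      (Subgroup.mul_mem _ (hK (cs.simple_mem_parabolic hk)) hzJ) rfl
    rw [mul_inv_rev, cs.inv_simple, ← mul_assoc] at h2
    omega
  obtain ⟨e₁, d', hd', he', hadd⟩ := cs.exists_min_coset {i, j} (w * z⁻¹)
  have hdesc' : ∀ k ∈ ({i, j} : Set B), cs.length (d' * cs.simple k) < cs.length d' := by
    intro k hk
    have := hdesc k hk
    rw [he', mul_assoc, hadd _ (Subgroup.mul_mem _ hd' (cs.simple_mem_parabolic hk)),
      hadd _ hd'] at this
    omega
  have hx : cs.simple i * d ∈ parabolic cs {i, j} :=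
    Subgroup.mul_mem _ (cs.simple_mem_parabolic (by simp)) hd
  have key := cs.length_mul_inv_of_dihedral_descents hd' (hdesc' i (by simp)) (hdesc' j (by simp))
    hx
  have h3 : w * (cs.simple i * u')⁻¹ = e₁ * (d' * (cs.simple i * d)⁻¹) := by
    rw [← mul_assoc, ← he', hdz]
    simp [mul_assoc]
  have h4 : cs.length (cs.simple i * u') = cs.length (cs.simple i * d) + cs.length z := by
    rw [hdz, ← mul_assoc, hz _ hx]
  have h5 : cs.length (w * z⁻¹) = cs.length e₁ + cs.length d' := by rw [he', hadd _ hd']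
  rw [h3, h4, hadd _ (Subgroup.mul_mem _ hd' (Subgroup.inv_mem _ hx))]
  omega

theorem length_mul_of_descents {J : Set B} {w u : W}
    (h : ∀ i ∈ J, cs.length (w * cs.simple i) < cs.length w) (hu : u ∈ parabolic cs J) :
    cs.length (w * u) + cs.length u = cs.length w := by
  have := cs.length_mul_inv_of_descents h (Subgroup.inv_mem _ hu)
  rwa [inv_inv, cs.length_inv] at this

/-- Since lengths subtract, exchange shows that each w u with u in W_J is spelled by a subword of
one fixed reduced word of w, and there are only finitely many subwords. -/
theorem finite_parabolic_of_descents {J : Set B} {w : W}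
    (h : ∀ i ∈ J, cs.length (w * cs.simple i) < cs.length w) :
    (parabolic cs J : Set W).Finite := by
  obtain ⟨ω, hω, he⟩ := cs.exists_isReduced w
  refine ((ω.sublists.finite_toSet).image fun σ => w⁻¹ * cs.wordProd σ).subset ?_
  intro u hu
  have : ∃ σ : List B, σ.Sublist ω ∧ w * u = cs.wordProd σ := by
    refine cs.parabolic_induction (J := J)
      (p := fun u => ∃ σ : List B, σ.Sublist ω ∧ w * u = cs.wordProd σ)
      ⟨ω, List.Sublist.refl _, by rw [mul_one, he]⟩ ?_ hu
    rintro v hv i hi hl ⟨σ, hσ, hv'⟩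
    have h1 := cs.length_mul_of_descents h hv
    have h2 := cs.length_mul_of_descents h
      (Subgroup.mul_mem _ hv (cs.simple_mem_parabolic hi))
    rw [← mul_assoc, hv'] at h2
    rw [hv'] at h1
    obtain ⟨j, hj, hj'⟩ := cs.exchange_right (ω := σ) (i := i) (by omega)
    exact ⟨σ.eraseIdx j, (List.eraseIdx_sublist _ _).trans hσ, by rw [← mul_assoc, hv', hj']⟩
  obtain ⟨σ, hσ, hu'⟩ := this
  exact ⟨σ, by simpa using hσ, by simp [← hu']⟩

theorem eq_of_descents_of_length_le {J : Set B} {w u : W} (hw : w ∈ parabolic cs J)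
    (h : ∀ i ∈ J, cs.length (w * cs.simple i) < cs.length w) (hu : u ∈ parabolic cs J)
    (hl : cs.length w ≤ cs.length u) : w = u := by
  have := cs.length_mul_of_descents h (Subgroup.mul_mem _ (Subgroup.inv_mem _ hw) hu)
  rw [mul_inv_cancel_left] at this
  have h0 : cs.length (w⁻¹ * u) = 0 := by omega
  rw [cs.length_eq_zero_iff] at h0
  exact inv_mul_eq_one.1 h0

/-! ### Words for the same element -/

/-- Matsumoto's theorem. If the two words end in i and j, both are descents of w, so w = w₁ d where
the dihedral part d has alternating words ending in either letter. By induction each word may be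
replaced by a word of w₁ followed by the matching alternating word, and the braid hypothesis
compares the two. The target is an arbitrary monoid so that galleries, as products of relations, are
covered. -/
theorem prod_map_eq_of_isReduced {A : Type*} [Monoid A] (f : B → A)
    (hf : ∀ i j k, cs.IsReduced (alternatingWord i j k) → cs.IsReduced (alternatingWord j i k) →
      cs.wordProd (alternatingWord i j k) = cs.wordProd (alternatingWord j i k) →
      ((alternatingWord i j k).map f).prod = ((alternatingWord j i k).map f).prod)
    {ω ω' : List B} (h : cs.IsReduced ω) (h' : cs.IsReduced ω')
    (he : cs.wordProd ω = cs.wordProd ω') : (ω.map f).prod = (ω'.map f).prod := by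
  induction hn : ω.length generalizing ω ω' with
  | zero =>
    have h0 : ω'.length = 0 := by rw [← h'.eq, ← he, h.eq, hn]
    rw [List.length_eq_zero_iff] at hn h0
    rw [hn, h0]
  | succ n ih =>
    have hlen : ω'.length = n + 1 := by rw [← h'.eq, ← he, h.eq, hn]
    have hne : ∀ l : List B, l.length = n + 1 → ∃ (l' : List B) (i : B), l = l'.concat i := by
      intro l hl
      rcases List.eq_nil_or_concat l with rfl | ⟨l', i, rfl⟩
      · simp at hl
      · exact ⟨l', i, by simp⟩
    obtain ⟨ω₁, i, rfl⟩ := hne ω hn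
    obtain ⟨ω₂, j, rfl⟩ := hne ω' hlen
    have r1 := cs.isReduced_of_concat h
    have r2 := cs.isReduced_of_concat h'
    set w := cs.wordProd (ω₁.concat i) with hw
    have d1 : cs.length (w * cs.simple i) < cs.length w := by
      rw [hw, cs.wordProd_concat, cs.simple_mul_simple_cancel_right]; exact r1.2
    have d2 : cs.length (w * cs.simple j) < cs.length w := by
      rw [he, cs.wordProd_concat, cs.simple_mul_simple_cancel_right]; exact r2.2
    obtain ⟨w₁, d, hd, hwd, hadd⟩ := cs.exists_min_coset {i, j} w
    have hdesc : ∀ k ∈ ({i, j} : Set B), cs.length (w * cs.simple k) < cs.length w →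
        cs.length (d * cs.simple k) < cs.length d := by
      intro k hk hk'
      rw [hwd, mul_assoc, hadd _ (Subgroup.mul_mem _ hd (cs.simple_mem_parabolic hk)),
        hadd _ hd] at hk'
      omega
    have e2 := cs.eq_wordProd_alternatingWord hd (hdesc j (by simp) d2)
    have hd' : d ∈ parabolic cs {j, i} := by rwa [Set.pair_comm]
    have e1 := cs.eq_wordProd_alternatingWord hd' (hdesc i (by simp) d1)
    obtain ⟨ρ, hρ, hρ'⟩ := cs.exists_isReduced w₁
    have hdpos : 0 < cs.length d := (Nat.zero_le _).trans_lt (hdesc i (by simp) d1)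
    obtain ⟨k, hk⟩ : ∃ k, cs.length d = k + 1 := ⟨cs.length d - 1, by omega⟩
    have main : ∀ (a b : B) (σ : List B), d = cs.wordProd (alternatingWord a b (cs.length d)) →
        cs.IsReduced σ → σ.length = n →
        w = cs.wordProd σ * cs.simple b →
        (σ.map f).prod * f b = (ρ.map f).prod * ((alternatingWord a b (cs.length d)).map f).prod := by
      intro a b σ ha hσ hσn hwσ
      have hred : cs.IsReduced ((ρ ++ alternatingWord b a k).concat b) := by
        have : (ρ ++ alternatingWord b a k).concat b = ρ ++ alternatingWord a b (k + 1) := by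
          rw [alternatingWord_succ]; simp
        rw [this, IsReduced, cs.wordProd_append, ← hk, ← ha, ← hρ', hadd _ hd, List.length_append,
          length_alternatingWord, ← hρ.eq, ← hρ']
      have := ih hσ (cs.isReduced_of_concat hred).1 (by
        have h1 : cs.wordProd (ρ ++ alternatingWord b a k) * cs.simple b = w := by
          rw [← cs.wordProd_concat]
          have : (ρ ++ alternatingWord b a k).concat b = ρ ++ alternatingWord a b (k + 1) := by
            rw [alternatingWord_succ]; simp
          rw [this, cs.wordProd_append, ← hk, ← ha, ← hρ', hwd]
        rw [← h1] at hwσ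
        exact (mul_right_cancel hwσ).symm) hσn
      rw [this, hk, alternatingWord_succ]
      simp [mul_assoc]
    have m1 := main j i ω₁ e1 r1.1 (by simpa using hn) (by rw [hw, cs.wordProd_concat])
    have m2 := main i j ω₂ e2 r2.1 (by simpa using hlen) (by rw [he, cs.wordProd_concat])
    have hbr := hf i j (cs.length d) (by rw [IsReduced, ← e2, length_alternatingWord])
      (by rw [IsReduced, ← e1, length_alternatingWord]) (by rw [← e1, ← e2])
    simp only [List.concat_eq_append, List.map_append, List.prod_append, List.map_cons,
      List.map_nil, List.prod_singleton]
    rw [m1, m2, hbr]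

end CoxeterSystem

/-! ### Combinatorics of roots -/

namespace CoxRoot

variable {B W : Type*} [Group W] {M : CoxeterMatrix B} {cs : CoxeterSystem M W}

theorem ext {α β : CoxRoot cs} (h : α.1 = β.1) : α = β := Subtype.ext h

theorem mem_act {w x : W} {α : CoxRoot cs} : x ∈ (α.act w).1 ↔ w⁻¹ * x ∈ α.1 :=
  Set.mem_smul_set_iff_inv_smul_mem

theorem mem_opp {x : W} {α : CoxRoot cs} : x ∈ α.opp.1 ↔ x ∉ α.1 := Iff.rfl

theorem mem_simple {x : W} {i : B} :
    x ∈ (simple cs i).1 ↔ cs.length x < cs.length (cs.simple i * x) := Iff.rfl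

@[simp] theorem act_one (α : CoxRoot cs) : α.act 1 = α := ext (by simp [act])

@[simp] theorem act_act (v w : W) (α : CoxRoot cs) : (α.act w).act v = α.act (v * w) :=
  ext (by simp [act, smul_smul])

@[simp] theorem opp_opp (α : CoxRoot cs) : α.opp.opp = α := ext (compl_compl _)

theorem act_opp (w : W) (α : CoxRoot cs) : α.opp.act w = (α.act w).opp := by
  apply ext
  ext x
  rw [mem_act, mem_opp, mem_opp, mem_act]

theorem isPos_opp {α : CoxRoot cs} : α.opp.IsPos ↔ ¬ α.IsPos := Iff.rfl

@[simp] theorem act_simple_self (i : B) : (simple cs i).act (cs.simple i) = (simple cs i).opp :=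
  ext (simpleRootSet_compl cs i).symm

theorem act_injective (w : W) : Function.Injective (act (cs := cs) w) := fun α β h => by
  simpa using congrArg (act w⁻¹) h

theorem isPos_act_simple {w : W} {i : B} :
    ((simple cs i).act w).IsPos ↔ cs.length w < cs.length (w * cs.simple i) := by
  rw [IsPos, mem_act, mem_simple, mul_one, cs.length_inv, ← cs.length_inv (_ * w⁻¹)]
  simp

theorem exists_eq_act (α : CoxRoot cs) : ∃ w i, α = (simple cs i).act w := by
  obtain ⟨w, i, h⟩ := α.2
  exact ⟨w, i, ext h⟩

theorem isPos_simple (i : B) : (simple cs i).IsPos := by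
  have := (isPos_act_simple (cs := cs) (w := 1) (i := i)).2 (by simp)
  rwa [act_one] at this

theorem nonempty (α : CoxRoot cs) : α.1.Nonempty := by
  obtain ⟨w, i, rfl⟩ := α.exists_eq_act
  exact ⟨w, by rw [mem_act, inv_mul_cancel]; exact isPos_simple i⟩

theorem nonempty_opp (α : CoxRoot cs) : ∃ x, x ∉ α.1 := α.opp.nonempty

/-- A form of the folding condition: a panel is cut by a root exactly when the reflection of the
root interchanges its two chambers. -/
theorem crossing_iff {w y : W} {i j : B} :
    (y ∈ ((simple cs i).act w).1 ↔ y * cs.simple j ∉ ((simple cs i).act w).1) ↔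
      w * cs.simple i * w⁻¹ * y = y * cs.simple j := by
  rw [mem_act, mem_act, mem_simple, mem_simple]
  have h1 : w * cs.simple i * w⁻¹ * y = y * cs.simple j ↔
      cs.simple i * (w⁻¹ * y) = w⁻¹ * y * cs.simple j := by
    rw [mul_assoc, mul_assoc, ← eq_inv_mul_iff_mul_eq, mul_assoc]
  rw [h1]
  set x := w⁻¹ * y with hx
  rw [← mul_assoc w⁻¹, ← hx]
  have n1 := cs.length_simple_mul_ne x i
  have n2 := cs.length_simple_mul_ne (x * cs.simple j) i
  constructor
  · intro h
    by_cases h2 : cs.length x < cs.length (cs.simple i * x)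
    · exact cs.simple_mul_eq_mul_simple h2 (by have := h.1 h2; omega)
    · have h3 : cs.length (x * cs.simple j) <
          cs.length (cs.simple i * (x * cs.simple j)) := by
        by_contra h3; exact h2 (h.2 h3)
      have := cs.simple_mul_eq_mul_simple (x := x * cs.simple j) (i := i) (j := j) h3 (by
        rw [cs.simple_mul_simple_cancel_right]; omega)
      rw [cs.simple_mul_simple_cancel_right, ← mul_assoc] at this
      calc cs.simple i * x = cs.simple i * x * cs.simple j * cs.simple j := by simp
        _ = x * cs.simple j := by rw [this]
  · intro h
    rw [← h, cs.simple_mul_simple_cancel_left]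
    omega

/-- By `crossing_iff` the reflection determines where membership changes along a gallery from 1, and
the sign fixes the starting value. -/
theorem eq_of_reflection {v w : W} {i j : B}
    (h : w * cs.simple i * w⁻¹ = v * cs.simple j * v⁻¹)
    (hpos : ((simple cs i).act w).IsPos ↔ ((simple cs j).act v).IsPos) :
    (simple cs i).act w = (simple cs j).act v := by
  apply ext
  ext y
  induction y using cs.simple_induction_right with
  | one => exact hpos
  | mul_simple_right y k ih =>
    have h1 := crossing_iff (cs := cs) (w := w) (y := y) (i := i) (j := k)
    have h2 := crossing_iff (cs := cs) (w := v) (y := y) (i := j) (j := k)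
    rw [h] at h1
    tauto

theorem eq_simple_of_isPos {α : CoxRoot cs} {i : B} (h : α.IsPos) (h' : cs.simple i ∉ α.1) :
    α = simple cs i := by
  obtain ⟨w, j, rfl⟩ := α.exists_eq_act
  have h1 := (crossing_iff (cs := cs) (w := w) (y := 1) (i := j) (j := i)).1 (by
    rw [one_mul]; exact ⟨fun _ => h', fun _ => h⟩)
  have := eq_of_reflection (cs := cs) (v := 1) (w := w) (i := j) (j := i) (by simpa using h1)
    (by rw [act_one]; exact ⟨fun _ => isPos_simple i, fun _ => h⟩)
  rwa [act_one] at this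

theorem prenilpotent_or (α β : CoxRoot cs) : α.Prenilpotent β ∨ α.opp.Prenilpotent β := by
  by_contra h
  simp only [Prenilpotent, not_or, not_and_or, opp_opp, Set.not_nonempty_iff_eq_empty,
    Set.eq_empty_iff_forall_notMem, Set.mem_inter_iff, mem_opp] at h
  obtain ⟨a, ha⟩ := α.nonempty
  obtain ⟨a', ha'⟩ := α.nonempty_opp
  obtain ⟨b, hb⟩ := β.nonempty
  obtain ⟨b', hb'⟩ := β.nonempty_opp
  obtain ⟨h1 | h1, h2 | h2⟩ := h
  · have := h1 b; have := h2 b; tauto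
  · have := h1 a; have := h2 a; tauto
  · have := h1 a'; have := h2 a'; tauto
  · have := h1 b'; have := h2 b'; tauto

theorem prenilpotent_act {w : W} {α β : CoxRoot cs} (h : α.Prenilpotent β) :
    (α.act w).Prenilpotent (β.act w) := by
  obtain ⟨⟨x, hx, hx'⟩, ⟨y, hy, hy'⟩⟩ := h
  refine ⟨⟨w * x, ?_, ?_⟩, ⟨w * y, ?_, ?_⟩⟩
  · rw [mem_act]; simpa
  · rw [mem_act]; simpa
  · rw [mem_opp, mem_act]; simpa
  · rw [mem_opp, mem_act]; simpa

/-- Positivity of a root with respect to the sign `ε`. -/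
def HasSign (ε : Bool) (α : CoxRoot cs) : Prop := α.IsPos ↔ ε = true

/-- The simple root of `i` of sign `ε`. -/
def signed (cs : CoxeterSystem M W) (ε : Bool) (i : B) : CoxRoot cs :=
  if ε then simple cs i else (simple cs i).opp

@[simp] theorem opp_signed (ε : Bool) (i : B) : (signed cs ε i).opp = signed cs (!ε) i := by
  cases ε <;> simp [signed]

@[simp] theorem act_signed (ε : Bool) (i : B) :
    (signed cs ε i).act (cs.simple i) = signed cs (!ε) i := by
  cases ε <;> simp [signed, act_opp]

theorem hasSign_not {ε : Bool} {α : CoxRoot cs} : α.HasSign (!ε) ↔ ¬ α.HasSign ε := by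
  cases ε <;> simp [HasSign]

theorem hasSign_opp {ε : Bool} {α : CoxRoot cs} : α.opp.HasSign ε ↔ ¬ α.HasSign ε := by
  cases ε <;> simp [HasSign, isPos_opp]

theorem hasSign_signed (ε : Bool) (i : B) : (signed cs ε i).HasSign ε := by
  cases ε <;> simp [HasSign, signed, isPos_opp, isPos_simple]

theorem hasSign_act_signed {ε ε' : Bool} {w : W} {i : B} :
    ((signed cs ε i).act w).HasSign ε' ↔
      (ε = ε' ↔ cs.length w < cs.length (w * cs.simple i)) := by
  rw [← isPos_act_simple]
  cases ε <;> cases ε' <;> simp [HasSign, signed, act_opp, isPos_opp]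

theorem exists_eq_act_signed (ε : Bool) (α : CoxRoot cs) : ∃ w i, α = (signed cs ε i).act w := by
  obtain ⟨w, i, rfl⟩ := α.exists_eq_act
  cases ε
  · exact ⟨w * cs.simple i, i, by rw [← act_act, act_signed]; rfl⟩
  · exact ⟨w, i, rfl⟩

theorem eq_signed_of_hasSign {ε : Bool} {α : CoxRoot cs} {i : B} (h : α.HasSign ε)
    (h' : ¬ (α.act (cs.simple i)).HasSign ε) : α = signed cs ε i := by
  have key : ∀ α : CoxRoot cs, (α.act (cs.simple i)).IsPos ↔ cs.simple i ∈ α.1 := by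
    intro α
    rw [IsPos, mem_act, cs.inv_simple, mul_one]
  cases ε
  · simp only [HasSign, Bool.false_eq_true, iff_false, not_not, key] at h h'
    have : α.opp = simple cs i := eq_simple_of_isPos h (by rw [mem_opp]; simpa using h')
    rw [← opp_opp α, this]; rfl
  · simp only [HasSign, iff_true, key] at h h'
    exact eq_simple_of_isPos h h'

theorem hasSign_act_simple {ε : Bool} {α : CoxRoot cs} {i : B} (h : α.HasSign ε)
    (h' : α ≠ signed cs ε i) : (α.act (cs.simple i)).HasSign ε := by
  by_contra hc; exact h' (eq_signed_of_hasSign h hc)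

theorem act_simple_ne_signed {ε : Bool} {α : CoxRoot cs} {i : B} (h : α.HasSign ε) :
    α.act (cs.simple i) ≠ signed cs ε i := by
  intro hc
  have := congrArg (act (cs.simple i)) hc
  rw [act_act, cs.simple_mul_simple_self, act_one, act_signed] at this
  rw [this, ← opp_signed, hasSign_opp] at h
  exact h (hasSign_signed ε i)

theorem hasSign_of_mem_openInterval {ε : Bool} {α β γ : CoxRoot cs} (hα : α.HasSign ε)
    (hβ : β.HasSign ε) (hγ : γ ∈ α.openInterval β) : γ.HasSign ε := by
  cases ε
  · simp only [HasSign, Bool.false_eq_true, iff_false] at *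
    exact hγ.2.2.2 ⟨hα, hβ⟩
  · simp only [HasSign, iff_true] at *
    exact hγ.2.2.1 ⟨hα, hβ⟩

end CoxRoot

theorem CoxeterSystem.exists_folding {B W : Type*} [Group W] {M : CoxeterMatrix B}
    (cs : CoxeterSystem M W) {i : B} {ω : List B}
    (h : cs.length (cs.simple i * cs.wordProd ω) < cs.length (cs.wordProd ω)) :
    ∃ a j b, ω = a ++ j :: b ∧ cs.length (cs.wordProd a) < cs.length (cs.simple i * cs.wordProd a) ∧
      cs.simple i * cs.wordProd a = cs.wordProd a * cs.simple j := by
  induction ω using List.reverseRecOn with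
  | nil => simp at h
  | append_singleton ω j ih =>
    by_cases h1 : cs.length (cs.simple i * cs.wordProd ω) < cs.length (cs.wordProd ω)
    · obtain ⟨a, k, b, rfl, h2, h3⟩ := ih h1
      exact ⟨a, k, b ++ [j], by simp, h2, h3⟩
    · have h2 := cs.length_simple_mul_ne (cs.wordProd ω) i
      rw [← List.concat_eq_append, cs.wordProd_concat] at h
      exact ⟨ω, j, [], rfl, by omega, cs.simple_mul_eq_mul_simple (by omega) h⟩

/-! ### Conjugates of subgroups -/

section Conj

variable {G : Type*} [Group G]

theorem mem_conjSubgroup {g x : G} {H : Subgroup G} :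
    x ∈ conjSubgroup g H ↔ g⁻¹ * x * g ∈ H := by
  rw [conjSubgroup, Subgroup.mem_map]
  constructor
  · rintro ⟨y, hy, rfl⟩
    simpa [mul_assoc] using hy
  · intro h
    exact ⟨_, h, by simp [mul_assoc]⟩

theorem conj_mem_conjSubgroup {g x : G} {H : Subgroup G} (h : x ∈ H) :
    g * x * g⁻¹ ∈ conjSubgroup g H := by
  rw [mem_conjSubgroup]; simpa [mul_assoc] using h

theorem conjSubgroup_one (H : Subgroup G) : conjSubgroup 1 H = H := by
  ext x; simp [mem_conjSubgroup]

theorem conjSubgroup_mul (g h : G) (H : Subgroup G) :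
    conjSubgroup (g * h) H = conjSubgroup g (conjSubgroup h H) := by
  ext x; simp [mem_conjSubgroup, mul_assoc]

theorem conjSubgroup_self {g : G} {H : Subgroup G} (h : g ∈ H) : conjSubgroup g H = H := by
  ext x
  rw [mem_conjSubgroup, H.mul_mem_cancel_right h, H.mul_mem_cancel_left (H.inv_mem h)]

theorem conjSubgroup_inv_eq_iff {g : G} {H K : Subgroup G} :
    conjSubgroup g⁻¹ H = K ↔ H = conjSubgroup g K := by
  constructor
  · rintro rfl; rw [← conjSubgroup_mul, mul_inv_cancel, conjSubgroup_one]
  · rintro rfl; rw [← conjSubgroup_mul, inv_mul_cancel, conjSubgroup_one]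

end Conj

/-! ### The quotient of `N` by the torus -/

namespace RGDSystem

open CoxRoot

variable {B W : Type*} [Group W] {M : CoxeterMatrix B} {cs : CoxeterSystem M W}
variable {G : Type u} [Group G] (R : RGDSystem cs G)

/-- `n` permutes the root groups as `w` permutes the roots. -/
def PermutesAs (n : G) (w : W) : Prop := ∀ β, conjSubgroup n (R.U β) = R.U (β.act w)

variable {R}

theorem PermutesAs.mul {n m : G} {v w : W} (hn : R.PermutesAs n v) (hm : R.PermutesAs m w) :
    R.PermutesAs (n * m) (v * w) := fun β => by
  rw [conjSubgroup_mul, hm, hn, act_act]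

theorem PermutesAs.inv {n : G} {w : W} (hn : R.PermutesAs n w) : R.PermutesAs n⁻¹ w⁻¹ := fun β => by
  rw [conjSubgroup_inv_eq_iff, hn, act_act, mul_inv_cancel, act_one]

theorem permutesAs_torus {t : G} (ht : t ∈ R.T) : R.PermutesAs t 1 := fun β => by
  rw [R.torus_normalizes β t ht, act_one]

theorem PermutesAs.conj_mem {n : G} {w : W} (hn : R.PermutesAs n w) {β : CoxRoot cs} {x : G}
    (hx : x ∈ R.U β) : n * x * n⁻¹ ∈ R.U (β.act w) := by
  rw [← hn β]; exact conj_mem_conjSubgroup hx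

theorem PermutesAs.inv_conj_mem {n : G} {w : W} (hn : R.PermutesAs n w) {β : CoxRoot cs} {x : G}
    (hx : x ∈ R.U β) : n⁻¹ * x * n ∈ R.U (β.act w⁻¹) := by
  simpa using hn.inv.conj_mem hx

theorem U_le_unip {ε : Bool} {α : CoxRoot cs} (h : α.HasSign ε) : R.U α ≤ R.unip ε :=
  le_iSup₂_of_le α h le_rfl

variable (R)

/-- The negative simple root groups are not contained in the positive unipotent group, where
positivity is taken with respect to `ε`. -/
def NotOppLe (ε : Bool) : Prop := ∀ i, ¬ R.U (signed cs (!ε) i) ≤ R.unip ε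

theorem notOppLe_true : R.NotOppLe true := by
  intro i h
  refine R.not_neg_le_pos i ?_
  simpa [signed, unip] using h

/-- The elements `μ(u)` for `u ≠ 1` in the simple root group of `i`. -/
def Mu (i : B) (n : G) : Prop := ∃ u ∈ R.U (simple cs i), u ≠ 1 ∧ R.IsMu i u n

variable {R}

theorem exists_ne_one (α : CoxRoot cs) : ∃ u ∈ R.U α, u ≠ 1 :=
  (Subgroup.ne_bot_iff_exists_ne_one (H := R.U α)).1 (R.root_ne_bot α) |>.elim
    fun a ha => ⟨a, a.2, fun h => ha (Subtype.ext h)⟩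

theorem Mu.permutesAs {i : B} {n : G} (h : R.Mu i n) : R.PermutesAs n (cs.simple i) := by
  obtain ⟨u, _, _, h⟩ := h
  exact h.2

theorem exists_isMu {i : B} {u : G} (hu : u ∈ R.U (simple cs i)) (h : u ≠ 1) :
    ∃ n, R.IsMu i u n := by
  obtain ⟨m, hm, _⟩ := R.exists_mu i
  exact ⟨m u, hm u hu h⟩

theorem exists_mu_elt (R : RGDSystem cs G) (i : B) : ∃ n, R.Mu i n := by
  obtain ⟨u, hu, h⟩ := exists_ne_one (R := R) (simple cs i)
  obtain ⟨n, hn⟩ := exists_isMu hu h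
  exact ⟨n, u, hu, h, hn⟩

theorem U_opp_ne (i : B) : R.U (simple cs i).opp ≠ R.U (simple cs i) := by
  intro h
  refine R.notOppLe_true i ?_
  change R.U (simple cs i).opp ≤ _
  rw [h]
  exact U_le_unip (hasSign_signed true i)

/-- Transporting a nontrivial a to the simple root group, taking its μ and transporting back puts a
reflection representative into U_α a U_α. It would normalize U_α if a did, yet it carries U_α to
U_{-α}, and these groups differ. -/
theorem eq_one_of_normalizes {i : B} {a : G} (ha : a ∈ R.U (simple cs i).opp)
    (h : conjSubgroup a (R.U (simple cs i)) = R.U (simple cs i)) : a = 1 := by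
  by_contra hne
  obtain ⟨m, hm⟩ := R.exists_mu_elt i
  have hm := hm.permutesAs
  have hb : m⁻¹ * a * m ∈ R.U (simple cs i) := by
    have := hm.inv_conj_mem ha
    rwa [cs.inv_simple, act_opp, act_simple_self, opp_opp] at this
  obtain ⟨m', ⟨x, hx, y, hy, he⟩, hm'⟩ := exists_isMu hb (by
    intro h0
    apply hne
    rw [mul_eq_one_iff_eq_inv, inv_mul_eq_iff_eq_mul] at h0
    simpa using h0)
  have hm' : R.PermutesAs m' (cs.simple i) := hm'
  have hc := (hm.mul hm').mul hm.inv
  have hx' := hm.conj_mem hx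
  have hy' := hm.conj_mem hy
  rw [act_opp, act_simple_self, opp_opp] at hx' hy'
  have e : m * m' * m⁻¹ = (m * x * m⁻¹) * a * (m * y * m⁻¹) := by rw [he]; group
  have h1 := hc (simple cs i)
  rw [e, conjSubgroup_mul, conjSubgroup_mul, conjSubgroup_self hy', h, conjSubgroup_self hx',
    cs.simple_mul_simple_self, one_mul, cs.inv_simple, act_simple_self] at h1
  exact U_opp_ne i h1.symm

theorem eq_one_of_normalizes_opp {i : B} {c : G} (hc : c ∈ R.U (simple cs i))
    (h : conjSubgroup c (R.U (simple cs i).opp) = R.U (simple cs i).opp) : c = 1 := by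
  obtain ⟨m, hm⟩ := R.exists_mu_elt i
  have hm := hm.permutesAs
  have h1 : m * c * m⁻¹ ∈ R.U (simple cs i).opp := by
    have := hm.conj_mem hc
    rwa [act_simple_self] at this
  have h2 := eq_one_of_normalizes h1 (by
    rw [conjSubgroup_mul, conjSubgroup_mul, hm.inv, cs.inv_simple, act_simple_self, h, hm,
      act_opp, act_simple_self, opp_opp])
  rw [mul_inv_eq_one] at h2
  simpa using h2

/-- The axiom only provides some choice of μ, while `N` uses all admissible elements. Two of them
differ by an element of U_{-α} U_α that fixes every root group; normalizing U_α kills the first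
factor, and normalizing U_{-α} then kills the second. -/
theorem IsMu.unique {i : B} {u n n' : G} (h : R.IsMu i u n) (h' : R.IsMu i u n') : n = n' := by
  obtain ⟨⟨x, hx, y, hy, he⟩, hn⟩ := h
  obtain ⟨⟨x', hx', y', hy', he'⟩, hn'⟩ := h'
  have hn : R.PermutesAs n (cs.simple i) := hn
  have hn' : R.PermutesAs n' (cs.simple i) := hn'
  have hc := hn.conj_mem (mul_mem (inv_mem hy) hy')
  rw [act_opp, act_simple_self, opp_opp] at hc
  have ha := mul_mem hx' (inv_mem hx)
  have e : n' * n⁻¹ = (x' * x⁻¹) * (n * (y⁻¹ * y') * n⁻¹) := by rw [he, he']; group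
  have hp := hn'.mul hn.inv
  rw [e, cs.inv_simple, cs.simple_mul_simple_self] at hp
  have h1 := hp (simple cs i)
  rw [conjSubgroup_mul, conjSubgroup_self hc, act_one] at h1
  have h2 := eq_one_of_normalizes ha h1
  rw [h2, one_mul] at hp e
  have h3 := hp (simple cs i).opp
  rw [act_one] at h3
  rw [eq_one_of_normalizes_opp hc h3, mul_inv_eq_one] at e
  exact e.symm

theorem Mu.inv {i : B} {n : G} (h : R.Mu i n) : R.Mu i n⁻¹ := by
  obtain ⟨u, hu, hu1, ⟨x, hx, y, hy, he⟩, hn⟩ := h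
  refine ⟨u⁻¹, inv_mem hu, inv_ne_one.2 hu1, ⟨y⁻¹, inv_mem hy, x⁻¹, inv_mem hx, ?_⟩, ?_⟩
  · rw [he]; group
  · have := (show R.PermutesAs n (cs.simple i) from hn).inv
    rwa [cs.inv_simple] at this

theorem Mu.inv_mul {i : B} {n n' : G} (h : R.Mu i n) (h' : R.Mu i n') : n⁻¹ * n' ∈ R.T := by
  obtain ⟨m, hm, hT⟩ := R.exists_mu i
  obtain ⟨u, hu, hu1, hn⟩ := h
  obtain ⟨v, hv, hv1, hn'⟩ := h'
  rw [hn.unique (hm u hu hu1), hn'.unique (hm v hv hv1)]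
  exact hT u hu hu1 v hv hv1

theorem Mu.mul_mem_torus {i : B} {n n' : G} (h : R.Mu i n) (h' : R.Mu i n') : n * n' ∈ R.T := by
  simpa using h.inv.inv_mul h'

theorem Mu.conj {i j : B} {n x : G} {w : W} (h : R.Mu i n) (hx : R.PermutesAs x w)
    (hw : (simple cs i).act w = simple cs j) (hw' : w * cs.simple i * w⁻¹ = cs.simple j) :
    R.Mu j (x * n * x⁻¹) := by
  obtain ⟨u, hu, hu1, ⟨y, hy, z, hz, he⟩, hn⟩ := h
  have hp := (hx.mul (show R.PermutesAs n (cs.simple i) from hn)).mul hx.inv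
  rw [hw'] at hp
  have hu' := hx.conj_mem hu
  have hy' := hx.conj_mem hy
  have hz' := hx.conj_mem hz
  rw [act_opp] at hy' hz'
  rw [hw] at hu' hy' hz'
  exact ⟨_, hu', by simpa using hu1, ⟨_, hy', _, hz', by rw [he]; group⟩, hp⟩

theorem Mu.torus_conj {i : B} {n t : G} (h : R.Mu i n) (ht : t ∈ R.T) : R.Mu i (t * n * t⁻¹) :=
  h.conj (permutesAs_torus ht) (by simp) (by simp)

theorem Mu.conj_torus {i : B} {n t : G} (h : R.Mu i n) (ht : t ∈ R.T) : n * t * n⁻¹ ∈ R.T := by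
  have h1 := (h.torus_conj (inv_mem ht)).mul_mem_torus h.inv
  have := mul_mem ht h1
  convert this using 1
  group

theorem Mu.inv_conj_torus {i : B} {n t : G} (h : R.Mu i n) (ht : t ∈ R.T) :
    n⁻¹ * t * n ∈ R.T := by
  simpa using h.inv.conj_torus ht

variable (R)

/-- `n` is a product of elements `μ(u)` along the word, times an element of the torus. -/
def WordRep : List B → G → Prop
  | [], n => n ∈ R.T
  | i :: ω, n => ∃ m n', R.Mu i m ∧ WordRep ω n' ∧ n = m * n'

variable {R}

theorem WordRep.torus_mul {ω : List B} {n t : G} (h : R.WordRep ω n) (ht : t ∈ R.T) :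
    R.WordRep ω (t * n) := by
  induction ω generalizing n t with
  | nil => exact mul_mem ht h
  | cons i ω ih =>
    obtain ⟨m, n', hm, hn', rfl⟩ := h
    exact ⟨m, _, hm, ih hn' (hm.inv_conj_torus ht), by group⟩

theorem WordRep.permutesAs {ω : List B} {n : G} (h : R.WordRep ω n) :
    R.PermutesAs n (cs.wordProd ω) := by
  induction ω generalizing n with
  | nil => simpa using permutesAs_torus h
  | cons i ω ih =>
    obtain ⟨m, n', hm, hn', rfl⟩ := h
    rw [cs.wordProd_cons]
    exact hm.permutesAs.mul (ih hn')

theorem wordRep_append {ω ω' : List B} {n : G} :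
    R.WordRep (ω ++ ω') n ↔ ∃ a b, R.WordRep ω a ∧ R.WordRep ω' b ∧ n = a * b := by
  induction ω generalizing n with
  | nil =>
    constructor
    · intro h; exact ⟨1, n, one_mem R.T, h, by simp⟩
    · rintro ⟨a, b, ha, hb, rfl⟩; exact hb.torus_mul ha
  | cons i ω ih =>
    constructor
    · rintro ⟨m, n', hm, hn', rfl⟩
      obtain ⟨a, b, ha, hb, rfl⟩ := ih.1 hn'
      exact ⟨m * a, b, ⟨m, a, hm, ha, rfl⟩, hb, by group⟩
    · rintro ⟨_, b, ⟨m, a, hm, ha, rfl⟩, hb, rfl⟩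
      exact ⟨m, a * b, hm, ih.2 ⟨a, b, ha, hb, rfl⟩, by group⟩

theorem torus_le_N : R.T ≤ R.N := le_sup_left

theorem Mu.mem_N {i : B} {n : G} (h : R.Mu i n) : n ∈ R.N :=
  (le_sup_right : _ ≤ R.N) (Subgroup.subset_closure ⟨i, h⟩)

theorem WordRep.mem_N {ω : List B} {n : G} (h : R.WordRep ω n) : n ∈ R.N := by
  induction ω generalizing n with
  | nil => exact torus_le_N h
  | cons i ω ih =>
    obtain ⟨m, n', hm, hn', rfl⟩ := h
    exact mul_mem hm.mem_N (ih hn')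

theorem exists_wordRep (R : RGDSystem cs G) (ω : List B) : ∃ n, R.WordRep ω n := by
  induction ω with
  | nil => exact ⟨1, one_mem R.T⟩
  | cons i ω ih =>
    obtain ⟨n', hn'⟩ := ih
    obtain ⟨m, hm⟩ := R.exists_mu_elt i
    exact ⟨m * n', m, n', hm, hn', rfl⟩

theorem exists_wordRep_of_mem_N {n : G} (h : n ∈ R.N) : ∃ ω, R.WordRep ω n := by
  have hN : R.N = Subgroup.closure ((R.T : Set G) ∪ {n | ∃ i, R.Mu i n}) := by
    rw [Subgroup.closure_union, Subgroup.closure_eq]; rfl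
  rw [hN] at h
  induction h using Subgroup.closure_induction_left with
  | one => exact ⟨[], one_mem R.T⟩
  | mul_left x hx y _ ih =>
    obtain ⟨ω, hω⟩ := ih
    rcases hx with hx | ⟨i, hx⟩
    · exact ⟨ω, hω.torus_mul hx⟩
    · exact ⟨i :: ω, x, y, hx, hω, rfl⟩
  | inv_mul_cancel x hx y _ ih =>
    obtain ⟨ω, hω⟩ := ih
    rcases hx with hx | ⟨i, hx⟩
    · exact ⟨ω, hω.torus_mul (inv_mem hx)⟩
    · exact ⟨i :: ω, x⁻¹, y, hx.inv, hω, rfl⟩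

/-- Deletion lifts to N. When s_i shortens a word, folding gives a letter j behind a prefix that
carries α_j to α_i. Conjugating the μ-element of i past that prefix gives a μ-element of j, and two
μ-elements of the same type multiply into T. -/
theorem WordRep.exists_isReduced {ω : List B} {n : G} (h : R.WordRep ω n) :
    ∃ ω', cs.IsReduced ω' ∧ R.WordRep ω' n := by
  induction ω generalizing n with
  | nil => exact ⟨[], by simp [CoxeterSystem.IsReduced], h⟩
  | cons i ω ih =>
    obtain ⟨m, n', hm, hn', rfl⟩ := h
    obtain ⟨σ, hσ, hn'⟩ := ih hn'
    rcases cs.length_simple_mul (cs.wordProd σ) i with hl | hl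
    · refine ⟨i :: σ, ?_, m, n', hm, hn', rfl⟩
      rw [CoxeterSystem.IsReduced, cs.wordProd_cons, hl, hσ.eq, List.length_cons]
    · obtain ⟨a, j, b, rfl, h1, h2⟩ := cs.exists_folding (i := i) (ω := σ) (by omega)
      obtain ⟨x, _, hx, ⟨m', y, hm', hy, rfl⟩, rfl⟩ := wordRep_append.1 hn'
      have h3 : (cs.wordProd a)⁻¹ * cs.simple i * cs.wordProd a = cs.simple j := by
        rw [mul_assoc, h2, inv_mul_cancel_left]
      have h4 : (simple cs i).act (cs.wordProd a)⁻¹ = simple cs j := by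
        have := eq_of_reflection (cs := cs) (w := (cs.wordProd a)⁻¹) (v := 1) (i := i) (j := j)
          (by simpa using h3) (by
            rw [act_one, isPos_act_simple, cs.length_inv, ← cs.length_inv (_ * cs.simple i)]
            simp [isPos_simple, h1])
        rwa [act_one] at this
      have hm2 : R.Mu j (x⁻¹ * m * x) := by
        have := hm.conj hx.permutesAs.inv h4 (by rw [inv_inv]; exact h3)
        rwa [inv_inv] at this
      refine ⟨a ++ b, ?_, wordRep_append.2 ⟨x, _, hx, hy.torus_mul (hm2.mul_mem_torus hm'), by group⟩⟩
      have h5 : cs.wordProd (a ++ b) = cs.simple i * cs.wordProd (a ++ j :: b) := by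
        rw [cs.wordProd_append, cs.wordProd_append, cs.wordProd_cons, ← mul_assoc, h2]
        simp [mul_assoc]
      have h6 := hσ.eq
      rw [CoxeterSystem.IsReduced, h5]
      simp only [List.length_append, List.length_cons] at h6 ⊢
      omega

/-- For a left descent i of w, the element w⁻¹ makes the simple root of sign -ε a root of sign ε.
Stability of U_ε would then put that simple root group into U_ε. -/
theorem eq_one_of_permutesAs {ε : Bool} (hN : R.NotOppLe ε) {n : G} {w : W}
    (hn : R.PermutesAs n w) (h : ∀ x ∈ R.unip ε, n * x * n⁻¹ ∈ R.unip ε) : w = 1 := by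
  by_contra hw
  obtain ⟨i, hi⟩ := cs.exists_leftDescent_of_ne_one hw
  have hi : cs.length (cs.simple i * w) < cs.length w := hi
  have hpos : ((signed cs (!ε) i).act w⁻¹).HasSign ε := by
    rw [hasSign_act_signed, cs.length_inv, ← cs.length_inv (_ * cs.simple i)]
    simp only [mul_inv_rev, cs.inv_simple, inv_inv]
    cases ε <;> simp <;> omega
  refine hN i fun x hx => ?_
  have h1 := h _ (U_le_unip hpos (hn.inv_conj_mem hx))
  simpa [mul_assoc] using h1

theorem Represents.permutesAs {n : G} {w : W} (h : R.Represents n w) : R.PermutesAs n w := h.2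

theorem Represents.mul {n m : G} {v w : W} (hn : R.Represents n v) (hm : R.Represents m w) :
    R.Represents (n * m) (v * w) := ⟨mul_mem hn.1 hm.1, hn.permutesAs.mul hm.permutesAs⟩

theorem Represents.inv {n : G} {w : W} (hn : R.Represents n w) : R.Represents n⁻¹ w⁻¹ :=
  ⟨inv_mem hn.1, hn.permutesAs.inv⟩

theorem represents_torus {t : G} (ht : t ∈ R.T) : R.Represents t 1 :=
  ⟨torus_le_N ht, permutesAs_torus ht⟩

theorem represents_one : R.Represents 1 1 := represents_torus (one_mem _)

theorem Mu.represents {i : B} {n : G} (h : R.Mu i n) : R.Represents n (cs.simple i) :=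
  ⟨h.mem_N, h.permutesAs⟩

theorem exists_represents (R : RGDSystem cs G) (w : W) : ∃ n, R.Represents n w := by
  obtain ⟨ω, _, rfl⟩ := cs.exists_isReduced w
  obtain ⟨n, hn⟩ := R.exists_wordRep ω
  exact ⟨n, hn.mem_N, hn.permutesAs⟩

theorem conj_mem_unip {ε : Bool} {n : G} (hn : R.PermutesAs n 1) {x : G} (hx : x ∈ R.unip ε) :
    n * x * n⁻¹ ∈ R.unip ε := by
  have : R.unip ε ≤ (R.unip ε).comap (MulAut.conj n).toMonoidHom := by
    refine iSup₂_le fun α hα y hy => ?_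
    have := hn.conj_mem hy
    rw [act_one] at this
    exact U_le_unip hα this
  exact this hx

/-- This makes N/T isomorphic to W: the element has a reduced word, and acting trivially on root
groups it preserves U_+, so that word is empty. -/
theorem Represents.mem_torus {n : G} (h : R.Represents n 1) : n ∈ R.T := by
  obtain ⟨ω, hω⟩ := exists_wordRep_of_mem_N h.1
  obtain ⟨ω', hr, hω'⟩ := hω.exists_isReduced
  have h1 := eq_one_of_permutesAs R.notOppLe_true hω'.permutesAs
    (fun x hx => conj_mem_unip h.permutesAs hx)
  have h2 := hr.eq
  rw [h1, cs.length_one] at h2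
  rw [List.eq_nil_of_length_eq_zero h2.symm] at hω'
  exact hω'

theorem Represents.inv_mul_mem {n m : G} {w : W} (hn : R.Represents n w)
    (hm : R.Represents m w) : n⁻¹ * m ∈ R.T := by
  have := hn.inv.mul hm
  rw [inv_mul_cancel] at this
  exact this.mem_torus

theorem Represents.conj_torus {n t : G} {w : W} (hn : R.Represents n w) (ht : t ∈ R.T) :
    n * t * n⁻¹ ∈ R.T := by
  have := (hn.mul (represents_torus ht)).mul hn.inv
  rw [mul_one, mul_inv_cancel] at this
  exact this.mem_torus

end RGDSystem

theorem exists_mul_of_mem_sup {G : Type*} [Group G] {H K : Subgroup G}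
    (hc : ∀ h ∈ H, ∀ k ∈ K, h * k * h⁻¹ ∈ K) {x : G} (hx : x ∈ H ⊔ K) :
    ∃ k ∈ K, ∃ h ∈ H, x = k * h := by
  rw [← Subgroup.closure_eq H, ← Subgroup.closure_eq K, ← Subgroup.closure_union] at hx
  have step : ∀ a ∈ (H : Set G) ∪ K, ∀ y, (∃ k ∈ K, ∃ h ∈ H, y = k * h) →
      ∃ k ∈ K, ∃ h ∈ H, a * y = k * h := by
    rintro a (ha | ha) _ ⟨k, hk, h, hh, rfl⟩
    · exact ⟨a * k * a⁻¹, hc a ha k hk, a * h, mul_mem ha hh, by group⟩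
    · exact ⟨a * k, mul_mem ha hk, h, hh, by group⟩
  induction hx using Subgroup.closure_induction_left with
  | one => exact ⟨1, one_mem _, 1, one_mem _, by simp⟩
  | mul_left a ha y _ ih => exact step a ha y ih
  | inv_mul_cancel a ha y _ ih =>
    exact step a⁻¹ (ha.imp (fun h => H.inv_mem h) (fun h => K.inv_mem h)) y ih

namespace RGDSystem

open CoxRoot

variable {B W : Type*} [Group W] {M : CoxeterMatrix B} {cs : CoxeterSystem M W}
variable {G : Type u} [Group G] {R : RGDSystem cs G}

/-! ### Structure of the Borel subgroups -/

theorem iSup_U_induction {P : CoxRoot cs → Prop} {p : G → Prop}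
    (hU : ∀ α, P α → ∀ x ∈ R.U α, p x) (one : p 1) (mul : ∀ x y, p x → p y → p (x * y))
    {x : G} (hx : x ∈ ⨆ (α) (_ : P α), R.U α) : p x := by
  refine Subgroup.iSup_induction _ (C := p) hx ?_ one mul
  intro α y hy
  exact Subgroup.iSup_induction _ (C := p) hy (fun h z hz => hU α h z hz) one mul

theorem exists_borel_decomp {ε : Bool} {b : G} (hb : b ∈ R.borel ε) :
    ∃ x ∈ R.unip ε, ∃ t ∈ R.T, b = x * t :=
  exists_mul_of_mem_sup (fun _ ht _ hx => conj_mem_unip (permutesAs_torus ht) hx) hb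

theorem unip_le_borel (ε : Bool) : R.unip ε ≤ R.borel ε := le_sup_right

theorem torus_le_borel (ε : Bool) : R.T ≤ R.borel ε := le_sup_left

theorem U_le_borel {ε : Bool} {α : CoxRoot cs} (h : α.HasSign ε) : R.U α ≤ R.borel ε :=
  (U_le_unip h).trans (unip_le_borel ε)

theorem conj_mem_unip_of_mem_borel {ε : Bool} {b x : G} (hb : b ∈ R.borel ε)
    (hx : x ∈ R.unip ε) : b * x * b⁻¹ ∈ R.unip ε := by
  obtain ⟨y, hy, t, ht, rfl⟩ := exists_borel_decomp hb
  have := mul_mem (mul_mem hy (conj_mem_unip (permutesAs_torus ht) hx)) (inv_mem hy)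
  convert this using 1
  group

/-- Every nontrivial element of a simple root group of sign `ε` gives a representative of the
reflection after multiplication with elements of the opposite root group. -/
theorem exists_represents_of_ne_one {ε : Bool} {i : B} {u : G} (hu : u ∈ R.U (signed cs ε i))
    (h1 : u ≠ 1) : ∃ a ∈ R.U (signed cs (!ε) i), ∃ b ∈ R.U (signed cs (!ε) i), ∃ m,
      R.Represents m (cs.simple i) ∧ u = a * m * b := by
  cases ε
  · obtain ⟨n, hn⟩ := R.exists_mu_elt i
    have hv := hn.permutesAs.inv_conj_mem hu
    rw [cs.inv_simple, act_signed] at hv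
    obtain ⟨m, hm⟩ := exists_isMu (i := i) hv (by
      intro h0
      apply h1
      rw [mul_eq_one_iff_eq_inv, inv_mul_eq_iff_eq_mul] at h0
      simpa using h0)
    have hmu : R.Mu i m := ⟨_, hv, by
      intro h0
      apply h1
      rw [mul_eq_one_iff_eq_inv, inv_mul_eq_iff_eq_mul] at h0
      simpa using h0, hm⟩
    obtain ⟨⟨x, hx, y, hy, he⟩, _⟩ := hm
    have hx' := hn.permutesAs.conj_mem (inv_mem hx)
    have hy' := hn.permutesAs.conj_mem (inv_mem hy)
    rw [act_opp, act_simple_self, opp_opp] at hx' hy'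
    have hr := (hn.represents.mul hmu.represents).mul hn.represents.inv
    rw [cs.simple_mul_simple_self, one_mul, cs.inv_simple] at hr
    exact ⟨_, hx', _, hy', _, hr, by rw [he]; group⟩
  · obtain ⟨m, hm⟩ := exists_isMu (i := i) hu h1
    have hmu : R.Mu i m := ⟨u, hu, h1, hm⟩
    obtain ⟨⟨x, hx, y, hy, he⟩, _⟩ := hm
    exact ⟨_, inv_mem hx, _, inv_mem hy, m, hmu.represents, by rw [he]; group⟩

variable (R) in
/-- The group generated by the root groups of sign `ε` other than the simple one of `i`. -/
def otherRoots (ε : Bool) (i : B) : Subgroup G :=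
  ⨆ (γ : CoxRoot cs) (_ : γ.HasSign ε ∧ γ ≠ signed cs ε i), R.U γ

theorem otherRoots_le_unip (ε : Bool) (i : B) : R.otherRoots ε i ≤ R.unip ε :=
  iSup₂_le fun _ hα => U_le_unip hα.1

theorem U_le_otherRoots {ε : Bool} {i : B} {α : CoxRoot cs} (h : α.HasSign ε)
    (h' : α ≠ signed cs ε i) : R.U α ≤ R.otherRoots ε i :=
  le_iSup₂_of_le α ⟨h, h'⟩ le_rfl

theorem conj_mem_otherRoots {ε : Bool} {i : B} {n x : G} (hn : R.PermutesAs n (cs.simple i))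
    (hx : x ∈ R.otherRoots ε i) : n * x * n⁻¹ ∈ R.otherRoots ε i := by
  have : R.otherRoots ε i ≤ (R.otherRoots ε i).comap (MulAut.conj n).toMonoidHom := by
    refine iSup₂_le fun α hα y hy => ?_
    exact U_le_otherRoots (hasSign_act_simple hα.1 hα.2) (act_simple_ne_signed hα.1)
      (hn.conj_mem hy)
  exact this hx

theorem commutator_mem {α β : CoxRoot cs} (h : α ≠ β) (hp : α.Prenilpotent β) {u y : G}
    (hu : u ∈ R.U α) (hy : y ∈ R.U β) :
    u * y * u⁻¹ * y⁻¹ ∈ ⨆ γ ∈ α.openInterval β, R.U γ :=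
  R.commutator_le α β h hp (Subgroup.commutator_mem_commutator hu hy)

theorem conj_mem_otherRoots_of_prenilpotent {ε : Bool} {i : B} {β : CoxRoot cs}
    (hβ : β.HasSign ε) (hne : β ≠ signed cs ε i) (hp : (signed cs ε i).Prenilpotent β) {u y : G}
    (hu : u ∈ R.U (signed cs ε i)) (hy : y ∈ R.U β) : u * y * u⁻¹ ∈ R.otherRoots ε i := by
  have hle : (⨆ γ ∈ (signed cs ε i).openInterval β, R.U γ) ≤ R.otherRoots ε i :=
    iSup₂_le fun γ hγ =>
      U_le_otherRoots (hasSign_of_mem_openInterval (hasSign_signed ε i) hβ hγ) hγ.1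
  have h1 := hle (commutator_mem hne.symm hp hu hy)
  have h2 : y ∈ R.otherRoots ε i := U_le_otherRoots hβ hne hy
  simpa using mul_mem h1 h2

/-- One of ±α_i is prenilpotent with β. For α_i the commutator relation applies directly. For -α_i
it applies to α_i and s_iβ, after n u n⁻¹ in U_{-α_i} is rewritten as a m b with a, b in U_{α_i} and
m representing s_i. -/
theorem conj_conj_mem_unip {ε : Bool} {i : B} {β : CoxRoot cs} (hβ : β.HasSign ε)
    (hne : β ≠ signed cs ε i) {u y n : G} (hu : u ∈ R.U (signed cs ε i)) (hy : y ∈ R.U β)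
    (hn : R.PermutesAs n (cs.simple i)) : n * (u * y * u⁻¹) * n⁻¹ ∈ R.unip ε := by
  rcases prenilpotent_or (signed cs ε i) β with hp | hp
  · exact otherRoots_le_unip ε i (conj_mem_otherRoots hn
      (conj_mem_otherRoots_of_prenilpotent hβ hne hp hu hy))
  · have hp' := prenilpotent_act (w := cs.simple i) hp
    rw [opp_signed, act_signed, Bool.not_not] at hp'
    have hy' := hn.conj_mem hy
    have hβ' := hasSign_act_simple hβ hne
    have hne' := act_simple_ne_signed (i := i) hβ
    have hu' := hn.conj_mem hu
    rw [act_signed] at hu'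
    by_cases hu1 : u = 1
    · subst hu1
      simpa using U_le_unip hβ' hy'
    · obtain ⟨a, ha, b, hb, m, hm, he⟩ := exists_represents_of_ne_one hu' (by simpa using hu1)
      rw [Bool.not_not] at ha hb
      have h1 := conj_mem_otherRoots hm.permutesAs
        (conj_mem_otherRoots_of_prenilpotent hβ' hne' hp' hb hy')
      have h2 := U_le_unip (hasSign_signed ε i) ha
      have h3 := mul_mem (mul_mem h2 (otherRoots_le_unip ε i h1)) (inv_mem h2)
      have e : n * (u * y * u⁻¹) * n⁻¹ = (n * u * n⁻¹) * (n * y * n⁻¹) * (n * u * n⁻¹)⁻¹ := by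
        group
      rw [e, he]
      convert h3 using 1
      group

variable (R) in
/-- The subgroup generated by the conjugates under the simple root group of `i` of the other
root groups of sign `ε`. -/
def radical (ε : Bool) (i : B) : Subgroup G :=
  Subgroup.closure {x | ∃ u ∈ R.U (signed cs ε i), ∃ β : CoxRoot cs, β.HasSign ε ∧
    β ≠ signed cs ε i ∧ ∃ y ∈ R.U β, x = u * y * u⁻¹}

/-- Since B_ε is the product of the radical, U_{α_i} and T, only the factor from U_{α_i} can
obstruct moving a representative of s_i past B_ε. -/
theorem conj_radical_mem_unip {ε : Bool} {i : B} {n v : G} (hn : R.PermutesAs n (cs.simple i))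
    (hv : v ∈ R.radical ε i) : n * v * n⁻¹ ∈ R.unip ε := by
  have : R.radical ε i ≤ (R.unip ε).comap (MulAut.conj n).toMonoidHom := by
    refine (Subgroup.closure_le _).2 ?_
    rintro _ ⟨u, hu, β, hβ, hne, y, hy, rfl⟩
    exact conj_conj_mem_unip hβ hne hu hy hn
  exact this hv

theorem exists_unip_decomp {ε : Bool} (i : B) {x : G} (hx : x ∈ R.unip ε) :
    ∃ v ∈ R.radical ε i, ∃ u ∈ R.U (signed cs ε i), x = v * u := by
  refine exists_mul_of_mem_sup ?_ ((?_ : R.unip ε ≤ R.U (signed cs ε i) ⊔ R.radical ε i) hx)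
  · intro a ha
    have : R.radical ε i ≤ (R.radical ε i).comap (MulAut.conj a).toMonoidHom := by
      refine (Subgroup.closure_le _).2 ?_
      rintro _ ⟨u, hu, β, hβ, hne, y, hy, rfl⟩
      refine Subgroup.subset_closure ⟨a * u, mul_mem ha hu, β, hβ, hne, y, hy, ?_⟩
      simp [mul_assoc]
    exact fun k hk => this hk
  · refine iSup₂_le fun β hβ => ?_
    by_cases h : β = signed cs ε i
    · rw [h]; exact le_sup_left
    · refine le_trans (fun y hy => ?_) (le_sup_right : R.radical ε i ≤ _)
      exact Subgroup.subset_closure ⟨1, one_mem _, β, hβ, h, y, hy, by simp⟩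

theorem exists_borel_decomp_simple {ε : Bool} (i : B) {b : G} (hb : b ∈ R.borel ε) :
    ∃ v ∈ R.radical ε i, ∃ u ∈ R.U (signed cs ε i), ∃ t ∈ R.T, b = v * u * t := by
  obtain ⟨x, hx, t, ht, rfl⟩ := exists_borel_decomp hb
  obtain ⟨v, hv, u, hu, rfl⟩ := exists_unip_decomp i hx
  exact ⟨v, hv, u, hu, t, ht, rfl⟩

/-! ### Double cosets -/

theorem Represents.mem_cell {n : G} {w : W} (h : R.Represents n w) (ε ε' : Bool) :
    n ∈ R.bruhatCell ε ε' w := ⟨1, one_mem _, n, h, 1, one_mem _, by simp⟩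

theorem mul_mem_cell {ε ε' : Bool} {w : W} {b x : G} (hb : b ∈ R.borel ε)
    (hx : x ∈ R.bruhatCell ε ε' w) : b * x ∈ R.bruhatCell ε ε' w := by
  obtain ⟨c, hc, n, hn, c', hc', rfl⟩ := hx
  exact ⟨b * c, mul_mem hb hc, n, hn, c', hc', by group⟩

theorem cell_mul_mem {ε ε' : Bool} {w : W} {b x : G} (hx : x ∈ R.bruhatCell ε ε' w)
    (hb : b ∈ R.borel ε') : x * b ∈ R.bruhatCell ε ε' w := by
  obtain ⟨c, hc, n, hn, c', hc', rfl⟩ := hx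
  exact ⟨c, hc, n, hn, c' * b, mul_mem hc' hb, by group⟩

theorem cell_inv {ε ε' : Bool} {w : W} {x : G} (hx : x ∈ R.bruhatCell ε ε' w) :
    x⁻¹ ∈ R.bruhatCell ε' ε w⁻¹ := by
  obtain ⟨c, hc, n, hn, c', hc', rfl⟩ := hx
  exact ⟨c'⁻¹, inv_mem hc', n⁻¹, hn.inv, c⁻¹, inv_mem hc, by group⟩

theorem mem_cell_one {ε : Bool} {x : G} : x ∈ R.bruhatCell ε ε 1 ↔ x ∈ R.borel ε := by
  constructor
  · rintro ⟨c, hc, n, hn, c', hc', rfl⟩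
    exact mul_mem (mul_mem hc (torus_le_borel ε hn.mem_torus)) hc'
  · intro hx
    simpa using mul_mem_cell hx (represents_one.mem_cell ε ε)

/-- If w⁻¹ gives α_i the sign ε', then u is absorbed by B_ε' on the right. Otherwise n u n⁻¹ = a m'
b with m' cancelling n modulo T, and now b is absorbed on the right, leaving the cell of w. -/
theorem mul_unip_mul_mem_cell {ε ε' : Bool} {i : B} {w : W} {n u m : G}
    (hn : R.Represents n (cs.simple i)) (hu : u ∈ R.U (signed cs ε i)) (hm : R.Represents m w) :
    (((signed cs ε i).act w⁻¹).HasSign ε' → n * u * m ∈ R.bruhatCell ε ε' (cs.simple i * w)) ∧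
      (n * u * m ∈ R.bruhatCell ε ε' (cs.simple i * w) ∨ n * u * m ∈ R.bruhatCell ε ε' w) := by
  have h1 : ((signed cs ε i).act w⁻¹).HasSign ε' →
      n * u * m ∈ R.bruhatCell ε ε' (cs.simple i * w) := by
    intro hs
    have := cell_mul_mem ((hn.mul hm).mem_cell ε ε') (U_le_borel hs (hm.permutesAs.inv_conj_mem hu))
    convert this using 1
    group
  refine ⟨h1, ?_⟩
  by_cases hs : ((signed cs ε i).act w⁻¹).HasSign ε'
  · exact Or.inl (h1 hs)
  by_cases hu1 : u = 1
  · subst hu1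
    left
    simpa using (hn.mul hm).mem_cell ε ε'
  · right
    have hu' := hn.permutesAs.conj_mem hu
    rw [act_signed] at hu'
    obtain ⟨a, ha, b, hb, m', hm', he⟩ := exists_represents_of_ne_one hu' (by simpa using hu1)
    rw [Bool.not_not] at ha hb
    have h3 := (hn.mul hm).permutesAs.inv_conj_mem hb
    have h4 : ((signed cs ε i).act (cs.simple i * w)⁻¹).HasSign ε' := by
      rw [mul_inv_rev, ← act_act, cs.inv_simple, act_signed, ← opp_signed, act_opp, hasSign_opp]
      exact hs
    have h5 := hm'.mul (hn.mul hm)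
    rw [cs.simple_mul_simple_cancel_left] at h5
    have h6 := mul_mem_cell (U_le_borel (hasSign_signed ε i) ha)
      (cell_mul_mem (h5.mem_cell ε ε') (U_le_borel h4 h3))
    convert h6 using 1
    have : n * u * m = (n * u * n⁻¹) * n * m := by group
    rw [this, he]
    group

theorem simple_mul_cell {ε ε' : Bool} {i : B} {w : W} {n x : G}
    (hn : R.Represents n (cs.simple i)) (hx : x ∈ R.bruhatCell ε ε' w) :
    (((signed cs ε i).act w⁻¹).HasSign ε' → n * x ∈ R.bruhatCell ε ε' (cs.simple i * w)) ∧
      (n * x ∈ R.bruhatCell ε ε' (cs.simple i * w) ∨ n * x ∈ R.bruhatCell ε ε' w) := by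
  obtain ⟨b, hb, m, hm, c, hc, rfl⟩ := hx
  obtain ⟨v, hv, u, hu, t, ht, rfl⟩ := exists_borel_decomp_simple i hb
  have htm := (represents_torus ht).mul hm
  rw [one_mul] at htm
  have h0 := unip_le_borel ε (conj_radical_mem_unip hn.permutesAs hv)
  have e : n * (v * u * t * m * c) = (n * v * n⁻¹) * ((n * u * (t * m)) * c) := by group
  rw [e]
  have key : ∀ w', n * u * (t * m) ∈ R.bruhatCell ε ε' w' →
      (n * v * n⁻¹) * ((n * u * (t * m)) * c) ∈ R.bruhatCell ε ε' w' :=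
    fun w' h => mul_mem_cell h0 (cell_mul_mem h hc)
  have := mul_unip_mul_mem_cell (ε' := ε') hn hu htm
  exact ⟨fun h => key _ (this.1 h), this.2.imp (key _) (key _)⟩

/-- The multiplication rule for double cosets. -/
theorem cell_mul_simple {ε ε' : Bool} {i : B} {w : W} {x y : G}
    (hx : x ∈ R.bruhatCell ε ε' w) (hy : y ∈ R.bruhatCell ε' ε' (cs.simple i)) :
    ((ε = ε' ↔ cs.length w < cs.length (w * cs.simple i)) →
        x * y ∈ R.bruhatCell ε ε' (w * cs.simple i)) ∧
      (x * y ∈ R.bruhatCell ε ε' (w * cs.simple i) ∨ x * y ∈ R.bruhatCell ε ε' w) := by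
  obtain ⟨b, hb, n, hn, c, hc, rfl⟩ := hy
  have hinv := hn.inv
  rw [cs.inv_simple] at hinv
  have h1 := simple_mul_cell hinv (cell_inv (cell_mul_mem hx hb))
  rw [inv_inv, hasSign_act_signed] at h1
  have key : ∀ w', n⁻¹ * (x * b)⁻¹ ∈ R.bruhatCell ε' ε w' →
      x * (b * n * c) ∈ R.bruhatCell ε ε' w'⁻¹ := by
    intro w' h
    have := cell_mul_mem (cell_inv h) hc
    convert this using 1
    group
  constructor
  · intro h
    have := key _ (h1.1 (by rw [← h]; exact eq_comm))
    simpa using this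
  · have := h1.2.imp (key _) (key _)
    simpa using this

theorem exists_mem_cell (ε ε' : Bool) (g : G) : ∃ w, g ∈ R.bruhatCell ε ε' w := by
  -- The union of the double cosets is shown to be stable under left multiplication by B_ε and N,
  -- hence by all root groups, which are N-conjugate to subgroups of B_ε, and so by G.
  let P : G → Prop := fun g => ∀ x, (∃ w, x ∈ R.bruhatCell ε ε' w) →
    ∃ w, g * x ∈ R.bruhatCell ε ε' w
  have Pmul : ∀ g h, P g → P h → P (g * h) := fun g h hg hh x hx => by
    rw [mul_assoc]; exact hg _ (hh _ hx)
  have Pone : P 1 := fun x hx => by simpa using hx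
  have Pb : ∀ b ∈ R.borel ε, P b := fun b hb x ⟨w, hw⟩ => ⟨w, mul_mem_cell hb hw⟩
  have Pn : ∀ ω n, R.WordRep ω n → P n := by
    intro ω
    induction ω with
    | nil => exact fun n hn => Pb n (torus_le_borel ε hn)
    | cons i ω ih =>
      rintro _ ⟨m, n', hm, hn', rfl⟩
      refine Pmul _ _ ?_ (ih _ hn')
      rintro x ⟨w, hw⟩
      rcases (simple_mul_cell hm.represents hw).2 with h | h
      · exact ⟨_, h⟩
      · exact ⟨_, h⟩
  have PN : ∀ n ∈ R.N, P n := fun n hn => by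
    obtain ⟨ω, hω⟩ := exists_wordRep_of_mem_N hn
    exact Pn ω n hω
  have PU : ∀ α, ∀ x ∈ R.U α, P x := by
    intro α x hx
    obtain ⟨w, i, rfl⟩ := exists_eq_act_signed ε α
    obtain ⟨n, hn⟩ := R.exists_represents w
    have h1 := hn.permutesAs.inv_conj_mem hx
    rw [act_act, inv_mul_cancel, act_one] at h1
    have := Pmul _ _ (Pmul _ _ (PN n hn.1) (Pb _ (U_le_borel (hasSign_signed ε i) h1)))
      (PN _ hn.inv.1)
    convert this using 1
    group
  obtain ⟨t, ht, x, hx, rfl⟩ := R.torus_mul_roots g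
  have hPx : P x := Subgroup.iSup_induction _ (C := P) hx PU Pone Pmul
  have := Pmul _ _ (Pb _ (torus_le_borel ε ht)) hPx 1 ⟨1, represents_one.mem_cell ε ε'⟩
  simpa using this

/-- Disjointness in the Bruhat decomposition. -/
theorem bruhat_unique {ε : Bool} (hN : R.NotOppLe ε) {w w' : W} {x : G}
    (h : x ∈ R.bruhatCell ε ε w) (h' : x ∈ R.bruhatCell ε ε w') : w = w' := by
  have main : ∀ k w w' n, cs.length w = k → R.Represents n w → cs.length w ≤ cs.length w' →
      n ∈ R.bruhatCell ε ε w' → w = w' := by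
    intro k
    induction k with
    | zero =>
      intro w w' n hk hn _ hc
      rw [cs.length_eq_zero_iff] at hk
      subst hk
      obtain ⟨b, hb, m, hm, c, hc, he⟩ := hc
      have hmB : m ∈ R.borel ε := by
        have : m = b⁻¹ * n * c⁻¹ := by rw [he]; group
        rw [this]
        exact mul_mem (mul_mem (inv_mem hb) (torus_le_borel ε hn.mem_torus)) (inv_mem hc)
      exact (eq_one_of_permutesAs hN hm.permutesAs
        fun x hx => conj_mem_unip_of_mem_borel hmB hx).symm
    | succ k ih =>
      intro w w' n hk hn hl hc
      have hw1 : w ≠ 1 := by rintro rfl; simp at hk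
      obtain ⟨i, hi⟩ := cs.exists_leftDescent_of_ne_one hw1
      have hi := cs.length_simple_mul_of_gt hi
      obtain ⟨m, hm⟩ := R.exists_represents (cs.simple i)
      -- Multiplying by a left descent of the shorter element w leads by induction to s w = s w' or
      -- s w = w'; the latter contradicts ℓ(w) ≤ ℓ(w').
      rcases (simple_mul_cell hm hc).2 with h1 | h1
      · have := ih _ _ _ (by omega) (hm.mul hn) (by
          rcases cs.length_simple_mul w' i with h | h <;> omega) h1
        exact mul_left_cancel this
      · have := ih _ _ _ (by omega) (hm.mul hn) (by omega) h1
        rw [← this] at hl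
        omega
  have flip : ∀ w w', x ∈ R.bruhatCell ε ε w → x ∈ R.bruhatCell ε ε w' →
      cs.length w ≤ cs.length w' → w = w' := by
    rintro w w' ⟨b, hb, n, hn, c, hc, rfl⟩ h2 hl
    refine main _ w w' n rfl hn hl ?_
    have := mul_mem_cell (inv_mem hb) (cell_mul_mem h2 (inv_mem hc))
    convert this using 1
    group
  rcases le_total (cs.length w) (cs.length w') with hl | hl
  · exact flip _ _ h h' hl
  · exact (flip _ _ h' h hl).symm

theorem mem_cell_simple_of_ne_one {ε : Bool} {i : B} {u : G} (hu : u ∈ R.U (signed cs (!ε) i))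
    (h1 : u ≠ 1) : u ∈ R.bruhatCell ε ε (cs.simple i) := by
  obtain ⟨a, ha, b, hb, m, hm, rfl⟩ := exists_represents_of_ne_one hu h1
  rw [Bool.not_not] at ha hb
  exact ⟨a, U_le_borel (hasSign_signed ε i) ha, m, hm, b, U_le_borel (hasSign_signed ε i) hb, rfl⟩

end RGDSystem

/-! ### Inversion sets of elements of W. -/

namespace CoxRoot

variable {B W : Type*} [Group W] {M : CoxeterMatrix B} {cs : CoxeterSystem M W}

theorem isPos_act {v : W} {α : CoxRoot cs} : (α.act v).IsPos ↔ v⁻¹ ∈ α.1 := by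
  rw [IsPos, mem_act, mul_one]

theorem prenilpotent_of_hasSign {ε : Bool} {v : W} {α β : CoxRoot cs} (hα : α.HasSign ε)
    (hβ : β.HasSign ε) (hα' : ¬ (α.act v).HasSign ε) (hβ' : ¬ (β.act v).HasSign ε) :
    α.Prenilpotent β := by
  cases ε
  · simp only [HasSign, Bool.false_eq_true, iff_false, not_not, isPos_act] at *
    exact ⟨⟨v⁻¹, hα', hβ'⟩, ⟨1, hα, hβ⟩⟩
  · simp only [HasSign, iff_true, isPos_act] at *
    exact ⟨⟨1, hα, hβ⟩, ⟨v⁻¹, hα', hβ'⟩⟩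

theorem act_mem_openInterval {v : W} {α β γ : CoxRoot cs} (h : γ ∈ α.openInterval β) :
    γ.act v ∈ (α.act v).openInterval (β.act v) := by
  refine ⟨fun hc => h.1 (act_injective v hc), fun hc => h.2.1 (act_injective v hc), ?_, ?_⟩
  · intro x hx
    rw [Set.mem_inter_iff, mem_act, mem_act] at hx
    rw [mem_act]
    exact h.2.2.1 hx
  · intro x hx
    rw [Set.mem_inter_iff, mem_opp, mem_opp, mem_act, mem_act] at hx
    rw [mem_opp, mem_act]
    exact h.2.2.2 hx

theorem exists_not_hasSign_act (ε : Bool) (α : CoxRoot cs) : ∃ w : W, ¬ (α.act w⁻¹).HasSign ε := by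
  cases ε
  · obtain ⟨x, hx⟩ := α.nonempty
    exact ⟨x, by simpa [HasSign, isPos_act] using hx⟩
  · obtain ⟨x, hx⟩ := α.nonempty_opp
    exact ⟨x, by simpa [HasSign, isPos_act] using hx⟩

/-- The roots of sign `ε` which become roots of the other sign under `w⁻¹`. -/
def IsInversion (ε : Bool) (w : W) (α : CoxRoot cs) : Prop :=
  α.HasSign ε ∧ ¬ (α.act w⁻¹).HasSign ε

theorem IsInversion.mul_simple {ε : Bool} {w : W} {i : B} {α : CoxRoot cs}
    (h : α.IsInversion ε w) (hl : cs.length w < cs.length (w * cs.simple i)) :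
    α.IsInversion ε (w * cs.simple i) := by
  refine ⟨h.1, fun hc => ?_⟩
  rw [mul_inv_rev, ← act_act, cs.inv_simple] at hc
  have h1 : α.act w⁻¹ = signed cs (!ε) i := by
    apply eq_signed_of_hasSign (hasSign_not.2 h.2)
    rw [hasSign_not, not_not]; exact hc
  have h2 : α = (signed cs (!ε) i).act w := by rw [← h1]; simp
  have h3 := h.1
  rw [h2, hasSign_act_signed] at h3
  simp [hl] at h3

theorem isInversion_act_signed {ε : Bool} {w : W} {i : B}
    (hl : cs.length w < cs.length (w * cs.simple i)) :
    ((signed cs ε i).act w).IsInversion ε (w * cs.simple i) := by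
  refine ⟨by simpa [hasSign_act_signed] using hl, ?_⟩
  rw [act_act]
  simp [← hasSign_not, hasSign_signed]

theorem IsInversion.of_mul_simple {ε : Bool} {w : W} {i : B} {α : CoxRoot cs}
    (h : α.IsInversion ε (w * cs.simple i)) (hne : α ≠ (signed cs ε i).act w) :
    α.IsInversion ε w := by
  refine ⟨h.1, fun hc => hne ?_⟩
  have h1 := h.2
  rw [mul_inv_rev, ← act_act, cs.inv_simple] at h1
  rw [← eq_signed_of_hasSign hc h1]
  simp

end CoxRoot

namespace RGDSystem

open CoxRoot

variable {B W : Type*} [Group W] {M : CoxeterMatrix B} {cs : CoxeterSystem M W}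
variable {G : Type u} [Group G] {R : RGDSystem cs G}

/-! ### The groups attached to inversion sets -/

variable (R) in
/-- The group generated by the root groups of the inversions of `w`. -/
def invUnip (ε : Bool) (w : W) : Subgroup G :=
  ⨆ (α : CoxRoot cs) (_ : α.IsInversion ε w), R.U α

variable (R) in
/-- The group generated by the torus and the root groups of the inversions of `w`. -/
def invBorel (ε : Bool) (w : W) : Subgroup G := R.T ⊔ R.invUnip ε w

theorem U_le_invUnip {ε : Bool} {w : W} {α : CoxRoot cs} (h : α.IsInversion ε w) :
    R.U α ≤ R.invUnip ε w := le_iSup₂_of_le α h le_rfl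

theorem U_le_invBorel {ε : Bool} {w : W} {α : CoxRoot cs} (h : α.IsInversion ε w) :
    R.U α ≤ R.invBorel ε w := (U_le_invUnip h).trans le_sup_right

theorem torus_le_invBorel (ε : Bool) (w : W) : R.T ≤ R.invBorel ε w := le_sup_left

theorem conj_mem_invUnip {ε : Bool} {w : W} {n x : G} (hn : R.PermutesAs n 1)
    (hx : x ∈ R.invUnip ε w) : n * x * n⁻¹ ∈ R.invUnip ε w := by
  have : R.invUnip ε w ≤ (R.invUnip ε w).comap (MulAut.conj n).toMonoidHom := by
    refine iSup₂_le fun α hα y hy => ?_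
    have := hn.conj_mem hy
    rw [act_one] at this
    exact U_le_invUnip hα this
  exact this hx

theorem inv_conj_invBorel {ε : Bool} {w : W} {n h : G} (hn : R.Represents n w)
    (hh : h ∈ R.invBorel ε w) : n⁻¹ * h * n ∈ R.borel (!ε) := by
  have : R.invBorel ε w ≤ (R.borel (!ε)).comap (MulAut.conj n⁻¹).toMonoidHom := by
    refine sup_le ?_ (iSup₂_le fun α hα y hy => ?_)
    · intro t ht
      exact torus_le_borel _ (hn.inv.conj_torus ht)
    · exact U_le_borel (hasSign_not.2 hα.2) (hn.permutesAs.inv.conj_mem hy)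
  simpa using this hh

theorem invBorel_le_mul_simple {ε : Bool} {w : W} {i : B}
    (hl : cs.length w < cs.length (w * cs.simple i)) :
    R.invBorel ε w ≤ R.invBorel ε (w * cs.simple i) :=
  sup_le (torus_le_invBorel _ _) (iSup₂_le fun _ hα => U_le_invBorel (hα.mul_simple hl))

/-- Any two inversions of w s are prenilpotent, and the interval between them again consists of
inversions of w s. Open intervals omit w α_s, the only inversion of w s that is not one of w. -/
theorem conj_simple_mem_invUnip {ε : Bool} {w : W} {i : B}
    (hl : cs.length w < cs.length (w * cs.simple i)) {u x : G}
    (hu : u ∈ R.U ((signed cs ε i).act w)) (hx : x ∈ R.invUnip ε w) :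
    u * x * u⁻¹ ∈ R.invUnip ε w := by
  have : R.invUnip ε w ≤ (R.invUnip ε w).comap (MulAut.conj u).toMonoidHom := by
    refine iSup₂_le fun β hβ y hy => ?_
    have hα := isInversion_act_signed (ε := ε) hl
    have hβ' := hβ.mul_simple hl
    have hne : (signed cs ε i).act w ≠ β := by
      rintro rfl
      apply hβ.2
      simp [hasSign_signed]
    have hle : (⨆ γ ∈ ((signed cs ε i).act w).openInterval β, R.U γ) ≤ R.invUnip ε w := by
      refine iSup₂_le fun γ hγ => U_le_invUnip ?_
      refine IsInversion.of_mul_simple (i := i)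
        ⟨hasSign_of_mem_openInterval hα.1 hβ.1 hγ, ?_⟩ hγ.1
      rw [← hasSign_not]
      exact hasSign_of_mem_openInterval (hasSign_not.2 hα.2) (hasSign_not.2 hβ'.2)
        (act_mem_openInterval hγ)
    have h1 := hle (commutator_mem hne (prenilpotent_of_hasSign hα.1 hβ.1 hα.2 hβ'.2) hu hy)
    have := mul_mem h1 (U_le_invUnip hβ hy)
    simpa using this
  exact this hx

theorem exists_invBorel_decomp_simple {ε : Bool} {w : W} {i : B}
    (hl : cs.length w < cs.length (w * cs.simple i)) {n h : G} (hn : R.Represents n w)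
    (hh : h ∈ R.invBorel ε (w * cs.simple i)) :
    ∃ a ∈ R.invBorel ε w, ∃ u ∈ R.U (signed cs ε i), h = a * (n * u * n⁻¹) := by
  obtain ⟨x, hx, t, ht, rfl⟩ := exists_mul_of_mem_sup
    (fun t ht x hx => conj_mem_invUnip (permutesAs_torus ht) hx) hh
  have hle : R.invUnip ε (w * cs.simple i) ≤ R.U ((signed cs ε i).act w) ⊔ R.invUnip ε w := by
    refine iSup₂_le fun α hα => ?_
    by_cases h : α = (signed cs ε i).act w
    · rw [h]; exact le_sup_left
    · exact (U_le_invUnip (hα.of_mul_simple h)).trans le_sup_right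
  obtain ⟨y, hy, u, hu, rfl⟩ := exists_mul_of_mem_sup
    (fun u hu x hx => conj_simple_mem_invUnip hl hu hx) (hle hx)
  have hu' : t⁻¹ * u * t ∈ R.U ((signed cs ε i).act w) := by
    simpa using (permutesAs_torus ht).inv_conj_mem hu
  refine ⟨y * t, mul_mem ((le_sup_right : _ ≤ R.invBorel ε w) hy) (torus_le_invBorel _ _ ht),
    n⁻¹ * (t⁻¹ * u * t) * n, ?_, by group⟩
  simpa using hn.permutesAs.inv_conj_mem hu'

theorem length_add_cases {w v : W} (hadd : cs.length (w * v) = cs.length w + cs.length v)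
    {i : B} {v' : W} (hv : v = v' * cs.simple i) (hl : cs.length v' < cs.length v) :
    cs.length (w * v') = cs.length w + cs.length v' ∧
      cs.length (w * v') < cs.length (w * v' * cs.simple i) := by
  have h1 := cs.length_mul_le w v'
  have h2 := cs.length_mul_simple (w * v') i
  have h3 := cs.length_mul_simple v' i
  rw [mul_assoc, ← hv] at h2 ⊢
  rw [← hv] at h3
  omega

theorem exists_eq_mul_simple {v : W} (hv : v ≠ 1) :
    ∃ v' i, v = v' * cs.simple i ∧ cs.length v' < cs.length v := by
  obtain ⟨i, hi⟩ := cs.exists_rightDescent_of_ne_one hv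
  exact ⟨v * cs.simple i, i, by simp, hi⟩

theorem invBorel_mono {ε : Bool} {w v : W}
    (hadd : cs.length (w * v) = cs.length w + cs.length v) :
    R.invBorel ε w ≤ R.invBorel ε (w * v) := by
  induction hk : cs.length v generalizing v with
  | zero => rw [cs.length_eq_zero_iff] at hk; simp [hk]
  | succ k ih =>
    obtain ⟨v', i, rfl, hl⟩ := exists_eq_mul_simple (cs := cs) (v := v) (by rintro rfl; simp at hk)
    have h1 := length_add_cases hadd rfl hl
    have h2 := cs.length_mul_simple v' i
    rw [← mul_assoc]
    exact (ih h1.1 (by omega)).trans (invBorel_le_mul_simple h1.2)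

theorem exists_invBorel_decomp {ε : Bool} {w v : W}
    (hadd : cs.length (w * v) = cs.length w + cs.length v) {n h : G} (hn : R.Represents n w)
    (hh : h ∈ R.invBorel ε (w * v)) :
    ∃ a ∈ R.invBorel ε w, ∃ k ∈ R.invBorel ε v, h = a * (n * k * n⁻¹) := by
  induction hk : cs.length v generalizing v h with
  | zero =>
    rw [cs.length_eq_zero_iff] at hk
    subst hk
    rw [mul_one] at hh
    exact ⟨h, hh, 1, one_mem _, by simp⟩
  | succ k ih =>
    obtain ⟨v', i, rfl, hl⟩ := exists_eq_mul_simple (cs := cs) (v := v) (by rintro rfl; simp at hk)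
    have h1 := length_add_cases hadd rfl hl
    have h2 := cs.length_mul_simple v' i
    obtain ⟨n', hn'⟩ := R.exists_represents v'
    rw [← mul_assoc] at hh
    obtain ⟨a, ha, u, hu, rfl⟩ := exists_invBorel_decomp_simple h1.2 (hn.mul hn') hh
    obtain ⟨b, hb, k', hk', rfl⟩ := ih h1.1 ha (by omega)
    refine ⟨b, hb, k' * (n' * u * n'⁻¹), mul_mem (invBorel_le_mul_simple hl hk') ?_, by group⟩
    exact U_le_invBorel (isInversion_act_signed hl) (hn'.permutesAs.conj_mem hu)

/-- A nontrivial component in the last root group would place k n in the double coset of v s_i,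
whereas k in B_{-ε} places it in that of v. -/
theorem invBorel_inf_borel {ε : Bool} (hN : R.NotOppLe (!ε)) {y : W} {k : G}
    (hk : k ∈ R.invBorel ε y) (hk' : k ∈ R.borel (!ε)) : k ∈ R.T := by
  induction hm : cs.length y generalizing y k with
  | zero =>
    rw [cs.length_eq_zero_iff] at hm
    subst hm
    have : R.invBorel ε 1 ≤ R.T := by
      refine sup_le le_rfl (iSup₂_le fun α hα => ?_)
      have h1 := hα.1
      have h2 := hα.2
      simp at h2
      exact (h2 h1).elim
    exact this hk
  | succ m ih =>
    obtain ⟨v, i, rfl, hl⟩ := exists_eq_mul_simple (cs := cs) (v := y) (by rintro rfl; simp at hm)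
    obtain ⟨n, hn⟩ := R.exists_represents v
    obtain ⟨a, ha, u, hu, he⟩ := exists_invBorel_decomp_simple hl hn hk
    by_cases hu1 : u = 1
    · subst hu1
      have h2 := cs.length_mul_simple v i
      rw [mul_one, mul_inv_cancel, mul_one] at he
      subst he
      exact ih ha hk' (by omega)
    · exfalso
      have h1 : u ∈ R.bruhatCell (!ε) (!ε) (cs.simple i) :=
        mem_cell_simple_of_ne_one (by rwa [Bool.not_not]) hu1
      have h2 := (cell_mul_simple (cell_mul_mem (hn.mem_cell (!ε) (!ε)) (inv_conj_invBorel hn ha))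
        h1).1 (by simpa using hl)
      have h3 := mul_mem_cell hk' (hn.mem_cell (!ε) (!ε))
      have e : n * (n⁻¹ * a * n) * u = k * n := by rw [he]; group
      rw [e] at h2
      have := bruhat_unique hN h2 h3
      rw [this] at hl
      omega

/-- Charts: elements of `invBorel ε wm` act freely enough on the chambers below `wm`. -/
theorem chart_injective {ε : Bool} (hN : R.NotOppLe (!ε)) {v y v' y' : W} {h h' n n' : G}
    (he : v * y = v' * y')
    (hadd : cs.length (v * y) = cs.length v + cs.length y)
    (hh : h ∈ R.invBorel ε (v * y)) (hh' : h' ∈ R.invBorel ε (v * y)) (hn : R.Represents n v)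
    (hn' : R.Represents n' v') (hp : (h * n)⁻¹ * (h' * n') ∈ R.borel (!ε)) :
    v = v' ∧ h⁻¹ * h' ∈ R.invBorel ε v := by
  obtain ⟨m, hm⟩ := R.exists_represents (v * y)
  have h0 := mul_mem (inv_mem hh) hh'
  have hκ := inv_conj_invBorel hm h0
  have hq : R.Represents (m⁻¹ * n) y⁻¹ := by
    have := hm.inv.mul hn
    simpa using this
  have hq' : R.Represents (m⁻¹ * n') y'⁻¹ := by
    have := hm.inv.mul hn'
    rw [he] at this
    simpa using this
  -- Seen from the representative m of x = v y = v' y', the group of x lies in B_{-ε}, so the common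
  -- chamber has a well-defined distance from x, namely both y⁻¹ and y'⁻¹.
  have hy : y⁻¹ = y'⁻¹ := by
    refine bruhat_unique hN (hq.mem_cell (!ε) (!ε)) ?_
    have := mul_mem_cell hκ (cell_mul_mem (hq'.mem_cell (!ε) (!ε)) (inv_mem hp))
    convert this using 1
    group
  have hv : v = v' := by
    rw [inv_inj] at hy
    rw [hy] at he
    exact mul_right_cancel he
  refine ⟨hv, ?_⟩
  subst hv
  obtain ⟨a, ha, k, hk, hk0⟩ := exists_invBorel_decomp hadd hn h0
  have ht := hn'.inv_mul_mem hn
  have hkB : k ∈ R.borel (!ε) := by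
    have := mul_mem (inv_mem (inv_conj_invBorel hn ha))
      (mul_mem hp (torus_le_borel (!ε) ht))
    convert this using 1
    have e : (h * n)⁻¹ * (h' * n') * (n'⁻¹ * n) = n⁻¹ * (h⁻¹ * h') * n := by group
    rw [e, hk0]
    group
  have hkT := invBorel_inf_borel hN hk hkB
  rw [hk0]
  exact mul_mem ha (torus_le_invBorel _ _ (hn.conj_torus hkT))

end RGDSystem

/-- The monoid of relations on a type, under composition. -/
def RelEnd (X : Type*) := X → X → Prop

instance (X : Type*) : Monoid (RelEnd X) where
  mul r s := Relation.Comp r s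
  one := Eq
  mul_assoc r s t := Relation.comp_assoc
  one_mul r := Relation.eq_comp
  mul_one r := Relation.comp_eq

namespace RGDSystem

open CoxRoot CoxeterSystem

variable {B W : Type*} [Group W] {M : CoxeterMatrix B} {cs : CoxeterSystem M W}
variable {G : Type u} [Group G] {R : RGDSystem cs G}

/-! ### The covering of the building of sign `!ε` by the orbits of the Borel subgroup of sign `ε` -/

variable (R) in
/-- A chosen representative of `w`. -/
noncomputable def rep (w : W) : G := (R.exists_represents w).choose

theorem rep_spec (w : W) : R.Represents (R.rep w) w := (R.exists_represents w).choose_spec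

variable (R) in
/-- The chamber (as a coset representative) under a point of the covering. -/
noncomputable def coverMap (x : G × W) : G := x.1 * R.rep x.2

variable (R) in
/-- Points of the covering which are to be identified. -/
def CoverEqv (ε : Bool) (x y : G × W) : Prop := x.2 = y.2 ∧ x.1⁻¹ * y.1 ∈ R.invBorel ε x.2

variable (R) in
/-- Strict adjacency in the covering. -/
def CoverAdj (ε : Bool) (i : B) (x y : G × W) : Prop :=
  (y.2 = x.2 ∨ y.2 = x.2 * cs.simple i) ∧
    x.1⁻¹ * y.1 ∈ R.invBorel ε x.2 ⊔ R.invBorel ε (x.2 * cs.simple i) ∧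
    (R.coverMap x)⁻¹ * R.coverMap y ∈ R.bruhatCell (!ε) (!ε) (cs.simple i)

variable (R) in
/-- Strict adjacency in the covering, as an element of the monoid of relations. -/
def coverAdjEnd (ε : Bool) (i : B) : RelEnd (G × W) := R.CoverAdj ε i

variable (R) in
/-- Galleries in the covering. -/
def CoverGal (ε : Bool) (ω : List B) : G × W → G × W → Prop :=
  (ω.map (R.coverAdjEnd ε)).prod

theorem coverGal_nil {ε : Bool} {x y : G × W} : R.CoverGal ε [] x y ↔ x = y := Iff.rfl

theorem coverGal_concat {ε : Bool} {ω : List B} {i : B} {x y : G × W} :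
    R.CoverGal ε (ω.concat i) x y ↔ ∃ z, R.CoverGal ε ω x z ∧ R.CoverAdj ε i z y := by
  rw [CoverGal, List.concat_eq_append, List.map_append, List.prod_append, List.map_cons,
    List.map_nil, List.prod_singleton]
  rfl

theorem CoverEqv.map {ε : Bool} {x y : G × W} (h : R.CoverEqv ε x y) :
    (R.coverMap x)⁻¹ * R.coverMap y ∈ R.borel (!ε) := by
  have := inv_conj_invBorel (rep_spec x.2) h.2
  rw [coverMap, coverMap, ← h.1]
  convert this using 1
  group

theorem CoverAdj.trans_eqv {ε : Bool} {i : B} {x y z : G × W} (h : R.CoverAdj ε i x y)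
    (h' : R.CoverEqv ε y z) : R.CoverAdj ε i x z := by
  refine ⟨by rw [← h'.1]; exact h.1, ?_, ?_⟩
  · have h1 : y.1⁻¹ * z.1 ∈ R.invBorel ε x.2 ⊔ R.invBorel ε (x.2 * cs.simple i) := by
      have := h'.2
      rcases h.1 with e | e <;> rw [e] at this
      · exact (le_sup_left : R.invBorel ε x.2 ≤ _) this
      · exact (le_sup_right : R.invBorel ε (x.2 * cs.simple i) ≤ _) this
    have := mul_mem h.2.1 h1
    convert this using 1
    group
  · have := cell_mul_mem h.2.2 h'.map
    convert this using 1
    group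

theorem sup_invBorel_symm {ε : Bool} {i : B} {w v : W} (h : v = w ∨ v = w * cs.simple i) :
    R.invBorel ε v ⊔ R.invBorel ε (v * cs.simple i) =
      R.invBorel ε w ⊔ R.invBorel ε (w * cs.simple i) := by
  rcases h with rfl | rfl
  · rfl
  · rw [cs.simple_mul_simple_cancel_right, sup_comm]

theorem CoverAdj.symm {ε : Bool} {i : B} {x y : G × W} (h : R.CoverAdj ε i x y) :
    R.CoverAdj ε i y x := by
  refine ⟨?_, ?_, ?_⟩
  · rcases h.1 with e | e <;> simp [e]
  · rw [sup_invBorel_symm h.1]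
    simpa using inv_mem h.2.1
  · have := cell_inv h.2.2
    simpa using this

theorem CoverEqv.symm {ε : Bool} {x y : G × W} (h : R.CoverEqv ε x y) : R.CoverEqv ε y x :=
  ⟨h.1.symm, by rw [← h.1]; simpa using inv_mem h.2⟩

theorem CoverEqv.trans_adj {ε : Bool} {i : B} {x y z : G × W} (h : R.CoverEqv ε x y)
    (h' : R.CoverAdj ε i y z) : R.CoverAdj ε i x z := (h'.symm.trans_eqv h.symm).symm

theorem CoverGal.trans_eqv {ε : Bool} {ω : List B} {x y z : G × W} (hω : ω ≠ [])
    (h : R.CoverGal ε ω x y) (h' : R.CoverEqv ε y z) : R.CoverGal ε ω x z := by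
  rcases List.eq_nil_or_concat ω with rfl | ⟨ω, i, rfl⟩
  · exact (hω rfl).elim
  · obtain ⟨t, h1, h2⟩ := coverGal_concat.1 h
    exact coverGal_concat.2 ⟨t, h1, h2.trans_eqv h'⟩

/-- Every panel of the building lifts. -/
theorem exists_lift_panel {ε : Bool} {i : B} {x : G × W} {g : G}
    (h : (R.coverMap x)⁻¹ * g ∈ R.bruhatCell (!ε) (!ε) (cs.simple i)) :
    ∃ y, R.CoverAdj ε i x y ∧ (R.coverMap y)⁻¹ * g ∈ R.borel (!ε) := by
  obtain ⟨b, hb, m, hm, c, hc, he⟩ := h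
  suffices ∃ y : G × W, (y.2 = x.2 ∨ y.2 = x.2 * cs.simple i) ∧
      x.1⁻¹ * y.1 ∈ R.invBorel ε x.2 ⊔ R.invBorel ε (x.2 * cs.simple i) ∧
      (R.coverMap y)⁻¹ * g ∈ R.borel (!ε) by
    obtain ⟨y, h1, h2, h3⟩ := this
    refine ⟨y, ⟨h1, h2, ?_⟩, h3⟩
    have h4 : (R.coverMap x)⁻¹ * g ∈ R.bruhatCell (!ε) (!ε) (cs.simple i) :=
      ⟨b, hb, m, hm, c, hc, he⟩
    have := cell_mul_mem h4 (inv_mem h3)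
    convert this using 1
    group
  obtain ⟨v, hv, u, hu, t, ht, hbe⟩ := exists_borel_decomp_simple i (inv_mem hb)
  have hm' := hm.inv
  rw [cs.inv_simple] at hm'
  have hg : ∃ d ∈ R.borel (!ε), g = R.coverMap x * (t⁻¹ * u⁻¹ * t) * m * d := by
    have hv' := unip_le_borel _ (conj_radical_mem_unip hm'.permutesAs (inv_mem hv))
    rw [inv_inv] at hv'
    have htm := torus_le_borel (!ε) (hm'.conj_torus (inv_mem ht))
    rw [inv_inv] at htm
    have hb' : b = t⁻¹ * u⁻¹ * v⁻¹ := by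
      rw [← inv_inv b, hbe]; group
    refine ⟨(m⁻¹ * t⁻¹ * m) * (m⁻¹ * v⁻¹ * m) * c, mul_mem (mul_mem htm hv') hc, ?_⟩
    rw [inv_mul_eq_iff_eq_mul] at he
    rw [he, hb']
    group
  obtain ⟨d, hd, rfl⟩ := hg
  have hu' : t⁻¹ * u⁻¹ * t ∈ R.U (signed cs (!ε) i) := by
    simpa using (permutesAs_torus ht).inv_conj_mem (inv_mem hu)
  set u' := t⁻¹ * u⁻¹ * t
  clear_value u'
  have hn := rep_spec (R := R) x.2
  set n := R.rep x.2 with hn0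
  have hnu := hn.permutesAs.conj_mem hu'
  have hs : ∀ z : G, z ∈ R.borel (!ε) → (R.rep (x.2 * cs.simple i))⁻¹ * n * m * z * d ∈
      R.borel (!ε) := by
    intro z hz
    have h1 := torus_le_borel (!ε) ((rep_spec (R := R) (x.2 * cs.simple i)).inv_mul_mem (hn.mul hm))
    have := mul_mem (mul_mem h1 hz) hd
    convert this using 1
    group
  -- The larger of the groups of w and w s_i must supply the difference of first coordinates. If w
  -- s_i is longer, that group contains the conjugate of U_{εα_i}, so a nontrivial u' of sign -ε is
  -- first rewritten as a m' b', and W-coordinate w is kept. If w is longer, the conjugate of u'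
  -- itself lies in its group.
  by_cases hl : cs.length x.2 < cs.length (x.2 * cs.simple i)
  · by_cases hu1 : u' = 1
    · refine ⟨(x.1, x.2 * cs.simple i), Or.inr rfl, by simp, ?_⟩
      have := hs 1 (one_mem _)
      convert this using 1
      simp only [coverMap, hu1, ← hn0]
      group
    · obtain ⟨a, ha, b', hb', m', hm', he'⟩ := exists_represents_of_ne_one hu' hu1
      rw [Bool.not_not] at ha hb'
      refine ⟨(x.1 * (n * a * n⁻¹), x.2), Or.inl rfl, ?_, ?_⟩
      · simp only [inv_mul_cancel_left]
        exact (le_sup_right : R.invBorel ε (x.2 * cs.simple i) ≤ _)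
          (U_le_invBorel (isInversion_act_signed hl) (hn.permutesAs.conj_mem ha))
      · have h1 := hm.permutesAs.inv_conj_mem hb'
        rw [cs.inv_simple, act_signed] at h1
        have h2 := hm'.mul hm
        rw [cs.simple_mul_simple_self] at h2
        have := mul_mem (mul_mem (torus_le_borel (!ε) h2.mem_torus)
          (U_le_borel (hasSign_signed (!ε) i) h1)) hd
        convert this using 1
        simp only [coverMap, he', ← hn0]
        group
  · refine ⟨(x.1 * (n * u' * n⁻¹), x.2 * cs.simple i), Or.inr rfl, ?_, ?_⟩
    · simp only [inv_mul_cancel_left]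
      refine (le_sup_left : R.invBorel ε x.2 ≤ _) (U_le_invBorel ⟨?_, ?_⟩ hnu)
      · rw [hasSign_act_signed]; simpa using hl
      · rw [act_act, inv_mul_cancel, act_one, ← hasSign_not]
        exact hasSign_signed _ _
    · have := hs 1 (one_mem _)
      convert this using 1
      simp only [coverMap, ← hn0]
      group

/-- Galleries of the building lift. -/
theorem exists_lift_gallery {ε : Bool} {ω : List B} {x : G × W} {g : G}
    (h : (R.coverMap x)⁻¹ * g ∈ R.bruhatCell (!ε) (!ε) (cs.wordProd ω)) :
    ∃ y, R.CoverGal ε ω x y ∧ (R.coverMap y)⁻¹ * g ∈ R.borel (!ε) := by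
  induction ω using List.reverseRecOn generalizing g with
  | nil =>
    rw [cs.wordProd_nil, mem_cell_one] at h
    exact ⟨x, coverGal_nil.2 rfl, h⟩
  | append_singleton ω i ih =>
    rw [← List.concat_eq_append, cs.wordProd_concat] at *
    obtain ⟨b, hb, n, hn, c, hc, he⟩ := h
    obtain ⟨m, hm⟩ := R.exists_represents (cs.simple i)
    have h1 := hn.mul hm.inv
    rw [cs.inv_simple, cs.simple_mul_simple_cancel_right] at h1
    obtain ⟨y, hy, hy'⟩ := ih (g := R.coverMap x * (b * (n * m⁻¹))) (by
      rw [inv_mul_cancel_left]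
      exact mul_mem_cell hb (h1.mem_cell _ _))
    obtain ⟨z, hz, hz'⟩ := exists_lift_panel (ε := ε) (i := i) (x := y) (g := g) (by
      have := mul_mem_cell hy' (cell_mul_mem (hm.mem_cell (!ε) (!ε)) hc)
      convert this using 1
      rw [inv_mul_eq_iff_eq_mul] at he
      rw [he]
      group)
    exact ⟨z, coverGal_concat.2 ⟨y, hy, hz⟩, hz'⟩

theorem CoverGal.map {ε : Bool} {ω : List B} (hω : cs.IsReduced ω) {x y : G × W}
    (h : R.CoverGal ε ω x y) :
    (R.coverMap x)⁻¹ * R.coverMap y ∈ R.bruhatCell (!ε) (!ε) (cs.wordProd ω) := by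
  induction ω using List.reverseRecOn generalizing y with
  | nil =>
    rw [coverGal_nil] at h
    subst h
    simpa using represents_one.mem_cell (R := R) (!ε) (!ε)
  | append_singleton ω i ih =>
    rw [← List.concat_eq_append] at *
    obtain ⟨z, hz, hzy⟩ := coverGal_concat.1 h
    have hr := cs.isReduced_of_concat hω
    have := (cell_mul_simple (ih hr.1 hz) hzy.2.2).1 (by simpa using hr.2)
    rw [cs.wordProd_concat]
    convert this using 1
    group

/-- When W_J is finite, a J-gallery in the cover stays in the chart of the longest element of its
coset w₁ W_J, where `chart_injective` applies. That element is w₁ d⁻¹, the inverse being harmless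
since d is longest in W_J. -/
theorem CoverGal.chart {ε : Bool} {J : Set B} {w₁ d : W} {x y : G × W} {ω : List B}
    (hmin : ∀ u ∈ parabolic cs J, cs.length (w₁ * u) = cs.length w₁ + cs.length u)
    (hd : d ∈ parabolic cs J)
    (hdesc : ∀ i ∈ J, cs.length (d * cs.simple i) < cs.length d)
    (hω : ∀ i ∈ ω, i ∈ J) (h : R.CoverGal ε ω x y)
    (hx : ∃ v ∈ parabolic cs J, x.2 = w₁ * v) :
    (∃ v ∈ parabolic cs J, y.2 = w₁ * v) ∧ x.1⁻¹ * y.1 ∈ R.invBorel ε (w₁ * d⁻¹) := by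
  have hle : ∀ v ∈ parabolic cs J, R.invBorel ε (w₁ * v) ≤ R.invBorel ε (w₁ * d⁻¹) := by
    intro v hv
    have h1 := cs.length_mul_of_descents hdesc hv
    rw [← cs.length_inv (d * v), mul_inv_rev] at h1
    have h2 : w₁ * d⁻¹ = w₁ * v * (v⁻¹ * d⁻¹) := by group
    rw [h2]
    apply invBorel_mono
    rw [← h2, hmin _ (inv_mem hd), hmin _ hv, cs.length_inv d]
    omega
  induction ω using List.reverseRecOn generalizing y with
  | nil =>
    rw [coverGal_nil] at h
    subst h
    exact ⟨hx, by simp⟩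
  | append_singleton ω i ih =>
    rw [← List.concat_eq_append] at h
    obtain ⟨z, hz, hzy⟩ := coverGal_concat.1 h
    obtain ⟨⟨v, hv, hv'⟩, hz1⟩ := ih (fun j hj => hω j (by simp [hj])) hz
    have hi : cs.simple i ∈ parabolic cs J := cs.simple_mem_parabolic (hω i (by simp))
    refine ⟨?_, ?_⟩
    · rcases hzy.1 with e | e
      · exact ⟨v, hv, e.trans hv'⟩
      · exact ⟨v * cs.simple i, mul_mem hv hi, by rw [e, hv', mul_assoc]⟩
    · have h2 := hzy.2.1
      rw [hv', mul_assoc] at h2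
      have h3 := sup_le (hle v hv) (hle _ (mul_mem hv hi)) h2
      have := mul_mem hz1 h3
      convert this using 1
      group

theorem alternatingWord_mem {i j k : B} {m : ℕ} (h : k ∈ alternatingWord i j m) :
    k = i ∨ k = j := by
  induction m generalizing i j with
  | zero => simp [alternatingWord] at h
  | succ m ih =>
    rw [alternatingWord_succ, List.concat_eq_append, List.mem_append, List.mem_singleton] at h
    rcases h with h | h
    · exact (ih h).symm
    · exact Or.inr h

/-- The image of the gallery also has the other type in the building, so it lifts with that type
from the same starting point. Both lifts end over the same chamber and inside one chart, hence at
equivalent points. -/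
theorem coverGal_braid {ε : Bool} (hN : R.NotOppLe (!ε)) {i j : B} {k : ℕ}
    (h1 : cs.IsReduced (alternatingWord i j k)) (h2 : cs.IsReduced (alternatingWord j i k))
    (he : cs.wordProd (alternatingWord i j k) = cs.wordProd (alternatingWord j i k))
    {x y : G × W} (h : R.CoverGal ε (alternatingWord i j k) x y) :
    R.CoverGal ε (alternatingWord j i k) x y := by
  cases k with
  | zero => exact h
  | succ k =>
    set d := cs.wordProd (alternatingWord i j (k + 1)) with hd0
    have hJ : ∀ l ∈ alternatingWord i j (k + 1), l ∈ ({i, j} : Set B) :=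
      fun l hl => alternatingWord_mem hl
    have hJ' : ∀ l ∈ alternatingWord j i (k + 1), l ∈ ({i, j} : Set B) :=
      fun l hl => (alternatingWord_mem hl).symm
    have hd : d ∈ parabolic cs {i, j} := cs.wordProd_mem_parabolic hJ
    have hdesc : ∀ l ∈ ({i, j} : Set B), cs.length (d * cs.simple l) < cs.length d := by
      rintro l (rfl | hl)
      · rw [he, alternatingWord_succ, cs.wordProd_concat, cs.simple_mul_simple_cancel_right]
        exact (cs.isReduced_of_concat h2).2
      · rw [Set.mem_singleton_iff] at hl
        subst hl
        rw [hd0, alternatingWord_succ, cs.wordProd_concat, cs.simple_mul_simple_cancel_right]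
        exact (cs.isReduced_of_concat h1).2
    have hm := h.map h1
    rw [← hd0, he] at hm
    obtain ⟨z, hz, hz'⟩ := exists_lift_gallery hm
    obtain ⟨w₁, v, hv, hx, hmin⟩ := cs.exists_min_coset {i, j} x.2
    obtain ⟨⟨a, ha, ha'⟩, hy⟩ := h.chart hmin hd hdesc hJ ⟨v, hv, hx⟩
    obtain ⟨⟨b, hb, hb'⟩, hzz⟩ := hz.chart hmin hd hdesc hJ' ⟨v, hv, hx⟩
    have h3 := cs.length_mul_of_descents hdesc hb
    rw [← cs.length_inv (d * b), mul_inv_rev] at h3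
    have h4 : z.2 * (b⁻¹ * d⁻¹) = w₁ * d⁻¹ := by rw [hb']; group
    have h5 : y.2 * (a⁻¹ * d⁻¹) = w₁ * d⁻¹ := by rw [ha']; group
    obtain ⟨e1, e2⟩ := chart_injective hN (h4.trans h5.symm)
      (by rw [h4, hb', hmin _ hb, hmin _ (inv_mem hd), cs.length_inv d]; omega)
      (by rw [h4]; exact hzz) (by rw [h4]; exact hy) (rep_spec z.2) (rep_spec y.2) (by
        convert hz' using 1
        simp only [coverMap]
        group)
    -- A gallery may end at any point of an equivalence class only if it has at least one step; this
    -- is why length zero is treated separately.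
    refine hz.trans_eqv (by simp [alternatingWord_succ]) ⟨e1, ?_⟩
    convert e2 using 1
    group

theorem coverGal_of_isReduced {ε : Bool} (hN : R.NotOppLe (!ε)) {ω ω' : List B}
    (h : cs.IsReduced ω) (h' : cs.IsReduced ω') (he : cs.wordProd ω = cs.wordProd ω')
    {x y : G × W} (hg : R.CoverGal ε ω x y) : R.CoverGal ε ω' x y := by
  have := cs.prod_map_eq_of_isReduced (R.coverAdjEnd ε) (fun i j k h1 h2 he => by
    funext x y
    exact propext ⟨coverGal_braid hN h1 h2 he, coverGal_braid hN h2 h1 he.symm⟩) h h' he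
  rw [CoverGal, this] at hg
  exact hg

theorem coverEqv_of_panel {ε : Bool} (hN : R.NotOppLe (!ε)) {i : B} {x y : G × W}
    (h : y.2 = x.2 ∨ y.2 = x.2 * cs.simple i)
    (h' : x.1⁻¹ * y.1 ∈ R.invBorel ε x.2 ⊔ R.invBorel ε (x.2 * cs.simple i))
    (hb : (R.coverMap x)⁻¹ * R.coverMap y ∈ R.borel (!ε)) : R.CoverEqv ε x y := by
  have hb' : (1 * R.rep x.2)⁻¹ * (x.1⁻¹ * y.1 * R.rep y.2) ∈ R.borel (!ε) := by
    convert hb using 1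
    simp only [coverMap]
    group
  have hl := cs.length_mul_simple x.2 i
  have key : ∀ t t', x.2 * t = y.2 * t' → cs.length (x.2 * t) = cs.length x.2 + cs.length t →
      x.1⁻¹ * y.1 ∈ R.invBorel ε (x.2 * t) → R.CoverEqv ε x y := by
    intro t t' h1 h2 h3
    obtain ⟨e1, e2⟩ := chart_injective hN h1 h2 (one_mem _) h3 (rep_spec x.2) (rep_spec y.2) hb'
    exact ⟨e1, by simpa using e2⟩
  rcases hl with hl | hl
  · have h1 := invBorel_le_mul_simple (R := R) (ε := ε) (w := x.2) (i := i) (by omega)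
    rw [sup_eq_right.2 h1] at h'
    rcases h with h | h
    · exact key (cs.simple i) (cs.simple i) (by rw [h]) (by rw [hl, cs.length_simple]) h'
    · exact key (cs.simple i) 1 (by rw [h, mul_one]) (by rw [hl, cs.length_simple]) h'
  · have h1 := invBorel_le_mul_simple (R := R) (ε := ε) (w := x.2 * cs.simple i) (i := i) (by
      rw [cs.simple_mul_simple_cancel_right]; omega)
    rw [cs.simple_mul_simple_cancel_right] at h1
    rw [sup_eq_left.2 h1] at h'
    rcases h with h | h
    · exact key 1 1 (by rw [h]) (by simp) (by simpa using h')
    · exact key 1 (cs.simple i) (by rw [h]; simp) (by simp) (by simpa using h')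

variable (R) in
/-- Points of the covering joined by a gallery of reduced type. -/
def CoverJoined (ε : Bool) (x y : G × W) : Prop :=
  ∃ ω, cs.IsReduced ω ∧ ∃ z, R.CoverGal ε ω x z ∧ R.CoverEqv ε z y

theorem CoverEqv.refl {ε : Bool} (x : G × W) : R.CoverEqv ε x x := ⟨rfl, by simp⟩

theorem CoverEqv.trans {ε : Bool} {x y z : G × W} (h : R.CoverEqv ε x y)
    (h' : R.CoverEqv ε y z) : R.CoverEqv ε x z := by
  refine ⟨h.1.trans h'.1, ?_⟩
  have := h'.2
  rw [← h.1] at this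
  have := mul_mem h.2 this
  convert this using 1
  group

theorem CoverJoined.refl {ε : Bool} (x : G × W) : R.CoverJoined ε x x :=
  ⟨[], by simp [CoxeterSystem.IsReduced], x, coverGal_nil.2 rfl, CoverEqv.refl x⟩

theorem CoverJoined.trans_eqv {ε : Bool} {x y z : G × W} (h : R.CoverJoined ε x y)
    (h' : R.CoverEqv ε y z) : R.CoverJoined ε x z := by
  obtain ⟨ω, h1, t, h2, h3⟩ := h
  exact ⟨ω, h1, t, h2, h3.trans h'⟩

/-- If the new letter shortens the type, braid moves bring that letter to the end. The last two
steps then lie over one panel, and they collapse to a single step or to an equivalence. -/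
theorem CoverJoined.trans_adj {ε : Bool} (hN : R.NotOppLe (!ε)) {i : B} {x y z : G × W}
    (h : R.CoverJoined ε x y) (h' : R.CoverAdj ε i y z) : R.CoverJoined ε x z := by
  obtain ⟨ω, hω, t, ht, hty⟩ := h
  have htz := hty.trans_adj h'
  rcases cs.length_mul_simple (cs.wordProd ω) i with hl | hl
  · exact ⟨ω.concat i, cs.isReduced_concat hω (by omega), z, coverGal_concat.2 ⟨t, ht, htz⟩,
      CoverEqv.refl z⟩
  · obtain ⟨σ, hσ, hσ'⟩ := cs.exists_isReduced (cs.wordProd ω * cs.simple i)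
    have h1 : cs.wordProd ω = cs.wordProd (σ.concat i) := by
      rw [cs.wordProd_concat, ← hσ']; simp
    have h2 : cs.IsReduced (σ.concat i) := by
      apply cs.isReduced_concat hσ
      rw [← hσ', cs.simple_mul_simple_cancel_right]
      omega
    obtain ⟨s, hs, hst⟩ := coverGal_concat.1 (coverGal_of_isReduced hN hω h2 h1 ht)
    have hz2 : z.2 = s.2 ∨ z.2 = s.2 * cs.simple i := by
      rcases hst.1 with e | e <;> rcases htz.1 with e' | e' <;> simp [e, e']
    have hz1 : s.1⁻¹ * z.1 ∈ R.invBorel ε s.2 ⊔ R.invBorel ε (s.2 * cs.simple i) := by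
      have h3 := htz.2.1
      rw [sup_invBorel_symm hst.1] at h3
      have := mul_mem hst.2.1 h3
      convert this using 1
      group
    have h4 : (R.coverMap s)⁻¹ * R.coverMap z =
        ((R.coverMap s)⁻¹ * R.coverMap t) * ((R.coverMap t)⁻¹ * R.coverMap z) := by group
    rcases (cell_mul_simple hst.2.2 htz.2.2).2 with h5 | h5
    · rw [← h4, cs.simple_mul_simple_self, mem_cell_one] at h5
      exact ⟨σ, hσ, s, hs, coverEqv_of_panel hN hz2 hz1 h5⟩
    · rw [← h4] at h5
      exact ⟨σ.concat i, h2, z, coverGal_concat.2 ⟨s, hs, hz2, hz1, h5⟩, CoverEqv.refl z⟩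

theorem coverAdj_same {ε : Bool} (b : G) (w : W) (i : B) :
    R.CoverAdj ε i (b, w) (b, w * cs.simple i) := by
  refine ⟨Or.inr rfl, by simp, ?_⟩
  have := (rep_spec (R := R) w).inv.mul (rep_spec (w * cs.simple i))
  rw [inv_mul_cancel_left] at this
  convert this.mem_cell (!ε) (!ε) using 1
  simp only [coverMap]
  group

theorem coverJoined_iff {ε : Bool} (hN : R.NotOppLe (!ε)) {x : G × W} {b : G} (w : W) :
    R.CoverJoined ε x (b, w) ↔ R.CoverJoined ε x (b, 1) := by
  induction w using cs.simple_induction_right with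
  | one => rfl
  | mul_simple_right w i ih =>
    rw [← ih]
    exact ⟨fun h => h.trans_adj hN (coverAdj_same b w i).symm,
      fun h => h.trans_adj hN (coverAdj_same b w i)⟩

/-- Connectedness: every root group of sign ε consists of inversions of some w. Moving to the
W-coordinate w, changing the representative there and moving back realizes multiplication by that
group. -/
theorem coverJoined_mul {ε : Bool} (hN : R.NotOppLe (!ε)) {x : G × W} {b h : G}
    (hb : R.CoverJoined ε x (b, 1)) (hh : h ∈ R.borel ε) : R.CoverJoined ε x (b * h, 1) := by
  have hstep : ∀ b h w, R.CoverJoined ε x (b, 1) → h ∈ R.invBorel ε w →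
      R.CoverJoined ε x (b * h, 1) := by
    intro b h w hb hh
    rw [← coverJoined_iff hN w] at hb ⊢
    exact hb.trans_eqv ⟨rfl, by simpa using hh⟩
  obtain ⟨y, hy, t, ht, rfl⟩ := exists_borel_decomp hh
  rw [← mul_assoc]
  refine hstep _ t 1 ?_ (torus_le_invBorel _ _ ht)
  have : ∀ b, R.CoverJoined ε x (b, 1) → R.CoverJoined ε x (b * y, 1) := by
    refine iSup_U_induction (R := R) (P := fun α => α.HasSign ε)
      (p := fun y => ∀ b, R.CoverJoined ε x (b, 1) → R.CoverJoined ε x (b * y, 1)) ?_ ?_ ?_ hy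
    · intro α hα u hu b hb
      obtain ⟨w, hw⟩ := exists_not_hasSign_act ε α
      exact hstep b u w hb (U_le_invBorel ⟨hα, hw⟩ hu)
    · intro b hb; simpa using hb
    · intro y z hy hz b hb
      rw [← mul_assoc]
      exact hz _ (hy _ hb)
  exact this b hb

/-- Disjointness in the Birkhoff decomposition, from the Bruhat decomposition of one half. -/
theorem birkhoff_unique {ε : Bool} (hN : R.NotOppLe (!ε)) {w w' : W} {g : G}
    (h : g ∈ R.bruhatCell ε (!ε) w) (h' : g ∈ R.bruhatCell ε (!ε) w') : w = w' := by
  obtain ⟨b, hb, n, hn, c, hc, rfl⟩ := h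
  obtain ⟨b', hb', n', hn', c', hc', he⟩ := h'
  have hj : R.CoverJoined ε (b, w) (b', w') := by
    rw [coverJoined_iff hN]
    have h1 : R.CoverJoined ε (b, w) (b, 1) := (coverJoined_iff hN w).1 (CoverJoined.refl _)
    have := coverJoined_mul hN h1 (mul_mem (inv_mem hb) hb')
    simpa using this
  obtain ⟨ω, hω, z, hz, hzy⟩ := hj
  have hmap := cell_mul_mem (hz.map hω) hzy.map
  -- The two points lie over the same chamber, so the reduced type of a gallery joining them is
  -- trivial and their W-coordinates agree.
  have hB : (R.coverMap (b, w))⁻¹ * R.coverMap (b', w') ∈ R.borel (!ε) := by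
    have t1 := torus_le_borel (!ε) ((rep_spec (R := R) w).inv_mul_mem hn)
    have t2 := torus_le_borel (!ε) (hn'.inv_mul_mem (rep_spec (R := R) w'))
    have := mul_mem (mul_mem t1 (mul_mem hc (inv_mem hc'))) t2
    convert this using 1
    have e : b' = b * n * c * c'⁻¹ * n'⁻¹ := by rw [he]; group
    simp only [coverMap]
    rw [e]
    group
  have h1 : cs.wordProd ω = 1 := by
    refine bruhat_unique hN hmap (mem_cell_one.2 ?_)
    convert hB using 1
    group
  have h2 := hω.eq
  rw [h1, cs.length_one] at h2
  rw [List.eq_nil_of_length_eq_zero h2.symm, coverGal_nil] at hz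
  subst hz
  exact hzy.1

/-- An inclusion would put a representative of s_i into B_ε, and hence into the Birkhoff cells of
both s_i and 1. -/
theorem notOppLe_of_not {ε : Bool} (hN : R.NotOppLe (!ε)) : R.NotOppLe ε := by
  intro i h
  obtain ⟨u, hu, hu1⟩ := exists_ne_one (R := R) (signed cs ε i)
  obtain ⟨a, ha, b, hb, m, hm, he⟩ := exists_represents_of_ne_one hu hu1
  have hmB : m ∈ R.borel ε := by
    have : m = a⁻¹ * u * b⁻¹ := by rw [he]; group
    rw [this]
    exact unip_le_borel ε (mul_mem (mul_mem (inv_mem (h ha)) (U_le_unip (hasSign_signed ε i) hu))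
      (inv_mem (h hb)))
  have h1 := mul_mem_cell hmB (represents_one.mem_cell ε (!ε))
  rw [mul_one] at h1
  have := birkhoff_unique hN (hm.mem_cell ε (!ε)) h1
  have h2 := cs.length_simple i
  rw [this, cs.length_one] at h2
  omega

theorem notOppLe (R : RGDSystem cs G) (ε : Bool) : R.NotOppLe ε := by
  cases ε
  · exact notOppLe_of_not R.notOppLe_true
  · exact R.notOppLe_true

/-- Disjointness in the Bruhat and Birkhoff decompositions. -/
theorem cell_unique {ε ε' : Bool} {w w' : W} {g : G} (h : g ∈ R.bruhatCell ε ε' w)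
    (h' : g ∈ R.bruhatCell ε ε' w') : w = w' := by
  by_cases he : ε' = ε
  · subst he
    exact bruhat_unique (R.notOppLe _) h h'
  · have he : ε' = !ε := by cases ε <;> cases ε' <;> simp_all
    subst he
    exact birkhoff_unique (R.notOppLe _) h h'

end RGDSystem

/-! ### Thick twin buildings and the automorphism of types induced by an involution. -/

namespace TwinChamberData

variable {B W : Type*} [Group W] {M : CoxeterMatrix B}

/-- Coordinates on a twin apartment: a chamber of each sign for each element of `W`, with
the distances and codistances of the thin twin building. -/
structure IsFrame (C : TwinChamberData.{u} W) (F : Bool → W → C.Chamber) : Prop where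
  sign_eq : ∀ ε v, C.sign (F ε v) = ε
  δ_eq : ∀ ε ε' v w, C.δ (F ε v) (F ε' w) = v⁻¹ * w

/-- Thick twin buildings of type `(W, S)` in which every pair of opposite chambers lies in a twin
apartment. -/
structure IsThickTwinBuilding (cs : CoxeterSystem M W) (C : TwinChamberData.{u} W) : Prop where
  δ_symm : ∀ x y, C.δ y x = (C.δ x y)⁻¹
  δ_eq_one : ∀ x y, C.sign x = C.sign y → (C.δ x y = 1 ↔ x = y)
  step : ∀ x y z i, C.sign y = C.sign z → C.δ y z = cs.simple i →
    C.δ x z = C.δ x y * cs.simple i ∨ C.δ x z = C.δ x y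
  step_eq : ∀ x y z i, C.sign y = C.sign z → C.δ y z = cs.simple i →
    (C.sign x = C.sign y ↔ cs.length (C.δ x y) < cs.length (C.δ x y * cs.simple i)) →
    C.δ x z = C.δ x y * cs.simple i
  exists_step : ∀ x y i, ∃ z, C.sign y = C.sign z ∧ C.δ y z = cs.simple i ∧
    C.δ x z = C.δ x y * cs.simple i
  thick : ∀ y i, ∃ z z', z ≠ z' ∧ (C.sign y = C.sign z ∧ C.δ y z = cs.simple i) ∧
    (C.sign y = C.sign z' ∧ C.δ y z' = cs.simple i)
  exists_frame : ∃ F, C.IsFrame F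
  exists_frame_of_opp : ∀ a b, C.sign a ≠ C.sign b → C.δ a b = 1 →
    ∃ F, C.IsFrame F ∧ F (C.sign a) 1 = a ∧ F (C.sign b) 1 = b

namespace IsThickTwinBuilding

variable {cs : CoxeterSystem M W} {C : TwinChamberData.{u} W} (h : C.IsThickTwinBuilding cs)
include h

theorem δ_self (x : C.Chamber) : C.δ x x = 1 := (h.δ_eq_one x x rfl).2 rfl

theorem δ_panel {y z z' : C.Chamber} {i : B} (hz : C.sign y = C.sign z)
    (hz' : C.sign y = C.sign z') (e : C.δ y z = cs.simple i) (e' : C.δ y z' = cs.simple i)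
    (hne : z ≠ z') : C.δ z z' = cs.simple i := by
  have h1 : C.δ z y = cs.simple i := by rw [h.δ_symm, e, cs.inv_simple]
  rcases h.step z y z' i hz' e' with h2 | h2
  · rw [h1, cs.simple_mul_simple_self] at h2
    exact (hne ((h.δ_eq_one z z' (hz.symm.trans hz')).1 h2)).elim
  · rw [h2, h1]

/-- Some z in the panel realizes δ(x, y) s_i. By thickness there is a third chamber, and under the
assumption on lengths the step from z to it is forced back to δ(x, y). -/
theorem exists_stay {x y : C.Chamber} {i : B}
    (hl : C.sign x = C.sign y ↔ cs.length (C.δ x y * cs.simple i) < cs.length (C.δ x y)) :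
    ∃ z, C.sign y = C.sign z ∧ C.δ y z = cs.simple i ∧ C.δ x z = C.δ x y := by
  obtain ⟨z, hz, hyz, hxz⟩ := h.exists_step x y i
  obtain ⟨t, ht, hyt, hne⟩ : ∃ t, C.sign y = C.sign t ∧ C.δ y t = cs.simple i ∧ z ≠ t := by
    obtain ⟨t, t', hne, ⟨h1, h2⟩, h3, h4⟩ := h.thick y i
    by_cases e : z = t
    · exact ⟨t', h3, h4, by rw [e]; exact hne⟩
    · exact ⟨t, h1, h2, e⟩
  refine ⟨t, ht, hyt, ?_⟩
  have hzt := h.δ_panel hz ht hyz hyt hne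
  have := h.step_eq x z t i (hz.symm.trans ht) hzt (by
    rw [hxz, cs.simple_mul_simple_cancel_right, ← hz]; exact hl)
  rw [this, hxz, cs.simple_mul_simple_cancel_right]

/-- An involution reversing signs that respects equality of distances acts on the values of the
distances by an involutive automorphism of `(W, S)`. -/
theorem exists_typeMap {θ : C.Chamber → C.Chamber} (hs : ∀ x, C.sign (θ x) = !C.sign x)
    (hθ : ∀ x, θ (θ x) = x)
    (hδ : ∀ x y x' y', C.sign x = C.sign x' → C.sign y = C.sign y' → C.δ x y = C.δ x' y' →
      C.δ (θ x) (θ y) = C.δ (θ x') (θ y')) :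
    ∃ σ : W →* W, (∀ w, σ (σ w) = w) ∧ (∀ i, ∃ j, σ (cs.simple i) = cs.simple j) ∧
      ∀ x y, C.δ (θ x) (θ y) = σ (C.δ x y) := by
  obtain ⟨F, hF⟩ := h.exists_frame
  let D : Bool → Bool → W → W := fun ε ε' w => C.δ (θ (F ε 1)) (θ (F ε' w))
  have hFD : ∀ ε ε' w, C.δ (F ε 1) (F ε' w) = w := fun ε ε' w => by
    rw [hF.δ_eq, inv_one, one_mul]
  have hD : ∀ x y, C.δ (θ x) (θ y) = D (C.sign x) (C.sign y) (C.δ x y) := fun x y =>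
    hδ _ _ _ _ (hF.sign_eq _ _).symm (hF.sign_eq _ _).symm (hFD _ _ _).symm
  have hDD : ∀ ε ε' w, D (!ε) (!ε') (D ε ε' w) = w := by
    intro ε ε' w
    have := hD (θ (F ε 1)) (θ (F ε' w))
    rw [hs, hs, hF.sign_eq, hF.sign_eq, hθ, hθ, hFD] at this
    exact this.symm
  have hinj : ∀ ε ε' w w', D ε ε' w = D ε ε' w' → w = w' := fun ε ε' w w' e => by
    rw [← hDD ε ε' w, e, hDD]
  have hone : ∀ ε, D ε ε 1 = 1 := fun ε => h.δ_self _
  have hDinv : ∀ ε ε' w, D ε' ε w⁻¹ = (D ε ε' w)⁻¹ := by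
    intro ε ε' w
    have := hD (F ε' w) (F ε 1)
    rw [hF.sign_eq, hF.sign_eq, h.δ_symm (F ε 1), hFD, h.δ_symm (θ (F ε 1))] at this
    exact this.symm
  have hsimple : ∀ ε i, ∃ j, D ε ε (cs.simple i) = cs.simple j := by
    intro ε i
    set w := D ε ε (cs.simple i) with hw
    have hw1 : w ≠ 1 := by
      intro e
      have := hinj ε ε (cs.simple i) 1 (by rw [← hw, e, hone])
      have h1 := cs.length_simple i
      rw [this, cs.length_one] at h1
      omega
    -- For a descent j of w, thickness gives two j-adjacent chambers at distance w from y. Their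
    -- images share an i-panel, so they have distance s_i; applying the involution again identifies
    -- w with s_j.
    obtain ⟨j, hj⟩ := cs.exists_rightDescent_of_ne_one hw1
    set y := θ (F ε 1) with hy
    set x := θ (F ε (cs.simple i)) with hx
    have hyx : C.δ y x = w := rfl
    have hsy : C.sign y = !ε := by rw [hy, hs, hF.sign_eq]
    have hsx : C.sign x = !ε := by rw [hx, hs, hF.sign_eq]
    obtain ⟨z, hz, hxz, hyz⟩ := h.exists_stay (x := y) (y := x) (i := j) (by
      rw [hsx, hsy, hyx]; exact ⟨fun _ => hj, fun _ => rfl⟩)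
    have key : ∀ t, C.sign t = !ε → C.δ y t = w → C.δ (θ y) (θ t) = cs.simple i := by
      intro t ht e
      rw [hD, hsy, ht, e, hw, hDD]
    have k1 := key x hsx hyx
    have k2 := key z (hz ▸ hsx) (hyz.trans hyx)
    have hne : x ≠ z := by
      intro e
      rw [← e, h.δ_self] at hxz
      have h1 := cs.length_simple j
      rw [← hxz, cs.length_one] at h1
      omega
    have hp := h.δ_panel (by simp [hs, hsy, hsx]) (by simp [hs, hsy, ← hz, hsx]) k1 k2
      (fun e => hne (by rw [← hθ x, e, hθ]))
    have := hD (θ x) (θ z)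
    have s1 : C.sign (θ x) = ε := by rw [hs, hsx, Bool.not_not]
    have s2 : C.sign (θ z) = ε := by rw [hs, ← hz, hsx, Bool.not_not]
    rw [hp, hθ, hθ, hxz, s1, s2] at this
    exact ⟨j, by rw [hw, this]⟩
  have hmul1 : ∀ ε ε' w i, D ε ε' (w * cs.simple i) = D ε ε' w * D ε' ε' (cs.simple i) := by
    intro ε ε' w i
    obtain ⟨z, hz, hyz, hxz⟩ := h.exists_step (F ε 1) (F ε' w) i
    rw [hF.sign_eq] at hz
    rw [hFD] at hxz
    have e1 := hD (F ε' w) z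
    rw [hF.sign_eq, ← hz, hyz] at e1
    have e2 := hD (F ε 1) z
    rw [hF.sign_eq, ← hz, hxz] at e2
    obtain ⟨j, hj⟩ := hsimple ε' i
    rw [hj] at e1
    rcases h.step (θ (F ε 1)) (θ (F ε' w)) (θ z) j (by simp [hs, hF.sign_eq, ← hz]) e1 with e | e
    · rw [← e2, e, hj]
    · rw [e2] at e
      have := hinj _ _ _ _ (show _ = D ε ε' w from e)
      have h1 := cs.length_mul_simple_ne w i
      rw [this] at h1
      exact (h1 rfl).elim
  have hmul : ∀ ε ε' w v, D ε ε' (w * v) = D ε ε' w * D ε' ε' v := by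
    intro ε ε' w v
    induction v using cs.simple_induction_right with
    | one => rw [mul_one, hone, mul_one]
    | mul_simple_right v i ih => rw [← mul_assoc, hmul1, hmul1, ih, mul_assoc]
  -- Opposition is preserved: from codistance 1 one can move along any type without changing it,
  -- while a codistance a ≠ 1 drops under every step along a descent of a.
  have hopp : ∀ ε, D ε (!ε) 1 = 1 := by
    intro ε
    by_contra ha
    set a := D ε (!ε) 1 with ha0
    obtain ⟨t, ht⟩ := cs.exists_rightDescent_of_ne_one ha
    have ht : cs.length (a * cs.simple t) < cs.length a := ht
    obtain ⟨i, hi⟩ := hsimple ε t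
    have hi' : D (!ε) (!ε) (cs.simple i) = cs.simple t := by rw [← hi, hDD]
    obtain ⟨z, hz, hyz, hxz⟩ := h.exists_stay (x := F ε 1) (y := F (!ε) 1) (i := i) (by
      rw [hF.sign_eq, hF.sign_eq, hFD]; simp)
    rw [hF.sign_eq] at hz
    have e1 := hD (F (!ε) 1) z
    rw [hF.sign_eq, ← hz, hyz, hi'] at e1
    have e2 := hD (F ε 1) z
    rw [hF.sign_eq, ← hz, hxz, hFD, ← ha0] at e2
    have := h.step_eq (θ (F ε 1)) (θ (F (!ε) 1)) (θ z) t (by simp [hs, hF.sign_eq, ← hz]) e1 (by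
      change _ ↔ cs.length a < cs.length (a * cs.simple t)
      simp only [hs, hF.sign_eq, Bool.not_not, Bool.not_eq_self, false_iff]
      omega)
    rw [e2] at this
    change a = a * cs.simple t at this
    rw [← this] at ht
    omega
  have hopp2 : ∀ ε w, D ε (!ε) w = D (!ε) (!ε) w := by
    intro ε w
    have := hmul ε (!ε) 1 w
    rwa [one_mul, hopp, one_mul] at this
  have hopp3 : ∀ ε w, D ε (!ε) w = D ε ε w := by
    intro ε w
    have h1 := hDinv (!ε) ε w⁻¹
    rw [inv_inv] at h1
    have h2 := hopp2 (!ε) w⁻¹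
    rw [Bool.not_not] at h2
    rw [h1, h2, hDinv ε ε w, inv_inv]
  have hall : ∀ ε ε' w, D ε ε' w = D true true w := by
    intro ε ε' w
    have h1 := hopp2 true w
    have h2 := hopp3 true w
    have h3 := hopp2 false w
    simp only [Bool.not_true, Bool.not_false] at h1 h2 h3
    cases ε <;> cases ε'
    · rw [← h1, h2]
    · exact h3
    · exact h2
    · rfl
  refine ⟨{ toFun := D true true, map_one' := hone true, map_mul' := hmul true true }, ?_, ?_, ?_⟩
  · intro w
    have := hDD true true w
    rw [hall] at this
    exact this
  · exact hsimple true
  · intro x y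
    rw [hD, hall]; rfl

end IsThickTwinBuilding

end TwinChamberData

namespace RGDSystem

open CoxRoot

variable {B W : Type*} [Group W] {M : CoxeterMatrix B} {cs : CoxeterSystem M W}
variable {G : Type u} [Group G] {R : RGDSystem cs G}

/-! ### The twin building of an RGD system -/

variable (R) in
/-- The chamber `g B_ε`. -/
def chamber (ε : Bool) (g : G) : R.twinBuilding.Chamber :=
  (⟨ε, (g : G ⧸ R.borel ε)⟩ : Σ ε : Bool, G ⧸ R.borel ε)

theorem exists_eq_chamber (c : R.twinBuilding.Chamber) : ∃ g, c = R.chamber (R.twinBuilding.sign c) g := by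
  obtain ⟨ε, q⟩ := c
  obtain ⟨g, rfl⟩ := QuotientGroup.mk_surjective q
  exact ⟨g, rfl⟩

@[simp] theorem sign_chamber (ε : Bool) (g : G) : R.twinBuilding.sign (R.chamber ε g) = ε := rfl

theorem chamber_eq_iff {ε : Bool} {g h : G} :
    R.chamber ε g = R.chamber ε h ↔ g⁻¹ * h ∈ R.borel ε := by
  rw [← QuotientGroup.eq]
  constructor
  · intro e
    exact eq_of_heq (Sigma.mk.inj e).2
  · intro e
    exact congrArg (Sigma.mk ε) e

theorem δ_chamber_iff {ε ε' : Bool} {g h : G} {w : W} :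
    R.twinBuilding.δ (R.chamber ε g) (R.chamber ε' h) = w ↔ g⁻¹ * h ∈ R.bruhatCell ε ε' w := by
  have key : ∀ w, (∃ g' h' : G, (g' : G ⧸ R.borel ε) = (g : G ⧸ R.borel ε) ∧
      (h' : G ⧸ R.borel ε') = (h : G ⧸ R.borel ε') ∧ g'⁻¹ * h' ∈ R.bruhatCell ε ε' w) ↔
      g⁻¹ * h ∈ R.bruhatCell ε ε' w := by
    intro w
    constructor
    · rintro ⟨g', h', hg, hh, hc⟩
      rw [QuotientGroup.eq] at hg hh
      have := mul_mem_cell (inv_mem hg) (cell_mul_mem hc hh)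
      convert this using 1
      group
    · intro hc
      exact ⟨g, h, rfl, rfl, hc⟩
  have hspec : g⁻¹ * h ∈ R.bruhatCell ε ε' (R.twinBuilding.δ (R.chamber ε g) (R.chamber ε' h)) := by
    obtain ⟨w, hw⟩ := exists_mem_cell (R := R) ε ε' (g⁻¹ * h)
    have := Classical.epsilon_spec (p := fun w => ∃ g' h' : G,
      (g' : G ⧸ R.borel ε) = (g : G ⧸ R.borel ε) ∧
      (h' : G ⧸ R.borel ε') = (h : G ⧸ R.borel ε') ∧ g'⁻¹ * h' ∈ R.bruhatCell ε ε' w)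
      ⟨w, (key w).2 hw⟩
    exact (key _).1 this
  constructor
  · rintro rfl; exact hspec
  · intro hw; exact cell_unique hspec hw

theorem δ_chamber_spec (ε ε' : Bool) (g h : G) : g⁻¹ * h ∈ R.bruhatCell ε ε'
    (R.twinBuilding.δ (R.chamber ε g) (R.chamber ε' h)) := δ_chamber_iff.1 rfl

theorem δ_chamber_mul (ε ε' : Bool) (k g h : G) :
    R.twinBuilding.δ (R.chamber ε (k * g)) (R.chamber ε' (k * h)) =
      R.twinBuilding.δ (R.chamber ε g) (R.chamber ε' h) := by
  rw [δ_chamber_iff]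
  convert δ_chamber_spec ε ε' g h using 1
  group

theorem isFrame_chamber (k : G) :
    R.twinBuilding.IsFrame (fun ε v => R.chamber ε (k * R.rep v)) where
  sign_eq _ _ := rfl
  δ_eq ε ε' v w := by
    rw [δ_chamber_mul, δ_chamber_iff]
    exact ((rep_spec v).inv.mul (rep_spec w)).mem_cell _ _

theorem chamber_mul_rep_one (ε : Bool) (k : G) :
    R.chamber ε (k * R.rep 1) = R.chamber ε k := by
  rw [chamber_eq_iff]
  have := torus_le_borel ε (inv_mem (rep_spec (R := R) 1).mem_torus)
  simpa using this

theorem isThickTwinBuilding (R : RGDSystem cs G) : R.twinBuilding.IsThickTwinBuilding cs where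
  δ_symm x y := by
    obtain ⟨g, hg⟩ := exists_eq_chamber x
    obtain ⟨h, hh⟩ := exists_eq_chamber y
    rw [hg, hh, δ_chamber_iff]
    have := cell_inv (δ_chamber_spec (R := R) (R.twinBuilding.sign x) (R.twinBuilding.sign y) g h)
    simpa using this
  δ_eq_one x y hs := by
    obtain ⟨g, hg⟩ := exists_eq_chamber x
    obtain ⟨h, hh⟩ := exists_eq_chamber y
    rw [← hs] at hh
    rw [hg, hh, chamber_eq_iff, δ_chamber_iff, mem_cell_one]
  step x y z i hs e := by
    obtain ⟨g, hg⟩ := exists_eq_chamber x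
    obtain ⟨h, hh⟩ := exists_eq_chamber y
    obtain ⟨k, hk⟩ := exists_eq_chamber z
    rw [← hs] at hk
    rw [hh, hk, δ_chamber_iff] at e
    have := (cell_mul_simple (δ_chamber_spec (R := R) (R.twinBuilding.sign x)
      (R.twinBuilding.sign y) g h) e).2
    rw [show g⁻¹ * h * (h⁻¹ * k) = g⁻¹ * k by group, ← δ_chamber_iff, ← δ_chamber_iff] at this
    rw [hg, hh, hk]
    exact this
  step_eq x y z i hs e hl := by
    obtain ⟨g, hg⟩ := exists_eq_chamber x
    obtain ⟨h, hh⟩ := exists_eq_chamber y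
    obtain ⟨k, hk⟩ := exists_eq_chamber z
    rw [← hs] at hk
    rw [hh, hk, δ_chamber_iff] at e
    rw [hg, hh, sign_chamber, sign_chamber] at hl
    have := (cell_mul_simple (δ_chamber_spec (R := R) (R.twinBuilding.sign x)
      (R.twinBuilding.sign y) g h) e).1 hl
    rw [show g⁻¹ * h * (h⁻¹ * k) = g⁻¹ * k by group, ← δ_chamber_iff] at this
    rw [hg, hh, hk]
    exact this
  exists_step x y i := by
    obtain ⟨g, hg⟩ := exists_eq_chamber x
    obtain ⟨h, hh⟩ := exists_eq_chamber y
    obtain ⟨b, hb, n, hn, c, hc, he⟩ := δ_chamber_spec (R := R) (R.twinBuilding.sign x)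
      (R.twinBuilding.sign y) g h
    obtain ⟨m, hm⟩ := R.exists_represents (cs.simple i)
    refine ⟨R.chamber (R.twinBuilding.sign y) (h * (c⁻¹ * m)), rfl, ?_, ?_⟩
    · rw [hh, δ_chamber_iff, inv_mul_cancel_left]
      exact mul_mem_cell (inv_mem hc) (hm.mem_cell _ _)
    · rw [hg, hh, sign_chamber, δ_chamber_iff, ← mul_assoc, he]
      have := mul_mem_cell hb ((hn.mul hm).mem_cell (R.twinBuilding.sign x)
        (R.twinBuilding.sign y))
      convert this using 1
      group
  thick y i := by
    obtain ⟨h, hh⟩ := exists_eq_chamber y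
    set ε := R.twinBuilding.sign y
    obtain ⟨m, hm⟩ := R.exists_represents (cs.simple i)
    obtain ⟨u, hu, hu1⟩ := exists_ne_one (R := R) (signed cs ε i)
    refine ⟨R.chamber ε (h * m), R.chamber ε (h * (u * m)), ?_, ⟨rfl, ?_⟩, rfl, ?_⟩
    · rw [Ne, chamber_eq_iff]
      intro hB
      have h1 := hm.permutesAs.inv_conj_mem hu
      rw [cs.inv_simple, act_signed] at h1
      have h2 := mem_cell_simple_of_ne_one h1 (by
        intro h0
        apply hu1
        rw [mul_eq_one_iff_eq_inv, inv_mul_eq_iff_eq_mul] at h0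
        simpa using h0)
      have h3 : (h * m)⁻¹ * (h * (u * m)) = m⁻¹ * u * m := by group
      rw [h3, ← mem_cell_one] at hB
      have := cell_unique h2 hB
      have h4 := cs.length_simple i
      rw [this, cs.length_one] at h4
      omega
    · rw [hh, δ_chamber_iff, inv_mul_cancel_left]
      exact hm.mem_cell _ _
    · rw [hh, δ_chamber_iff, inv_mul_cancel_left]
      exact mul_mem_cell (U_le_borel (hasSign_signed _ _) hu) (hm.mem_cell _ _)
  exists_frame := ⟨_, isFrame_chamber 1⟩
  exists_frame_of_opp a b hs hab := by
    obtain ⟨g, hg⟩ := exists_eq_chamber a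
    obtain ⟨h, hh⟩ := exists_eq_chamber b
    rw [hg, hh, δ_chamber_iff] at hab
    obtain ⟨b', hb', n, hn, c, hc, he⟩ := hab
    refine ⟨_, isFrame_chamber (g * b'), ?_, ?_⟩
    · rw [chamber_mul_rep_one]
      conv_rhs => rw [hg]
      rw [chamber_eq_iff]
      simpa using inv_mem hb'
    · rw [chamber_mul_rep_one]
      conv_rhs => rw [hh]
      rw [chamber_eq_iff]
      have := mul_mem (torus_le_borel (R.twinBuilding.sign b) hn.mem_torus) hc
      convert this using 1
      rw [inv_mul_eq_iff_eq_mul] at he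
      rw [he]
      group

/-! ### Quasi-flips -/

/-- A normalizing representative of w ≠ 1 would put a simple root group of sign -ε into B_ε,
although its nontrivial elements lie in the double coset of s_i. This makes the action on chambers
an involution. -/
theorem mem_borel_of_normalizes {ε : Bool} {g : G}
    (hg : conjSubgroup g (R.borel ε) = R.borel ε) : g ∈ R.borel ε := by
  obtain ⟨w, b, hb, n, hn, c, hc, rfl⟩ := exists_mem_cell (R := R) ε ε g
  rw [conjSubgroup_mul, conjSubgroup_mul, conjSubgroup_self hc] at hg
  have hg' : conjSubgroup n (R.borel ε) = R.borel ε := by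
    have := congrArg (conjSubgroup b⁻¹) hg
    rwa [← conjSubgroup_mul, inv_mul_cancel, conjSubgroup_one,
      conjSubgroup_self (inv_mem hb)] at this
  by_cases hw : w = 1
  · subst hw
    exact mul_mem (mul_mem hb (torus_le_borel ε hn.mem_torus)) hc
  · exfalso
    obtain ⟨i, hi⟩ := cs.exists_leftDescent_of_ne_one hw
    have hi : cs.length (cs.simple i * w) < cs.length w := hi
    have hpos : ((signed cs (!ε) i).act w⁻¹).HasSign ε := by
      rw [hasSign_act_signed, cs.length_inv, ← cs.length_inv (_ * cs.simple i)]
      simp only [mul_inv_rev, cs.inv_simple, inv_inv]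
      cases ε <;> simp <;> omega
    obtain ⟨u, hu, hu1⟩ := exists_ne_one (R := R) (signed cs (!ε) i)
    have h1 := U_le_borel hpos (hn.permutesAs.inv_conj_mem hu)
    rw [← mem_conjSubgroup, hg', ← mem_cell_one] at h1
    have := cell_unique h1 (mem_cell_simple_of_ne_one hu hu1)
    have h4 := cs.length_simple i
    rw [← this, cs.length_one] at h4
    omega

theorem IsQuasiFlip.conjElt_spec {θ : G ≃* G} (h : R.IsQuasiFlip θ) (ε : Bool) :
    (R.borel ε).map θ.toMonoidHom = conjSubgroup (h.conjElt ε) (R.borel !ε) :=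
  (h.exists_conj ε).choose_spec

theorem IsQuasiFlip.chamberMap_chamber {θ : G ≃* G} (h : R.IsQuasiFlip θ) (ε : Bool) (g : G) :
    h.chamberMap (R.chamber ε g) = R.chamber (!ε) (θ g * h.conjElt ε) := rfl

theorem IsQuasiFlip.sign_chamberMap {θ : G ≃* G} (h : R.IsQuasiFlip θ)
    (c : R.twinBuilding.Chamber) :
    R.twinBuilding.sign (h.chamberMap c) = !R.twinBuilding.sign c := rfl

theorem IsQuasiFlip.chamberMap_chamberMap {θ : G ≃* G} (h : R.IsQuasiFlip θ)
    (c : R.twinBuilding.Chamber) : h.chamberMap (h.chamberMap c) = c := by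
  obtain ⟨g, hg⟩ := exists_eq_chamber c
  generalize R.twinBuilding.sign c = ε at hg
  subst hg
  rw [h.chamberMap_chamber, h.chamberMap_chamber]
  have key : θ (h.conjElt ε) * h.conjElt (!ε) ∈ R.borel ε := by
    have hmem : ∀ ε x, x ∈ R.borel ε ↔
        (h.conjElt ε)⁻¹ * θ x * h.conjElt ε ∈ R.borel (!ε) := by
      intro ε x
      rw [← mem_conjSubgroup, ← h.conjElt_spec, Subgroup.mem_map]
      constructor
      · intro hx; exact ⟨x, hx, rfl⟩
      · rintro ⟨y, hy, e⟩
        have : y = x := θ.injective e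
        rwa [← this]
    have hmem' : ∀ x, (θ (h.conjElt ε) * h.conjElt (!ε))⁻¹ * x *
        (θ (h.conjElt ε) * h.conjElt (!ε)) ∈ R.borel ε ↔ x ∈ R.borel ε := by
      intro x
      rw [hmem ε x, hmem (!ε), Bool.not_not]
      simp only [map_mul, map_inv, h.1, mul_inv_rev, mul_assoc]
    apply mem_borel_of_normalizes
    ext x
    rw [mem_conjSubgroup, hmem']
  have e : R.chamber ε (θ (θ g * h.conjElt ε) * h.conjElt (!ε)) = R.chamber ε g := by
    rw [chamber_eq_iff, map_mul, h.1]
    convert inv_mem key using 1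
    group
  rw [← e, Bool.not_not]

/-- Pairs of chambers with the same signs and the same δ differ by a translation κ in G. The induced
map turns this into translation by θ(κ), under which δ is invariant. -/
theorem IsQuasiFlip.δ_chamberMap {θ : G ≃* G} (h : R.IsQuasiFlip θ)
    (x y x' y' : R.twinBuilding.Chamber) (hx : R.twinBuilding.sign x = R.twinBuilding.sign x')
    (hy : R.twinBuilding.sign y = R.twinBuilding.sign y')
    (e : R.twinBuilding.δ x y = R.twinBuilding.δ x' y') :
    R.twinBuilding.δ (h.chamberMap x) (h.chamberMap y) =
      R.twinBuilding.δ (h.chamberMap x') (h.chamberMap y') := by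
  obtain ⟨g, hg⟩ := exists_eq_chamber x
  obtain ⟨k, hk⟩ := exists_eq_chamber y
  obtain ⟨g', hg'⟩ := exists_eq_chamber x'
  obtain ⟨k', hk'⟩ := exists_eq_chamber y'
  rw [← hx] at hg'
  rw [← hy] at hk'
  generalize R.twinBuilding.sign x = ε at *
  generalize R.twinBuilding.sign y = ε' at *
  obtain ⟨b, hb, n, hn, c, hc, he⟩ := δ_chamber_spec (R := R) ε ε' g k
  obtain ⟨b', hb', n', hn', c', hc', he'⟩ := δ_chamber_spec (R := R) ε ε' g' k'
  rw [← hg, ← hk, e] at hn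
  rw [← hg', ← hk'] at hn'
  have e1 : R.chamber ε g' = R.chamber ε ((g' * b' * b⁻¹ * g⁻¹) * g) := by
    rw [chamber_eq_iff]
    have := mul_mem hb' (inv_mem hb)
    convert this using 1
    group
  have e2 : R.chamber ε' k' = R.chamber ε' ((g' * b' * b⁻¹ * g⁻¹) * k) := by
    rw [chamber_eq_iff]
    have := mul_mem (mul_mem (inv_mem hc') (torus_le_borel ε' (hn'.inv_mul_mem hn))) hc
    convert this using 1
    rw [inv_mul_eq_iff_eq_mul] at he he'
    rw [he, he']
    group
  generalize g' * b' * b⁻¹ * g⁻¹ = κ at e1 e2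
  rw [hg, hk, hg', hk', e1, e2, h.chamberMap_chamber, h.chamberMap_chamber, h.chamberMap_chamber,
    h.chamberMap_chamber, map_mul, map_mul, mul_assoc, mul_assoc, δ_chamber_mul]

end RGDSystem

namespace TwinChamberData

variable {B W : Type*} [Group W] {M : CoxeterMatrix B} {cs : CoxeterSystem M W}
variable {C : TwinChamberData.{u} W}

/-! ### Twin apartments -/

/-- The set of chambers of a frame. -/
def frameSet (F : Bool → W → C.Chamber) : Set C.Chamber := {x | ∃ ε v, F ε v = x}

namespace IsFrame

variable {F : Bool → W → C.Chamber} (hF : C.IsFrame F)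
include hF

theorem injective (ε : Bool) : Function.Injective (F ε) := by
  intro v w e
  have h1 := hF.δ_eq ε ε v w
  rw [← e, hF.δ_eq, inv_mul_cancel] at h1
  exact inv_mul_eq_one.1 h1.symm

theorem isTwinApartment : C.IsTwinApartment (frameSet F) := by
  refine ⟨fun ε => ⟨fun c hc => hc.2, F ε, ⟨?_, (hF.injective ε).injOn, ?_⟩,
    fun v w => hF.δ_eq ε ε v w⟩, ?_⟩
  · intro v _
    exact ⟨⟨ε, v, rfl⟩, hF.sign_eq ε v⟩
  · rintro _ ⟨⟨ε', v, rfl⟩, e⟩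
    rw [hF.sign_eq] at e
    exact ⟨v, trivial, by rw [e]⟩
  · rintro _ ⟨ε, v, rfl⟩
    refine ⟨F (!ε) v, ⟨⟨_, _, rfl⟩, ?_, ?_⟩, ?_⟩
    · simp [hF.sign_eq]
    · rw [hF.δ_eq, inv_mul_cancel]
    · rintro _ ⟨⟨ε', w, rfl⟩, hs, hd⟩
      rw [hF.sign_eq, hF.sign_eq] at hs
      rw [hF.δ_eq, inv_mul_eq_one] at hd
      rw [hd, Bool.eq_not.2 hs.symm]

theorem translate (w : W) : C.IsFrame (fun ε v => F ε (w * v)) where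
  sign_eq _ _ := hF.sign_eq _ _
  δ_eq _ _ _ _ := by rw [hF.δ_eq]; group

omit hF in
theorem frameSet_translate (F : Bool → W → C.Chamber) (w : W) :
    frameSet (fun ε v => F ε (w * v)) = frameSet F := by
  ext x
  constructor
  · rintro ⟨ε, v, e⟩; exact ⟨ε, _, e⟩
  · rintro ⟨ε, v, e⟩; exact ⟨ε, w⁻¹ * v, by rw [← e]; simp⟩

theorem δ_one (ε ε' : Bool) (w : W) : C.δ (F ε 1) (F ε' w) = w := by
  rw [hF.δ_eq, inv_one, one_mul]

theorem eq_of_mem_frameSet {x : C.Chamber} (hx : x ∈ frameSet F) (ε : Bool) :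
    F (C.sign x) (C.δ (F ε 1) x) = x := by
  obtain ⟨ε', v, rfl⟩ := hx
  rw [hF.sign_eq, hF.δ_one]

/-- Descending along w, induction puts the neighbour z into the frame. If x differed from the frame
chamber of its panel, the two would be adjacent, and the forced drop of codistance would contradict
that both have codistance w. Hence an opposite pair determines its twin apartment. -/
theorem eq_of_δ_eq (h : C.IsThickTwinBuilding cs) {ε : Bool} {x : C.Chamber} {w : W}
    (hs : C.sign x = ε) (h1 : C.δ (F ε 1) x = w) (h2 : C.δ (F (!ε) 1) x = w) : x = F ε w := by
  induction hn : cs.length w generalizing w x with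
  | zero =>
    rw [cs.length_eq_zero_iff] at hn
    subst hn
    exact ((h.δ_eq_one _ _ (by rw [hs, hF.sign_eq])).1 h1).symm
  | succ n ih =>
    have hw : w ≠ 1 := by
      rintro rfl
      simp at hn
    obtain ⟨i, hi⟩ := cs.exists_rightDescent_of_ne_one hw
    have hi : cs.length (w * cs.simple i) < cs.length w := hi
    have hl := cs.length_mul_simple w i
    obtain ⟨z, hz, hxz, haz⟩ := h.exists_step (F ε 1) x i
    rw [h1] at haz
    have hbz := h.step_eq (F (!ε) 1) x z i hz hxz (by
      rw [hF.sign_eq, hs, h2]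
      simp only [Bool.not_eq_self, false_iff]
      omega)
    rw [h2] at hbz
    have hzF := ih (hz.symm.trans hs) haz hbz (by omega)
    by_contra hne
    have hzs : C.sign z = ε := hz.symm.trans hs
    have hp := h.δ_panel (y := z) (z := x) (z' := F ε w) (i := i) hz.symm
      (by rw [hzs, hF.sign_eq]) (by rw [h.δ_symm, hxz, cs.inv_simple])
      (by rw [hzF, hF.δ_eq]; simp) hne
    have := h.step_eq (F (!ε) 1) x (F ε w) i (by rw [hs, hF.sign_eq]) hp (by
      rw [hF.sign_eq, hs, h2]
      simp only [Bool.not_eq_self, false_iff]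
      omega)
    rw [hF.δ_one, h2] at this
    rw [← this] at hi
    omega

theorem mem_frameSet_iff (h : C.IsThickTwinBuilding cs) (ε : Bool) {x : C.Chamber} :
    x ∈ frameSet F ↔ C.δ (F ε 1) x = C.δ (F (!ε) 1) x := by
  constructor
  · rintro ⟨ε', v, rfl⟩
    rw [hF.δ_one, hF.δ_one]
  · intro e
    rcases Bool.eq_or_eq_not (C.sign x) ε with hs | hs
    · exact ⟨ε, _, (hF.eq_of_δ_eq h hs rfl e.symm).symm⟩
    · exact ⟨!ε, _, (hF.eq_of_δ_eq h hs rfl (by rw [Bool.not_not, e])).symm⟩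

end IsFrame

/-! ### Residues and galleries -/

namespace IsThickTwinBuilding

variable (h : C.IsThickTwinBuilding cs)
include h

theorem δ_mul_of_length_add {c x d : C.Chamber} (hc : C.sign c = C.sign x)
    (hd : C.sign x = C.sign d)
    (hl : cs.length (C.δ c x * C.δ x d) = cs.length (C.δ c x) + cs.length (C.δ x d)) :
    C.δ c d = C.δ c x * C.δ x d := by
  generalize hu : C.δ x d = u at hl ⊢
  induction hn : cs.length u generalizing u d with
  | zero =>
    rw [cs.length_eq_zero_iff] at hn
    rw [hn] at hu
    rw [← (h.δ_eq_one _ _ hd).1 hu, hn, mul_one]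
  | succ n ih =>
    have hu1 : u ≠ 1 := by
      rintro rfl
      simp at hn
    obtain ⟨i, hi⟩ := cs.exists_rightDescent_of_ne_one hu1
    have hi : cs.length (u * cs.simple i) < cs.length u := hi
    have hl1 := cs.length_mul_simple u i
    obtain ⟨z, hz, hdz, hxz⟩ := h.exists_step x d i
    rw [hu] at hxz
    have hl2 := cs.length_mul_le (C.δ c x) (u * cs.simple i)
    have hl3 := cs.length_mul_simple (C.δ c x * u) i
    rw [mul_assoc] at hl3
    have hcz := ih (hd.trans hz) _ hxz (by omega) (by omega)
    have := h.step_eq c z d i hz.symm (by rw [h.δ_symm, hdz, cs.inv_simple]) (by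
      rw [hcz, ← mul_assoc, cs.simple_mul_simple_cancel_right, mul_assoc]
      have : C.sign c = C.sign z := hc.trans (hd.trans hz)
      simp only [this, true_iff]
      omega)
    rw [this, hcz, ← mul_assoc, cs.simple_mul_simple_cancel_right]

theorem δ_mul_of_length_sub {c x d : C.Chamber} (hc : C.sign c ≠ C.sign x)
    (hd : C.sign x = C.sign d)
    (hl : cs.length (C.δ c x * C.δ x d) + cs.length (C.δ x d) = cs.length (C.δ c x)) :
    C.δ c d = C.δ c x * C.δ x d := by
  generalize hu : C.δ x d = u at hl ⊢
  induction hn : cs.length u generalizing u d with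
  | zero =>
    rw [cs.length_eq_zero_iff] at hn
    rw [hn] at hu
    rw [← (h.δ_eq_one _ _ hd).1 hu, hn, mul_one]
  | succ n ih =>
    have hu1 : u ≠ 1 := by
      rintro rfl
      simp at hn
    obtain ⟨i, hi⟩ := cs.exists_rightDescent_of_ne_one hu1
    have hi : cs.length (u * cs.simple i) < cs.length u := hi
    have hl1 := cs.length_mul_simple u i
    obtain ⟨z, hz, hdz, hxz⟩ := h.exists_step x d i
    rw [hu] at hxz
    have hl2 := cs.length_mul_le (C.δ c x * (u * cs.simple i)) (u * cs.simple i)⁻¹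
    rw [mul_inv_cancel_right, cs.length_inv] at hl2
    have hl3 := cs.length_mul_simple (C.δ c x * u) i
    rw [mul_assoc] at hl3
    have hcz := ih (hd.trans hz) _ hxz (by omega) (by omega)
    have := h.step_eq c z d i hz.symm (by rw [h.δ_symm, hdz, cs.inv_simple]) (by
      rw [hcz, ← mul_assoc, cs.simple_mul_simple_cancel_right, mul_assoc]
      have : ¬ C.sign c = C.sign z := fun e => hc (e.trans (hd.trans hz).symm)
      simp only [this, false_iff]
      omega)
    rw [this, hcz, ← mul_assoc, cs.simple_mul_simple_cancel_right]

theorem residue_spec {J : Set B} {x y : C.Chamber} (hy : y ∈ C.residue cs J x) :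
    C.sign x = C.sign y ∧ ∀ a, ∃ u ∈ parabolic cs J, C.δ a y = C.δ a x * u := by
  induction hy with
  | refl => exact ⟨rfl, fun a => ⟨1, one_mem _, (mul_one _).symm⟩⟩
  | tail _ hyz ih =>
    obtain ⟨i, hi, hs, hd⟩ := hyz
    refine ⟨ih.1.trans hs, fun a => ?_⟩
    obtain ⟨u, hu, e⟩ := ih.2 a
    rcases hd with hd | hd
    · rw [← (h.δ_eq_one _ _ hs).1 hd]
      exact ⟨u, hu, e⟩
    · rcases h.step a _ _ i hs hd with e' | e'
      · exact ⟨u * cs.simple i, mul_mem hu (cs.simple_mem_parabolic hi), by rw [e', e, mul_assoc]⟩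
      · exact ⟨u, hu, e'.trans e⟩

theorem exists_mem_residue {J : Set B} (a x : C.Chamber) {u : W} (hu : u ∈ parabolic cs J) :
    ∃ y ∈ C.residue cs J x, C.δ a y = C.δ a x * u := by
  induction hu using Subgroup.closure_induction_right with
  | one => exact ⟨x, .refl, (mul_one _).symm⟩
  | mul_right u _ s hs ih =>
    obtain ⟨i, hi, rfl⟩ := hs
    obtain ⟨y, hy, e⟩ := ih
    obtain ⟨z, hz, hyz, haz⟩ := h.exists_step a y i
    exact ⟨z, hy.tail ⟨i, hi, hz, .inr hyz⟩, by rw [haz, e, mul_assoc]⟩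
  | mul_inv_cancel u _ s hs ih =>
    obtain ⟨i, hi, rfl⟩ := hs
    obtain ⟨y, hy, e⟩ := ih
    obtain ⟨z, hz, hyz, haz⟩ := h.exists_step a y i
    exact ⟨z, hy.tail ⟨i, hi, hz, .inr hyz⟩, by rw [haz, e, mul_assoc, cs.inv_simple]⟩

end IsThickTwinBuilding

/-! ### Involutions of twin buildings -/

/-- `θ` is an involution of the twin building exchanging the two halves which acts on the values of
the distances by the automorphism `σ` of `(W, S)`. -/
structure IsFlip (cs : CoxeterSystem M W) (θ : C.Chamber → C.Chamber) (σ : W →* W) : Prop where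
  sign_map : ∀ x, C.sign (θ x) = !C.sign x
  map_map : ∀ x, θ (θ x) = x
  type_type : ∀ w, σ (σ w) = w
  type_simple : ∀ i, ∃ j, σ (cs.simple i) = cs.simple j
  δ_map : ∀ x y, C.δ (θ x) (θ y) = σ (C.δ x y)

namespace IsFlip

variable {θ : C.Chamber → C.Chamber} {σ : W →* W} (hf : IsFlip cs θ σ)
include hf

theorem length_type (w : W) : cs.length (σ w) = cs.length w := by
  choose f hfs using hf.type_simple
  have h1 : ∀ ω : List B, σ (cs.wordProd ω) = cs.wordProd (ω.map f) := by
    intro ω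
    induction ω with
    | nil => simp
    | cons i ω ih => rw [cs.wordProd_cons, map_mul, ih, hfs, List.map_cons, cs.wordProd_cons]
  have h2 : ∀ w, cs.length (σ w) ≤ cs.length w := by
    intro w
    obtain ⟨ω, hω, rfl⟩ := cs.exists_isReduced w
    rw [h1, hω]
    exact (cs.length_wordProd_le _).trans (by simp)
  refine le_antisymm (h2 w) ?_
  have := h2 (σ w)
  rwa [hf.type_type] at this

theorem type_injective : Function.Injective σ := fun v w e => by
  rw [← hf.type_type v, e, hf.type_type]

theorem mapsType {s t : B} (hst : σ (cs.simple s) = cs.simple t) : C.MapsType cs θ s t := by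
  intro c d
  unfold Adj
  rw [hf.sign_map, hf.sign_map, hf.δ_map, ← hst, map_eq_one_iff σ hf.type_injective,
    hf.type_injective.eq_iff, Bool.not_inj_iff]

theorem type_δ (h : C.IsThickTwinBuilding cs) (x : C.Chamber) :
    σ (C.δ x (θ x)) = (C.δ x (θ x))⁻¹ := by
  rw [← hf.δ_map, hf.map_map, h.δ_symm]

theorem sign_ne (x : C.Chamber) : C.sign x ≠ C.sign (θ x) := by
  rw [hf.sign_map]; simp

theorem length_mul_type (h : C.IsThickTwinBuilding cs) (x : C.Chamber) (v : W) :
    cs.length (C.δ x (θ x) * σ v) = cs.length (v⁻¹ * C.δ x (θ x)) := by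
  rw [← hf.length_type (v⁻¹ * _), map_mul, hf.type_δ h, ← cs.length_inv]
  simp

/-- Since σ(w) = w⁻¹, right multiplication by σ(s) shortens w as well. Codistances are forced to
drop, first in passing from θ(c) to θ(d), then from c to d; the second step also shortens, as
otherwise folding would give s w σ(s) = w. -/
theorem δ_map_of_adj (h : C.IsThickTwinBuilding cs) {c d : C.Chamber} {i : B}
    (hs : C.sign c = C.sign d) (hd : C.δ c d = cs.simple i)
    (hl : cs.length (cs.simple i * C.δ c (θ c)) < cs.length (C.δ c (θ c)))
    (hne : cs.simple i * C.δ c (θ c) * σ (cs.simple i) ≠ C.δ c (θ c)) :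
    C.δ d (θ d) = cs.simple i * C.δ c (θ c) * σ (cs.simple i) ∧
      cs.length (C.δ d (θ d)) < cs.length (C.δ c (θ c)) := by
  obtain ⟨j, hj⟩ := hf.type_simple i
  have hl1 := hf.length_mul_type h c (cs.simple i)
  rw [cs.inv_simple, hj] at hl1
  have e1 := h.step_eq c (θ c) (θ d) j (by rw [hf.sign_map, hf.sign_map, hs])
    (by rw [hf.δ_map, hd, hj]) (by
      simp only [hf.sign_ne c, false_iff]
      omega)
  generalize hw : C.δ c (θ c) = w at *
  have hl2 : cs.length (cs.simple i * (w * cs.simple j)) < cs.length (w * cs.simple j) := by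
    by_contra hcon
    have h1 := cs.length_simple_mul (w * cs.simple j) i
    apply hne
    rw [hj]
    have := cs.simple_mul_eq_mul_simple (i := i) (j := j) (x := w * cs.simple j) (by omega) (by
      rw [cs.simple_mul_simple_cancel_right]
      omega)
    rw [mul_assoc, this, cs.simple_mul_simple_cancel_right]
  have e2 := h.step_eq (θ d) c d i hs hd (by
    rw [h.δ_symm c, e1, ← cs.length_inv (_ * cs.simple i), mul_inv_rev _ (cs.simple i), inv_inv,
      cs.inv_simple, cs.length_inv]
    have : C.sign (θ d) ≠ C.sign c := by rw [hs]; exact (hf.sign_ne d).symm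
    simp only [this, false_iff]
    omega)
  rw [h.δ_symm c, e1] at e2
  have e3 : C.δ d (θ d) = cs.simple i * w * cs.simple j := by
    rw [h.δ_symm, e2]
    simp [mul_assoc]
  rw [e3, hj]
  refine ⟨rfl, ?_⟩
  rw [mul_assoc]
  omega

end IsFlip

end TwinChamberData

/-! ### Construction of stable twin apartments. -/

namespace TwinChamberData

variable {B W : Type*} [Group W] {M : CoxeterMatrix B} {cs : CoxeterSystem M W}
variable {C : TwinChamberData.{u} W}

namespace IsFlip

variable {θ : C.Chamber → C.Chamber} {σ : W →* W} (hf : IsFlip cs θ σ)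
include hf

/-- If `s w σ(s) = w` for every left descent `s` of `w = δ(c, θ(c))`, then `w` is the longest
element of the parabolic subgroup generated by its left descents. -/
theorem mem_parabolic_of_stable (h : C.IsThickTwinBuilding cs) {c : C.Chamber} {I : Set B} {w : W}
    (hw : C.δ c (θ c) = w)
    (hI : ∀ i, i ∈ I ↔ cs.length (cs.simple i * w) < cs.length w)
    (hst : ∀ i ∈ I, cs.simple i * w * σ (cs.simple i) = w) :
    w ∈ parabolic cs I := by
  obtain ⟨b, v, hv, he, hb⟩ := cs.exists_left_min_coset I w
  by_cases hb1 : b = 1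
  · rw [he, hb1, mul_one]; exact hv
  exfalso
  obtain ⟨t, ht⟩ := cs.exists_rightDescent_of_ne_one hb1
  have ht : cs.length (b * cs.simple t) < cs.length b := ht
  obtain ⟨j, hj⟩ := hf.type_simple t
  have hj' : σ (cs.simple j) = cs.simple t := by rw [← hj, hf.type_type]
  have hl := hf.length_mul_type h c (cs.simple j)
  rw [hw, hj', cs.inv_simple] at hl
  have hjI : j ∈ I := by
    rw [hI, ← hl]
    have h1 := hb v hv
    rw [← he] at h1
    have h2 := cs.length_mul_le v (b * cs.simple t)
    rw [← mul_assoc, ← he] at h2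
    omega
  have h1 := hst j hjI
  rw [hj', he] at h1
  -- The right descent t of b is one of w, so j = σ(t) is a left descent. Stability then writes b
  -- s_t as an element of W_I times b, which cannot be shorter than b.
  have h2 : b * cs.simple t = v⁻¹ * cs.simple j * v * b := by
    calc b * cs.simple t = v⁻¹ * cs.simple j * (cs.simple j * (v * b) * cs.simple t) := by
          simp [mul_assoc]
      _ = _ := by rw [h1]; group
  rw [h2, hb _ (mul_mem (mul_mem (inv_mem hv) (cs.simple_mem_parabolic hjI)) hv)] at ht
  omega

/-- Passing to a chamber opposite within a rank one or two residue. -/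
theorem exists_longer (h : C.IsThickTwinBuilding cs) (hfix : C.LocallyFixesOpposite cs θ)
    {c x : C.Chamber} {I : Set B} {w : W} (hwI : w ∈ parabolic cs I)
    (hl : ∀ i ∈ I, cs.length (w * cs.simple i) < cs.length w)
    (hst : ∀ i ∈ I, cs.simple i * w * σ (cs.simple i) = w)
    (hσI : ∀ i ∈ I, ∃ j ∈ I, σ (cs.simple i) = cs.simple j) (hinv : w⁻¹ = w) (hσw : σ w = w)
    (hs : C.sign c = C.sign x) (hv : C.δ c x ∈ parabolic cs I)
    (hσv : σ (C.δ c x) = C.δ c x) (hx : C.δ x (θ x) = w) (hne : C.δ c x ≠ w) :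
    ∃ d, C.sign c = C.sign d ∧ C.δ c d ∈ parabolic cs I ∧ σ (C.δ c d) = C.δ c d ∧
      C.δ d (θ d) = w ∧ cs.length (C.δ c x) < cs.length (C.δ c d) := by
  have hmax : ∀ u ∈ parabolic cs I, cs.length u ≤ cs.length w := fun u hu => by
    have := cs.length_mul_of_descents hl hu
    omega
  obtain ⟨s, hsI, hsl⟩ : ∃ s ∈ I, cs.length (C.δ c x) < cs.length (C.δ c x * cs.simple s) := by
    by_contra! hcon
    apply hne
    refine cs.eq_of_descents_of_length_le hv (fun i hi => ?_) hwI (hmax _ hv)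
    have h1 := hcon i hi
    have h2 := cs.length_mul_simple (C.δ c x) i
    omega
  obtain ⟨t, htI, hst'⟩ := hσI s hsI
  have hts : σ (cs.simple t) = cs.simple s := by rw [← hst', hf.type_type]
  -- Since δ(c, x) is fixed by σ, the whole orbit {s, σ(s)} consists of ascents, so distances add
  -- when moving from x into this residue.
  set J : Set B := {s, t} with hJ
  have hJI : J ⊆ I := by
    rintro i (rfl | rfl)
    · exact hsI
    · exact htI
  have hasc : ∀ i ∈ J, cs.length (C.δ c x) < cs.length (C.δ c x * cs.simple i) := by
    rintro i (rfl | rfl)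
    · exact hsl
    · rw [← hf.length_type (_ * cs.simple i), map_mul, hσv, hts]
      exact hsl
  have hσJ : ∀ u ∈ parabolic cs J, σ u ∈ parabolic cs J := by
    intro u hu
    have : parabolic cs J ≤ (parabolic cs J).comap σ := by
      rw [parabolic, Subgroup.closure_le]
      rintro _ ⟨i, hi, rfl⟩
      change σ (cs.simple i) ∈ parabolic cs J
      rcases hi with rfl | rfl
      · rw [hst']; exact cs.simple_mem_parabolic (.inr rfl)
      · rw [hts]; exact cs.simple_mem_parabolic (.inl rfl)
    exact this hu
  have hconj : ∀ u ∈ parabolic cs I, u * w = w * σ u := by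
    intro u hu
    have : parabolic cs I ≤ (MonoidHom.eqLocus (MulAut.conj w⁻¹).toMonoidHom σ) := by
      rw [parabolic, Subgroup.closure_le]
      rintro _ ⟨i, hi, rfl⟩
      change w⁻¹ * cs.simple i * w⁻¹⁻¹ = σ (cs.simple i)
      calc w⁻¹ * cs.simple i * w⁻¹⁻¹
          = w⁻¹ * cs.simple i * (cs.simple i * w * σ (cs.simple i)) := by rw [hst i hi, inv_inv]
        _ = _ := by simp [mul_assoc]
    have h1 : w⁻¹ * u * w⁻¹⁻¹ = σ u := this hu
    rw [← h1]; group
  set Q := C.residue cs J x with hQ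
  have hres := fun {y} (hy : y ∈ Q) => h.residue_spec hy
  have hxQ : x ∈ Q := .refl
  have hcod : ∀ y ∈ Q, ∃ u ∈ parabolic cs J, C.δ (θ y) x = w * u := by
    intro y hy
    obtain ⟨u, hu, e⟩ := (hres hy).2 (θ x)
    refine ⟨u⁻¹, inv_mem hu, ?_⟩
    rw [h.δ_symm x (θ x), hx, hinv] at e
    rw [← hf.map_map x, hf.δ_map, h.δ_symm (θ x) y, e, mul_inv_rev, hinv,
      hconj _ (inv_mem (cs.parabolic_mono hJI hu)), map_mul, hσw, hf.type_type]
  have hmem : ∀ y ∈ Q, ∀ z ∈ Q, C.δ y (θ z) ∈ parabolic cs I := by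
    intro y hy z hz
    obtain ⟨u, hu, e⟩ := hcod z hz
    obtain ⟨u', hu', e'⟩ := (hres hy).2 (θ z)
    rw [h.δ_symm (θ z), e', e]
    exact inv_mem (mul_mem (mul_mem hwI (cs.parabolic_mono hJI hu)) (cs.parabolic_mono hJI hu'))
  have hex : ∀ y ∈ Q, ∃ z ∈ Q, C.δ (θ y) z = w := by
    intro y hy
    obtain ⟨u, hu, e⟩ := hcod y hy
    obtain ⟨z, hz, e'⟩ := h.exists_mem_residue (θ y) x (inv_mem hu)
    exact ⟨z, hz, by rw [e', e, mul_inv_cancel_right]⟩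
  have hex' : ∀ y ∈ Q, ∃ z ∈ Q, C.δ y (θ z) = w := by
    intro y hy
    obtain ⟨z, hz, e⟩ := hex y hy
    exact ⟨z, hz, by rw [← hf.map_map y, hf.δ_map, e, hσw]⟩
  have hpar : C.Parallel cs Q (θ '' Q) := by
    constructor
    · refine Set.Subset.antisymm (fun y ⟨_, _, hy⟩ => hy.1) fun y hy => ?_
      obtain ⟨z, hz, e⟩ := hex' y hy
      refine ⟨θ z, ⟨z, hz, rfl⟩, hy, fun y' hy' => ?_⟩
      rw [e]
      exact hmax _ (hmem y' hy' z hz)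
    · refine Set.Subset.antisymm (fun y ⟨_, _, hy⟩ => hy.1) ?_
      rintro _ ⟨y, hy, rfl⟩
      obtain ⟨z, hz, e⟩ := hex y hy
      refine ⟨z, hz, ⟨y, hy, rfl⟩, ?_⟩
      rintro _ ⟨y', hy', rfl⟩
      rw [e, h.δ_symm, cs.length_inv]
      exact hmax _ (hmem z hz y' hy')
  obtain ⟨d, hd, hproj, hlong⟩ := hfix J x
    ((cs.finite_parabolic_of_descents hl).subset (cs.parabolic_mono hJI))
    ⟨s, t, hf.mapsType hst', rfl⟩ hpar x hxQ
    ⟨hxQ, fun y hy => by rw [hx]; exact hmax _ (hmem y hy x hxQ)⟩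
  have hdw : C.δ d (θ d) = w := by
    obtain ⟨z, hz, e⟩ := hex d hd
    have := hproj.2 z hz
    rw [h.δ_symm (θ d) z, e, cs.length_inv] at this
    exact (cs.eq_of_descents_of_length_le hwI hl (hmem d hd d hd) this).symm
  set u := C.δ x d with hu
  have hul : ∀ i ∈ J, cs.length (u * cs.simple i) < cs.length u := by
    intro i hi
    have h1 := hlong.2 _ (mul_mem hlong.1 (cs.simple_mem_parabolic hi))
    have h2 := cs.length_mul_simple u i
    omega
  -- The longest element of W_J is unique and σ preserves W_J; hence δ(c, d) is again fixed by σ and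
  -- the construction can be repeated.
  have hσu : u = σ u := cs.eq_of_descents_of_length_le hlong.1 hul (hσJ u hlong.1)
    (hf.length_type u).ge
  have hadd := cs.length_mul_of_ascents hasc hlong.1
  have hcd := h.δ_mul_of_length_add hs (hres hd).1 hadd
  refine ⟨d, hs.trans (hres hd).1, ?_, ?_, hdw, ?_⟩
  · rw [hcd]; exact mul_mem hv (cs.parabolic_mono hJI hlong.1)
  · rw [hcd, map_mul, hσv, ← hu, ← hσu]
  · have := hul s (.inl rfl)
    rw [hcd, hadd]
    omega

/-- As w² = 1, the chambers c and θ(d) are opposite, and d and θ(c) are the opposite pair at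
position w of their twin apartment. Membership can be tested from either pair, and θ translates one
test into the other. -/
theorem exists_frame_of_eq (h : C.IsThickTwinBuilding cs) {c d : C.Chamber} {w : W}
    (hs : C.sign c = C.sign d) (hcd : C.δ c d = w) (hc : C.δ c (θ c) = w) (hd : C.δ d (θ d) = w)
    (hinv : w⁻¹ = w) (hσw : σ w = w) :
    ∃ F, C.IsFrame F ∧ c ∈ frameSet F ∧ ∀ x ∈ frameSet F, θ x ∈ frameSet F := by
  have hww : w * w = 1 := by
    nth_rewrite 1 [← hinv]
    exact inv_mul_cancel w
  have hdc : C.δ d c = w := by rw [h.δ_symm c, hcd, hinv]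
  have hdd : C.δ (θ d) d = w := by rw [h.δ_symm d, hd, hinv]
  have hopp : C.δ (θ d) c = 1 := by
    rw [h.δ_mul_of_length_sub (x := d) (hf.sign_ne d).symm hs.symm (by rw [hdc, hdd, hww]; simp),
      hdc, hdd, hww]
  have hsd : C.sign (θ d) = !C.sign c := by rw [hf.sign_map, hs]
  obtain ⟨F, hF, hF1, hF2⟩ := h.exists_frame_of_opp c (θ d) (by rw [hsd]; simp)
    (by rw [h.δ_symm (θ d), hopp, inv_one])
  rw [hsd] at hF2
  have hmem : ∀ x, x ∈ frameSet F ↔ C.δ c x = C.δ (θ d) x := fun x => by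
    rw [hF.mem_frameSet_iff h (C.sign c), hF1, hF2]
  have hcF : c ∈ frameSet F := ⟨_, _, hF1⟩
  have hdF : d ∈ frameSet F := (hmem d).2 (by rw [hcd, hdd])
  have hθc : θ c ∈ frameSet F := (hmem _).2 (by rw [hc, hf.δ_map, hdc, hσw])
  have hF3 : F (C.sign c) w = d := by
    have := hF.eq_of_mem_frameSet hdF (C.sign c)
    rwa [hF1, hcd, ← hs] at this
  have hF4 : F (!C.sign c) w = θ c := by
    have := hF.eq_of_mem_frameSet hθc (C.sign c)
    rwa [hF1, hc, hf.sign_map] at this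
  refine ⟨F, hF, hcF, fun x hx => ?_⟩
  rw [← IsFrame.frameSet_translate F w, (hF.translate w).mem_frameSet_iff h (C.sign c), mul_one,
    hF3, hF4, hf.δ_map, (hmem x).1 hx, ← hf.δ_map, hf.map_map]

theorem exists_stable_frame (h : C.IsThickTwinBuilding cs) (hfix : C.LocallyFixesOpposite cs θ)
    (c : C.Chamber) :
    ∃ F, C.IsFrame F ∧ c ∈ frameSet F ∧ ∀ x ∈ frameSet F, θ x ∈ frameSet F := by
  induction hn : cs.length (C.δ c (θ c)) using Nat.strong_induction_on generalizing c with
  | _ n ih =>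
  subst hn
  generalize hw : C.δ c (θ c) = w at ih
  by_cases hA : ∃ i, cs.length (cs.simple i * w) < cs.length w ∧
      cs.simple i * w * σ (cs.simple i) ≠ w
  · obtain ⟨i, hl, hne⟩ := hA
    subst hw
    obtain ⟨d, -, -, ⟨hs, hd⟩, -⟩ := h.thick c i
    obtain ⟨e, hlt⟩ := hf.δ_map_of_adj h hs hd hl hne
    obtain ⟨F, hF, hdF, hθF⟩ := ih _ hlt d rfl
    refine ⟨F, hF, ?_, hθF⟩
    have hθd := hθF d hdF
    have hF1 := hF.eq_of_mem_frameSet hdF true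
    have hF2 := hF.eq_of_mem_frameSet hθd true
    set v := C.δ (F true 1) d
    set v' := C.δ (F true 1) (θ d)
    have hvv : v⁻¹ * v' = C.δ d (θ d) := by
      conv_rhs => rw [← hF2, ← hF1, hF.δ_eq]
    -- This is the s_i-neighbour of d in the stable apartment. If it were not c, it would be
    -- s_i-adjacent to c and have codistance s w σ(s) to its image; computed inside the apartment
    -- that codistance is w.
    set d' := F (C.sign d) (v * cs.simple i) with hd'
    have hsd : C.sign d = C.sign d' := (hF.sign_eq _ _).symm
    have hdd : C.δ d d' = cs.simple i := by
      rw [hd']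
      nth_rewrite 1 [← hF1]
      rw [hF.δ_eq, inv_mul_cancel_left]
    by_contra hcF
    have hne' : c ≠ d' := by
      rintro e
      exact hcF ⟨_, _, e.symm⟩
    have hcd' := h.δ_panel hs.symm hsd (by rw [h.δ_symm, hd, cs.inv_simple]) hdd hne'
    obtain ⟨e', -⟩ := hf.δ_map_of_adj h (hs.trans hsd) hcd' hl hne
    have hF3 := hF.eq_of_mem_frameSet (hθF d' ⟨_, _, rfl⟩) true
    have h1 : v'⁻¹ * C.δ (F true 1) (θ d') = σ (cs.simple i) := by
      rw [← hdd, ← hf.δ_map]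
      conv_rhs => rw [← hF2, ← hF3, hF.δ_eq]
    have h2 : C.δ d' (θ d') = (v * cs.simple i)⁻¹ * C.δ (F true 1) (θ d') := by
      conv_lhs => rw [← hF3, hd', hF.δ_eq]
    apply hne
    rw [← e', h2, eq_mul_of_inv_mul_eq h1, ← mul_assoc, mul_inv_rev, mul_assoc _ v⁻¹, hvv, e,
      cs.inv_simple]
    simp only [mul_assoc, cs.simple_mul_simple_cancel_left, ← map_mul, cs.simple_mul_simple_self,
      map_one, mul_one]
  · push Not at hA
    set I : Set B := {i | cs.length (cs.simple i * w) < cs.length w}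
    have hwI := hf.mem_parabolic_of_stable h (I := I) hw (fun i => Iff.rfl) hA
    -- The element w⁻¹ has every i in I as a right descent and lies in W_I, so it is the longest
    -- element there; w has the same length and must coincide with it.
    have hinv : w⁻¹ = w := cs.eq_of_descents_of_length_le (J := I) (inv_mem hwI) (fun i hi => by
      have hi : cs.length (cs.simple i * w) < cs.length w := hi
      rw [← cs.length_inv]
      simpa using hi) hwI (cs.length_inv w).le
    have hσw : σ w = w := by
      rw [← hw, hf.type_δ h, hw, hinv]
    have hl : ∀ i ∈ I, cs.length (w * cs.simple i) < cs.length w := fun i hi => by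
      have hi : cs.length (cs.simple i * w) < cs.length w := hi
      rw [← cs.length_inv]
      simpa [hinv] using hi
    have hσI : ∀ i ∈ I, ∃ j ∈ I, σ (cs.simple i) = cs.simple j := by
      intro i hi
      obtain ⟨j, hj⟩ := hf.type_simple i
      refine ⟨j, ?_, hj⟩
      change cs.length (cs.simple j * w) < cs.length w
      rw [← hj, ← hσw, ← map_mul, hf.length_type, hσw]
      exact hi
    -- Induction on the defect ℓ(w) - ℓ(δ(c, x)), starting at x = c; it is a genuine defect because
    -- w is longest in W_I.
    have key : ∀ k x, C.sign c = C.sign x → C.δ c x ∈ parabolic cs I → σ (C.δ c x) = C.δ c x →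
        C.δ x (θ x) = w → cs.length w - cs.length (C.δ c x) = k →
        ∃ d, C.sign c = C.sign d ∧ C.δ c d = w ∧ C.δ d (θ d) = w := by
      intro k
      induction k using Nat.strong_induction_on with
      | _ k ihk =>
      intro x hs hv hσv hx hk
      by_cases hne : C.δ c x = w
      · exact ⟨x, hs, hne, hx⟩
      obtain ⟨d, h1, h2, h3, h4, h5⟩ := hf.exists_longer h hfix hwI hl hA hσI hinv hσw hs hv hσv
        hx hne
      have := cs.length_mul_of_descents hl h2
      exact ihk _ (by omega) d h1 h2 h3 h4 rfl
    obtain ⟨d, hs, hcd, hd⟩ := key _ c rfl (by rw [h.δ_self]; exact one_mem _)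
      (by rw [h.δ_self, map_one]) hw rfl
    exact hf.exists_frame_of_eq h hs hcd hw hd hinv hσw

end IsFlip

end TwinChamberData

/-- For an RGD system of type `(W, S)` and a quasi-flip `θ` of `G` that locally fixes opposite
chambers of the associated twin building, every chamber lies in a `θ`-stable twin apartment. -/
theorem mainTheorem7 {B W G : Type*} [Group W] [Group G] {M : CoxeterMatrix B}
    (cs : CoxeterSystem M W) (R : RGDSystem cs G) (θ : G ≃* G) (hθ : R.IsQuasiFlip θ)
    (hfix : R.twinBuilding.LocallyFixesOpposite cs hθ.chamberMap)
    (c : R.twinBuilding.Chamber) :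
    ∃ A : Set R.twinBuilding.Chamber,
      R.twinBuilding.IsTwinApartment A ∧ hθ.chamberMap '' A = A ∧ c ∈ A := by
  have h := R.isThickTwinBuilding
  obtain ⟨σ, h1, h2, h3⟩ := h.exists_typeMap hθ.sign_chamberMap hθ.chamberMap_chamberMap
    hθ.δ_chamberMap
  have hf : TwinChamberData.IsFlip cs hθ.chamberMap σ :=
    ⟨hθ.sign_chamberMap, hθ.chamberMap_chamberMap, h1, h2, h3⟩
  obtain ⟨F, hF, hc, hst⟩ := hf.exists_stable_frame h hfix c
  refine ⟨_, hF.isTwinApartment, Set.Subset.antisymm ?_ fun x hx => ?_, hc⟩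
  · rintro _ ⟨x, hx, rfl⟩
    exact hst x hx
  · exact ⟨_, hst x hx, hθ.chamberMap_chamberMap x⟩
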